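/- **Setting.** Let $n\ge 1$ nodes have data distributions $\mathcal D_1,\dots,\mathcal D_n$ and stochastic objectives $F_i(x,\xi)$, $x\in\mathbb R^d$; put $f_i(x)=\mathbb E_{\xi\sim\mathcal D_i}F_i(x,\xi)$ (assumed finite) and $f=\frac1n\sum_i f_i$. For $X=[x_1,\dots,x_n]\in\mathbb R^{d\times n}$ let $\overline X=X\frac{\mathbf 1\mathbf 1^\top}{n}$, $\partial f(X)=[\nabla f_1(x_1),\dots,\nabla f_n(x_n)]$ and $\overline{\partial f}(X)=\partial f(X)\frac{\mathbf 1\mathbf 1^\top}{n}$. For each $t\ge 0$ let $\mathcal W^{(t)}$ be a probability distribution on doubly stochastic $n\times n$ matrices (with nonnegative entries). D-SGD with constant stepsize $\eta$, started with all nodes at the same point $x_0$, is $$X^{(0)}=x_0\mathbf 1^\top,\qquad X^{(t+1)}=\bigl(X^{(t)}-\eta\,[\nabla F_i(x_i^{(t)},\xi_i^{(t)})]_{i=1}^n\bigr)W^{(t)},\qquad \xi_i^{(t)}\sim\mathcal D_i,\quad W^{(t)}\sim\mathcal W^{(t)},$$ all these samples being independent. Write $\overline x^{(t)}=\frac1n\sum_i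 x_i^{(t)}$. **Assumptions.** (i) *$L$-smoothness*: for each $i$ and $\mathcal D_i$-almost every $\xi$, $F_i(\cdot,\xi)$ is differentiable with $L$-Lipschitz gradient, $L\ge 0$. (ii) *Consensus factor* $p\in(0,1]$: $\mathbb E_{W\sim\mathcal W^{(t)}}\|XW-\overline X\|_F^2\le(1-p)\|X-\overline X\|_F^2$ for all $X$ and $t$. Further conditions, used where indicated: *bounded variance* $\sigma\ge 0$ means $\frac1n\sum_i\mathbb E_{\xi\sim\mathcal D_i}\|\nabla F_i(x,\xi)-\nabla f_i(x)\|^2\le\sigma^2$ for all $x$; *relative heterogeneity* $\zeta'\ge 0$ means $\mathbb E_{W\sim\mathcal W^{(t)}}\frac1n\|\partial f(\overline X)W-\overline{\partial f}(\overline X)\|_F^2\le\zeta'^2$ for all $X$ and $t$. The corresponding constants at a minimizer $x^\star$ of $f$ are $\sigma_\star$, with the first bound required only at $x=x^\star$, and $\zeta'_\star$, with $\mathbb E_{W\sim\mathcal W^{(t)}}\frac1n\|\partial f(X_\star)W-\overline{\partial f}(X_\star)\|_F^2\le\zeta_\star'^2$ for all $t$, $X_\star=x^\star\mathbf 1^\top$.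 The functions $f_i$ are *$\mu$-convex* if $f_i(x)-f_i(y)+\frac\mu2\|x-y\|^2\le\langle\nabla f_i(x),x-y\rangle$ for all $i,x,y$. **Theorem.** Let (i) and (ii) hold. There is a universal constant $C>0$ (independent of all the data above, including $d$ and $n$) such that for every $\varepsilon>0$ the following holds; in each case $\eta>0$ is a stepsize with $\eta L\le p$ that does not depend on $T$, and all expectations below are finite. 1. **Non-convex.** Suppose bounded variance $\sigma$ and relative heterogeneity $\zeta'$, and let $f^\star=\inf f>-\infty$ and $F_0=f(x_0)-f^\star$. Then there is $\eta$ such that $\frac1{T+1}\sum_{t=0}^T\mathbb E\|\nabla f(\overline x^{(t)})\|^2\le\varepsilon$ for every integer $$T\ \ge\ C\Bigl(\frac{\sigma^2}{n\varepsilon^2}+\frac{\zeta'+\sigma\sqrt p}{p\,\varepsilon^{3/2}}+\frac1{p\,\varepsilon}\Bigr)L F_0,\qquad T\ge 0.$$ For parts 2 and 3 let $x^\star$ be a minimizer of $f$, $f^\star=f(x^\star)$, $R_0=\|x_0-x^\star\|$, let $\zeta'_\star$ be as above, and let $s\ge 0$ be either a bounded-variance constant $\sigma$ (valid for all $x$),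 or a variance constant $\sigma_\star$ at $x^\star$; in the latter case suppose in addition that $F_i(\cdot,\xi)$ is convex for each $i$ and $\mathcal D_i$-almost every $\xi$. 2. **Convex.** If the $f_i$ are $\mu$-convex with $\mu\ge 0$, then there is $\eta$ such that $\frac1{T+1}\sum_{t=0}^T(\mathbb E f(\overline x^{(t)})-f^\star)\le\varepsilon$ for every integer $$T\ \ge\ C\Bigl(\frac{s^2}{n\varepsilon^2}+\frac{\sqrt L(\zeta'_\star+s\sqrt p)}{p\,\varepsilon^{3/2}}+\frac L{p\,\varepsilon}\Bigr)R_0^2,\qquad T\ge 0.$$ 3. **Strongly convex.** If the $f_i$ are $\mu$-convex with $\mu>0$, then there are $\eta$ and weights $w_t>0$, $t\ge 0$, not depending on $T$, such that $\sum_{t=0}^T\frac{w_t}{\sum_{s'=0}^Tw_{s'}}(\mathbb E f(\overline x^{(t)})-f^\star)+\mu\,\mathbb E\|\overline x^{(T+1)}-x^\star\|^2\le\varepsilon$ for every integer $$T\ \ge\ C\Bigl(\frac{s^2}{\mu n\varepsilon}+\frac{\sqrt L(\zeta'_\star+s\sqrt p)}{\mu p\sqrt\varepsilon}+\frac L{\mu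 p}\Bigr)\log\Bigl(2+\frac{\mu R_0^2}{\varepsilon}\Bigr),\qquad T\ge 0.$$ 4. **Comparison with the matrix-independent heterogeneity.** If $\zeta\ge 0$ satisfies $\frac1n\|\partial f(\overline X)-\overline{\partial f}(\overline X)\|_F^2\le\zeta^2$ for all $X$, then the relative heterogeneity condition holds with $\zeta'=\sqrt{1-p}\,\zeta$. Likewise, for any point $x^\star$, if $\frac1n\|\partial f(X_\star)-\overline{\partial f}(X_\star)\|_F^2\le\zeta_\star^2$ with $X_\star=x^\star\mathbf 1^\top$ and $\zeta_\star\ge0$, then the mixing-error bound at $X_\star$ holds for all $t$ with $\zeta'_\star=\sqrt{1-p}\,\zeta_\star$. -/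

import Mathlib

open MeasureTheory ProbabilityTheory
open scoped InnerProductSpace

namespace DSGD

/-! A matrix `X ∈ ℝ^{d × n}` is represented by its `n` columns `X i ∈ ℝ^d`. -/

/-- The parameter space `ℝ^d` with the Euclidean norm. -/
abbrev Vec (d : ℕ) := EuclideanSpace ℝ (Fin d)

/-- `d × n` real matrices, given by their columns. -/
abbrev Cols (d n : ℕ) := Fin n → Vec d

/-- The Borel σ-algebra on real matrices, i.e. the product σ-algebra of the entries. -/
instance instMeasurableSpaceMatrix (n : ℕ) : MeasurableSpace (Matrix (Fin n) (Fin n) ℝ) :=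
  inferInstanceAs (MeasurableSpace (Fin n → Fin n → ℝ))

/-- The squared Frobenius norm. -/
noncomputable def frobSq {d n : ℕ} (X : Cols d n) : ℝ := ∑ i, ‖X i‖ ^ 2

/-- The average of the columns, `x̄ = (1/n) ∑ i, X i`. -/
noncomputable def avg {d n : ℕ} (X : Cols d n) : Vec d := (1 / (n : ℝ)) • ∑ i, X i

/-- `X̄ = X (1 1ᵀ / n)`: every column is replaced by the average of the columns. -/
noncomputable def avgMat {d n : ℕ} (X : Cols d n) : Cols d n := fun _ => avg X

/-- The matrix product `X W`, column by column. -/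
noncomputable def mix {d n : ℕ} (W : Matrix (Fin n) (Fin n) ℝ) (X : Cols d n) : Cols d n :=
  fun j => ∑ i, W i j • X i

section Objective

variable {d n : ℕ} {Ξ : Fin n → Type*} [∀ i, MeasurableSpace (Ξ i)]

/-- The local objective `f_i(x) = E_{ξ ∼ 𝓓_i} F_i(x, ξ)`. -/
noncomputable def localObj (𝓓 : ∀ i, Measure (Ξ i)) (F : ∀ i, Vec d → Ξ i → ℝ)
    (i : Fin n) (x : Vec d) : ℝ :=
  ∫ ξ, F i x ξ ∂(𝓓 i)

/-- The global objective `f = (1/n) ∑ i, f_i`. -/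
noncomputable def globalObj (𝓓 : ∀ i, Measure (Ξ i)) (F : ∀ i, Vec d → Ξ i → ℝ)
    (x : Vec d) : ℝ :=
  (1 / (n : ℝ)) * ∑ i, localObj 𝓓 F i x

/-- The stochastic gradient `∇F_i(x, ξ)` with respect to `x`. -/
noncomputable def stochGrad (F : ∀ i, Vec d → Ξ i → ℝ) (i : Fin n) (x : Vec d) (ξ : Ξ i) : Vec d :=
  gradient (fun y => F i y ξ) x

/-- `∂f(X) = [∇f_1(x_1), …, ∇f_n(x_n)]`. -/
noncomputable def gradMat (𝓓 : ∀ i, Measure (Ξ i)) (F : ∀ i, Vec d → Ξ i → ℝ)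
    (X : Cols d n) : Cols d n :=
  fun i => gradient (localObj 𝓓 F i) (X i)

/-- The stochastic objectives are well defined: the `𝓓 i` are probability distributions,
`F_i(x, ·)` has an expectation, and the stochastic gradients are measurable. -/
structure IsStochObjective (𝓓 : ∀ i, Measure (Ξ i)) (F : ∀ i, Vec d → Ξ i → ℝ) : Prop where
  prob : ∀ i, IsProbabilityMeasure (𝓓 i)
  integrable : ∀ i x, Integrable (fun ξ => F i x ξ) (𝓓 i)
  measurable_grad : ∀ i, Measurable (fun q : Vec d × Ξ i => stochGrad F i q.1 q.2)

/-- `L`-smoothness of every `F_i(·, ξ)`, for `𝓓_i`-almost every `ξ`. -/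
structure LSmooth (𝓓 : ∀ i, Measure (Ξ i)) (F : ∀ i, Vec d → Ξ i → ℝ) (L : ℝ) : Prop where
  nonneg : 0 ≤ L
  differentiable : ∀ i, ∀ᵐ ξ ∂(𝓓 i), Differentiable ℝ (fun x => F i x ξ)
  lipschitz : ∀ i, ∀ᵐ ξ ∂(𝓓 i), ∀ x y : Vec d,
    ‖stochGrad F i y ξ - stochGrad F i x ξ‖ ≤ L * ‖x - y‖

/-- Every `f_i` is `μ`-(strongly) convex. -/
def MuConvex (𝓓 : ∀ i, Measure (Ξ i)) (F : ∀ i, Vec d → Ξ i → ℝ) (μ : ℝ) : Prop :=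
  ∀ i, ∀ x y : Vec d,
    localObj 𝓓 F i x - localObj 𝓓 F i y + μ / 2 * ‖x - y‖ ^ 2
      ≤ ⟪gradient (localObj 𝓓 F i) x, x - y⟫_ℝ

/-- Every sample function `F_i(·, ξ)` is convex, for `𝓓_i`-almost every `ξ`. -/
def SampleConvex (𝓓 : ∀ i, Measure (Ξ i)) (F : ∀ i, Vec d → Ξ i → ℝ) : Prop :=
  ∀ i, ∀ᵐ ξ ∂(𝓓 i), ConvexOn ℝ Set.univ (fun x => F i x ξ)

/-- The averaged variance of the stochastic gradients at the point `x` is at most `σ²`. -/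
def VarianceAt (𝓓 : ∀ i, Measure (Ξ i)) (F : ∀ i, Vec d → Ξ i → ℝ) (σ : ℝ) (x : Vec d) : Prop :=
  (∀ i, Integrable
    (fun ξ => ‖stochGrad F i x ξ - gradient (localObj 𝓓 F i) x‖ ^ 2) (𝓓 i)) ∧
  (1 / (n : ℝ)) * ∑ i, ∫ ξ, ‖stochGrad F i x ξ - gradient (localObj 𝓓 F i) x‖ ^ 2 ∂(𝓓 i) ≤ σ ^ 2

/-- Bounded variance, uniformly over `ℝ^d`. -/
def BoundedVariance (𝓓 : ∀ i, Measure (Ξ i)) (F : ∀ i, Vec d → Ξ i → ℝ) (σ : ℝ) : Prop :=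
  ∀ x, VarianceAt 𝓓 F σ x

/-- The gradient mixing error at `X`, for the mixing matrices sampled at any time, is at most
`ζ'²`. -/
def MixingErrorAt (𝓓 : ∀ i, Measure (Ξ i)) (F : ∀ i, Vec d → Ξ i → ℝ)
    (𝒲 : ℕ → Measure (Matrix (Fin n) (Fin n) ℝ)) (ζ' : ℝ) (X : Cols d n) : Prop :=
  ∀ t, ∫ W, (1 / (n : ℝ)) * frobSq (mix W (gradMat 𝓓 F X) - avgMat (gradMat 𝓓 F X)) ∂(𝒲 t)
    ≤ ζ' ^ 2

/-- Relative heterogeneity with constant `ζ'`, uniformly over `X`. -/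
def RelativeHeterogeneity (𝓓 : ∀ i, Measure (Ξ i)) (F : ∀ i, Vec d → Ξ i → ℝ)
    (𝒲 : ℕ → Measure (Matrix (Fin n) (Fin n) ℝ)) (ζ' : ℝ) : Prop :=
  ∀ X : Cols d n, MixingErrorAt 𝓓 F 𝒲 ζ' (avgMat X)

/-- The (matrix-independent) dissimilarity of the local gradients at `X` is at most `ζ²`. -/
def DissimilarityAt (𝓓 : ∀ i, Measure (Ξ i)) (F : ∀ i, Vec d → Ξ i → ℝ)
    (ζ : ℝ) (X : Cols d n) : Prop :=
  (1 / (n : ℝ)) * frobSq (gradMat 𝓓 F X - avgMat (gradMat 𝓓 F X)) ≤ ζ ^ 2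

/-- The (matrix-independent) heterogeneity with constant `ζ`, uniformly over `X`. -/
def Heterogeneity (𝓓 : ∀ i, Measure (Ξ i)) (F : ∀ i, Vec d → Ξ i → ℝ) (ζ : ℝ) : Prop :=
  ∀ X : Cols d n, DissimilarityAt 𝓓 F ζ (avgMat X)

end Objective

/-- `𝒲 t` is a probability distribution over doubly stochastic matrices, for every `t`. -/
structure IsMixingLaw {n : ℕ} (𝒲 : ℕ → Measure (Matrix (Fin n) (Fin n) ℝ)) : Prop where
  prob : ∀ t, IsProbabilityMeasure (𝒲 t)
  doublyStochastic : ∀ t, ∀ᵐ W ∂(𝒲 t), W ∈ doublyStochastic ℝ (Fin n)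

/-- The consensus factor `p` for matrices with `d` rows. -/
structure ConsensusFactor (d : ℕ) {n : ℕ} (𝒲 : ℕ → Measure (Matrix (Fin n) (Fin n) ℝ)) (p : ℝ) :
    Prop where
  pos : 0 < p
  le_one : p ≤ 1
  contraction : ∀ t, ∀ X : Cols d n,
    ∫ W, frobSq (mix W X - avgMat X) ∂(𝒲 t) ≤ (1 - p) * frobSq (X - avgMat X)

section Algorithm

variable {d n : ℕ} {Ξ : Fin n → Type*} [∀ i, MeasurableSpace (Ξ i)]
variable {Ω : Type*} [MeasurableSpace Ω]

/-- The randomness of the algorithm: `ξ t i ∼ 𝓓 i` and `W t ∼ 𝒲 t`, all independent. -/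
structure IsSampling (P : Measure Ω) (𝓓 : ∀ i, Measure (Ξ i))
    (𝒲 : ℕ → Measure (Matrix (Fin n) (Fin n) ℝ))
    (ξ : ℕ → ∀ i, Ω → Ξ i) (W : ℕ → Ω → Matrix (Fin n) (Fin n) ℝ) : Prop where
  prob : IsProbabilityMeasure P
  measurable_sample : ∀ t i, Measurable (ξ t i)
  measurable_mixing : ∀ t, Measurable (W t)
  law_sample : ∀ t i, P.map (ξ t i) = 𝓓 i
  law_mixing : ∀ t, P.map (W t) = 𝒲 t
  indep : iIndep
    (fun s : (ℕ × Fin n) ⊕ ℕ =>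
      Sum.elim (fun q => MeasurableSpace.comap (ξ q.1 q.2) inferInstance)
        (fun t => MeasurableSpace.comap (W t) inferInstance) s) P

/-- The iterates of decentralized SGD, `X^{(t+1)} = (X^{(t)} - η_t ∂F(X^{(t)}, ξ^{(t)})) W^{(t)}`. -/
noncomputable def iterate (F : ∀ i, Vec d → Ξ i → ℝ) (X₀ : Cols d n) (η : ℕ → ℝ)
    (ξ : ℕ → ∀ i, Ω → Ξ i) (W : ℕ → Ω → Matrix (Fin n) (Fin n) ℝ) : ℕ → Ω → Cols d n
  | 0, _ => X₀
  | t + 1, ω => mix (W t ω) (fun i =>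
      iterate F X₀ η ξ W t ω i - η t • stochGrad F i (iterate F X₀ η ξ W t ω i) (ξ t i ω))

/-- The averaged iterate `x̄^{(t)}`, when all nodes start from `x₀` and use the constant
stepsize `η`. -/
noncomputable def avgIterate (F : ∀ i, Vec d → Ξ i → ℝ) (x₀ : Vec d) (η : ℝ)
    (ξ : ℕ → ∀ i, Ω → Ξ i) (W : ℕ → Ω → Matrix (Fin n) (Fin n) ℝ) (t : ℕ) (ω : Ω) : Vec d :=
  avg (iterate F (fun _ => x₀) (fun _ => η) ξ W t ω)

end Algorithm

end DSGD

/-! Mixing with doubly stochastic matrices preserves the mean of the columns, so `x̄` performs SGD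
on `f`, except that node `i` evaluates its gradient at `x_i` instead of `x̄`. By smoothness the
squared gradient error this causes is at most `L²` times the consensus error `c = (1/n)‖X - X̄‖²`.
Everything rests on two coupled one-step inequalities.

Consensus (`Setting.integral_consensusError_step_le`). The gradient matrix is split into its value
at the consensus point `X̄`, a Lipschitz deviation, and centred noise. Only the first part is not
small with `X - X̄` and `η`, and it enters solely through its mixing error, which is what `ζ'`
measures. For `ηL ≤ p/64` this gives `E c⁺ ≤ (1 - p/4) E c + O(η²ζ'²/p + η²σ²)`, plus multiples of
the optimality gap in the convex cases. The noise carries no factor `1/p` because it is independent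
of the drift, so no Young inequality is spent on it.

Progress (`Setting.integral_globalObj_step_le`, `Setting.integral_norm_avg_step_sub_sq_le`). The
usual descent estimates for `f(x̄)` or `‖x̄ - x⋆‖²` hold with an extra `O(ηL²) c` or `O(ηL) c`, and
with noise `σ²/n` since the nodes sample independently.

In the non-convex case the consensus recursion closes by itself and its uniform bound is inserted
into the descent of `f`. In the convex cases constants at `x⋆` suffice because co-coercivity pays
for moving gradients and noise from `x̄` to `x⋆` with the gap `f(x̄) - f⋆`; the consensus recursion
then contains that gap, and the two inequalities are combined into the Lyapunov function `E‖x̄ -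
x⋆‖² + 16(ηL/p) E c` (`lyapunov_step`). The sum of these decreases, or a geometrically weighted sum
when `μ > 0`, gives the rates once `η` is about the reciprocal of `σ²/(nε) + (ζ' + σ√p)/(p√ε) +
L/p`, with the appropriate powers of `L` (`stepsize_bounds`). -/

namespace DSGD

/-! ### Smooth functions on a Euclidean space -/

section Smooth

variable {E : Type*} [NormedAddCommGroup E] [InnerProductSpace ℝ E]

/-- A function with an upper quadratic model at `x` and a global lower bound `m` has a slope
controlled by the gap `g x - m`. -/
theorem norm_sq_le_of_lower_bound {g : E → ℝ} {x v : E} {L m : ℝ} (hL : 0 ≤ L)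
    (hup : ∀ y, g y ≤ g x + ⟪v, y - x⟫_ℝ + L / 2 * ‖y - x‖ ^ 2) (hm : ∀ y, m ≤ g y) :
    ‖v‖ ^ 2 ≤ 2 * L * (g x - m) := by
  have key : ∀ s : ℝ, (s - L / 2 * s ^ 2) * ‖v‖ ^ 2 ≤ g x - m := by
    intro s
    have h := (hm (x - s • v)).trans (hup (x - s • v))
    have e : x - s • v - x = -(s • v) := by abel
    rw [e, inner_neg_right, real_inner_smul_right, real_inner_self_eq_norm_sq, norm_neg,
      norm_smul, mul_pow, Real.norm_eq_abs, sq_abs] at h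
    linarith
  rcases hL.eq_or_lt with rfl | hL
  -- For `L = 0` the model is affine and steps may be arbitrarily long; this one would decrease `g`
  -- by more than the gap, so `v = 0`.
  · have h := key ((g x - m + 1) / ‖v‖ ^ 2)
    by_cases hv : ‖v‖ ^ 2 = 0
    · simp [hv]
    · have e : (g x - m + 1) / ‖v‖ ^ 2 * ‖v‖ ^ 2 = g x - m + 1 := div_mul_cancel₀ _ hv
      simp only [zero_div, zero_mul, sub_zero] at h
      linarith
  · have h := key (1 / L)
    have e : 1 / L - L / 2 * (1 / L) ^ 2 = 1 / (2 * L) := by field_simp; norm_num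
    rw [e, div_mul_eq_mul_div, one_mul, div_le_iff₀ (by positivity)] at h
    linarith

/-- Co-coercivity of the gradient of a convex smooth function. -/
theorem norm_sub_sq_le_of_convex {g : E → ℝ} {x y u v : E} {L : ℝ} (hL : 0 ≤ L)
    (hup : ∀ z, g z ≤ g x + ⟪u, z - x⟫_ℝ + L / 2 * ‖z - x‖ ^ 2)
    (hlow : ∀ z, g y + ⟪v, z - y⟫_ℝ ≤ g z) :
    ‖u - v‖ ^ 2 ≤ 2 * L * (g x - g y - ⟪v, x - y⟫_ℝ) := by
  -- Tilting by `v` makes `y` a global minimizer, and the slope at `x` becomes `u - v`.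
  have h := norm_sq_le_of_lower_bound (g := fun z => g z - ⟪v, z⟫_ℝ) (x := x) (v := u - v)
    (m := g y - ⟪v, y⟫_ℝ) hL
    (fun z => by
      have := hup z
      rw [inner_sub_left, inner_sub_right v z x]
      linarith)
    (fun z => by
      have := hlow z
      rw [inner_sub_right] at this
      linarith)
  rw [inner_sub_right]
  convert h using 2
  ring

variable [CompleteSpace E]

theorem hasDerivAt_comp_line {g : E → ℝ} (hd : Differentiable ℝ g) (x v : E) (s : ℝ) :
    HasDerivAt (fun s : ℝ => g (x + s • v)) ⟪gradient g (x + s • v), v⟫_ℝ s := by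
  have h1 : HasDerivAt (fun s : ℝ => x + s • v) v s := by
    simpa using ((hasDerivAt_id s).smul_const v).const_add x
  have h2 := (hd (x + s • v)).hasFDerivAt.comp_hasDerivAt s h1
  rwa [← inner_gradient_left] at h2

/-- The two-sided descent lemma. -/
theorem abs_sub_sub_inner_gradient_le {g : E → ℝ} {L : ℝ} (hd : Differentiable ℝ g)
    (hL : ∀ x y, ‖gradient g y - gradient g x‖ ≤ L * ‖x - y‖) (x y : E) :
    |g y - g x - ⟪gradient g x, y - x⟫_ℝ| ≤ L / 2 * ‖y - x‖ ^ 2 := by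
  set v := y - x with hv
  -- The sign `c = ±1` treats both sides of the estimate at once.
  have key : ∀ c : ℝ, |c| = 1 →
      c * (g y - g x - ⟪gradient g x, v⟫_ℝ) ≤ L / 2 * ‖v‖ ^ 2 := by
    intro c hc
    -- The Lipschitz bound and Cauchy-Schwarz make `φ` nonincreasing on `[0,1]`; the claim is `φ 1 ≤
    -- φ 0`.
    set φ : ℝ → ℝ := fun s =>
      c * (g (x + s • v) - s * ⟪gradient g x, v⟫_ℝ) - L / 2 * ‖v‖ ^ 2 * s ^ 2 with hφ
    have hder : ∀ s, HasDerivAt φ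
        (c * (⟪gradient g (x + s • v), v⟫_ℝ - ⟪gradient g x, v⟫_ℝ)
          - L / 2 * ‖v‖ ^ 2 * (2 * s)) s := by
      intro s
      have h1 := hasDerivAt_comp_line hd x v s
      have h2 := (hasDerivAt_id s).mul_const ⟪gradient g x, v⟫_ℝ
      have h3 := ((hasDerivAt_id s).pow 2).const_mul (L / 2 * ‖v‖ ^ 2)
      have h4 := ((h1.sub h2).const_mul c).sub h3
      refine HasDerivAt.congr_deriv (f := φ) h4 ?_
      simp
    have hanti : AntitoneOn φ (Set.Icc 0 1) := by
      refine antitoneOn_of_deriv_nonpos (convex_Icc 0 1)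
        (fun s _ => (hder s).continuousAt.continuousWithinAt)
        (fun s _ => (hder s).differentiableAt.differentiableWithinAt) ?_
      intro s hs
      rw [interior_Icc] at hs
      rw [(hder s).deriv, ← inner_sub_left]
      have h1 : c * ⟪gradient g (x + s • v) - gradient g x, v⟫_ℝ
          ≤ ‖gradient g (x + s • v) - gradient g x‖ * ‖v‖ := by
        refine (le_abs_self _).trans ?_
        rw [abs_mul, hc, one_mul]
        exact abs_real_inner_le_norm _ _
      have h2 := hL x (x + s • v)
      have e : ‖x - (x + s • v)‖ = s * ‖v‖ := by
        rw [sub_add_cancel_left, norm_neg, norm_smul, Real.norm_of_nonneg hs.1.le]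
      rw [e] at h2
      have h3 := mul_le_mul_of_nonneg_right h2 (norm_nonneg v)
      nlinarith
    have h := hanti (Set.left_mem_Icc.2 zero_le_one) (Set.right_mem_Icc.2 zero_le_one) zero_le_one
    have e : x + (1 : ℝ) • v = y := by rw [one_smul, hv]; abel
    simp only [hφ, e, zero_smul, add_zero] at h
    nlinarith
  rw [abs_le]
  have h1 := key 1 (by simp)
  have h2 := key (-1) (by simp)
  constructor <;> linarith

/-- The first-order lower bound for a differentiable convex function. -/
theorem add_inner_gradient_le_of_convexOn {g : E → ℝ} (hd : Differentiable ℝ g)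
    (hc : ConvexOn ℝ Set.univ g) (y z : E) : g y + ⟪gradient g y, z - y⟫_ℝ ≤ g z := by
  have hconv : ConvexOn ℝ Set.univ (fun s : ℝ => g (y + s • (z - y))) := by
    have h := hc.comp_affineMap (AffineMap.lineMap y z : ℝ →ᵃ[ℝ] E)
    have e : (g ∘ (AffineMap.lineMap y z : ℝ →ᵃ[ℝ] E)) = fun s : ℝ => g (y + s • (z - y)) := by
      ext s
      simp [AffineMap.lineMap_apply, add_comm]
    rwa [e] at h
  have hder := hasDerivAt_comp_line hd y (z - y) 0
  have h := hconv.le_slope_of_hasDerivAt (Set.mem_univ 0) (Set.mem_univ 1) one_pos hder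
  simp only [slope_def_field, zero_smul, add_zero, one_smul, add_sub_cancel, sub_zero,
    div_one] at h
  linarith

/-- A two-sided quadratic model identifies the gradient. -/
theorem hasGradientAt_of_abs_sub_sub_inner_le {g : E → ℝ} {x v : E} {L : ℝ}
    (h : ∀ y, |g y - g x - ⟪v, y - x⟫_ℝ| ≤ L / 2 * ‖y - x‖ ^ 2) : HasGradientAt g v x := by
  rw [hasGradientAt_iff_isLittleO]
  refine (Asymptotics.IsBigO.of_bound (L / 2) (g := fun y => ‖y - x‖ ^ 2) ?_).trans_isLittleO ?_
  · filter_upwards with y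
    rw [Real.norm_eq_abs, norm_pow, norm_norm]
    exact h y
  · have := (Asymptotics.isLittleO_norm_pow_id (E' := E) one_lt_two).comp_tendsto
      (k := fun y : E => y - x) (l' := nhds x) (by
        have : Filter.Tendsto (fun y : E => y - x) (nhds x) (nhds (x - x)) :=
          (continuous_id.sub continuous_const).tendsto x
        rwa [sub_self] at this)
    exact this

end Smooth

/-! ### The stochastic and the expected gradients -/

section Objective

variable {d n : ℕ} {Ξ : Fin n → Type*} [∀ i, MeasurableSpace (Ξ i)]
  {𝓓 : ∀ i, Measure (Ξ i)} {F : ∀ i, Vec d → Ξ i → ℝ} {L : ℝ}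

theorem IsStochObjective.measurable_stochGrad (hO : IsStochObjective 𝓓 F) (i : Fin n) (x : Vec d) :
    Measurable (fun ξ => stochGrad F i x ξ) :=
  (hO.measurable_grad i).comp (measurable_const.prodMk measurable_id)

theorem LSmooth.ae_abs_sub_sub_inner_le (hS : LSmooth 𝓓 F L) (i : Fin n) :
    ∀ᵐ ξ ∂(𝓓 i), ∀ x y : Vec d,
      |F i y ξ - F i x ξ - ⟪stochGrad F i x ξ, y - x⟫_ℝ| ≤ L / 2 * ‖y - x‖ ^ 2 := by
  filter_upwards [hS.differentiable i, hS.lipschitz i] with ξ hd hl x y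
  exact abs_sub_sub_inner_gradient_le (g := fun x => F i x ξ) hd hl x y

/-- Only the values of `F` are assumed integrable. The inner product with the gradient differs from
the increment `F(x+h) - F(x)` by at most `L/2 ‖h‖²`, so it inherits integrability. -/
theorem integrable_inner_stochGrad (hO : IsStochObjective 𝓓 F) (hS : LSmooth 𝓓 F L) (i : Fin n)
    (x h : Vec d) : Integrable (fun ξ => ⟪stochGrad F i x ξ, h⟫_ℝ) (𝓓 i) := by
  have := hO.prob i
  have h1 : Integrable (fun ξ => F i (x + h) ξ - F i x ξ) (𝓓 i) :=
    (hO.integrable i _).sub (hO.integrable i _)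
  have hm : AEStronglyMeasurable (fun ξ => ⟪stochGrad F i x ξ, h⟫_ℝ) (𝓓 i) :=
    ((hO.measurable_stochGrad i x).inner measurable_const).aestronglyMeasurable
  have h2 : Integrable (fun ξ => F i (x + h) ξ - F i x ξ - ⟪stochGrad F i x ξ, h⟫_ℝ) (𝓓 i) := by
    refine (integrable_const (L / 2 * ‖h‖ ^ 2)).mono' (h1.1.sub hm) ?_
    filter_upwards [hS.ae_abs_sub_sub_inner_le i] with ξ hξ
    simpa using hξ x (x + h)
  refine (h1.sub h2).congr (Filter.Eventually.of_forall fun ξ => ?_)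
  simp

theorem integrable_stochGrad (hO : IsStochObjective 𝓓 F) (hS : LSmooth 𝓓 F L) (i : Fin n)
    (x : Vec d) : Integrable (fun ξ => stochGrad F i x ξ) (𝓓 i) := by
  have h : Integrable (fun ξ => ∑ k, ⟪stochGrad F i x ξ, EuclideanSpace.basisFun (Fin d) ℝ k⟫_ℝ
      • EuclideanSpace.basisFun (Fin d) ℝ k) (𝓓 i) :=
    integrable_finsetSum _ fun k _ => (integrable_inner_stochGrad hO hS i x _).smul_const _
  refine h.congr (Filter.Eventually.of_forall fun ξ => ?_)
  change _ = stochGrad F i x ξ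
  conv_rhs => rw [← (EuclideanSpace.basisFun (Fin d) ℝ).sum_repr' (stochGrad F i x ξ)]
  exact Finset.sum_congr rfl fun k _ => by rw [real_inner_comm]

/-- Integrating the samplewise quadratic model gives a quadratic model of `f_i` whose slope is the
mean stochastic gradient. This proves that `f_i` is differentiable and identifies its gradient, with
no separate differentiation under the integral. -/
theorem abs_localObj_sub_sub_inner_integral_le (hO : IsStochObjective 𝓓 F) (hS : LSmooth 𝓓 F L)
    (i : Fin n) (x y : Vec d) :
    |localObj 𝓓 F i y - localObj 𝓓 F i x - ⟪∫ ξ, stochGrad F i x ξ ∂(𝓓 i), y - x⟫_ℝ|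
      ≤ L / 2 * ‖y - x‖ ^ 2 := by
  have := hO.prob i
  have e : localObj 𝓓 F i y - localObj 𝓓 F i x - ⟪∫ ξ, stochGrad F i x ξ ∂(𝓓 i), y - x⟫_ℝ
      = ∫ ξ, (F i y ξ - F i x ξ - ⟪stochGrad F i x ξ, y - x⟫_ℝ) ∂(𝓓 i) := by
    rw [integral_sub (f := fun ξ => F i y ξ - F i x ξ)
      ((hO.integrable i y).sub (hO.integrable i x))
      (integrable_inner_stochGrad hO hS i x _), integral_sub (hO.integrable i y)
      (hO.integrable i x)]
    congr 1
    rw [real_inner_comm, ← integral_inner (integrable_stochGrad hO hS i x)]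
    simp_rw [real_inner_comm]
  rw [e]
  have h := norm_integral_le_of_norm_le_const (μ := 𝓓 i)
    (f := fun ξ => F i y ξ - F i x ξ - ⟪stochGrad F i x ξ, y - x⟫_ℝ) (C := L / 2 * ‖y - x‖ ^ 2) (by
      filter_upwards [hS.ae_abs_sub_sub_inner_le i] with ξ hξ using hξ x y)
  simpa using h

theorem hasGradientAt_localObj (hO : IsStochObjective 𝓓 F) (hS : LSmooth 𝓓 F L) (i : Fin n)
    (x : Vec d) : HasGradientAt (localObj 𝓓 F i) (∫ ξ, stochGrad F i x ξ ∂(𝓓 i)) x :=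
  hasGradientAt_of_abs_sub_sub_inner_le (abs_localObj_sub_sub_inner_integral_le hO hS i x)

theorem gradient_localObj (hO : IsStochObjective 𝓓 F) (hS : LSmooth 𝓓 F L) (i : Fin n)
    (x : Vec d) : gradient (localObj 𝓓 F i) x = ∫ ξ, stochGrad F i x ξ ∂(𝓓 i) :=
  (hasGradientAt_localObj hO hS i x).gradient

theorem abs_localObj_sub_sub_inner_le (hO : IsStochObjective 𝓓 F) (hS : LSmooth 𝓓 F L)
    (i : Fin n) (x y : Vec d) :
    |localObj 𝓓 F i y - localObj 𝓓 F i x - ⟪gradient (localObj 𝓓 F i) x, y - x⟫_ℝ|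
      ≤ L / 2 * ‖y - x‖ ^ 2 := by
  rw [gradient_localObj hO hS]
  exact abs_localObj_sub_sub_inner_integral_le hO hS i x y

theorem norm_gradient_localObj_sub_le (hO : IsStochObjective 𝓓 F) (hS : LSmooth 𝓓 F L)
    (i : Fin n) (x y : Vec d) :
    ‖gradient (localObj 𝓓 F i) y - gradient (localObj 𝓓 F i) x‖ ≤ L * ‖y - x‖ := by
  have := hO.prob i
  rw [gradient_localObj hO hS, gradient_localObj hO hS, ← integral_sub
    (integrable_stochGrad hO hS i y) (integrable_stochGrad hO hS i x)]
  have h := norm_integral_le_of_norm_le_const (μ := 𝓓 i)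
    (f := fun ξ => stochGrad F i y ξ - stochGrad F i x ξ) (C := L * ‖y - x‖) (by
      filter_upwards [hS.lipschitz i] with ξ hξ
      rw [norm_sub_rev y x]
      exact hξ x y)
  simpa using h

theorem continuous_gradient_localObj (hO : IsStochObjective 𝓓 F) (hS : LSmooth 𝓓 F L)
    (i : Fin n) : Continuous (gradient (localObj 𝓓 F i)) := by
  have h : LipschitzWith L.toNNReal (gradient (localObj 𝓓 F i)) := by
    refine LipschitzWith.of_dist_le_mul fun x y => ?_
    rw [dist_eq_norm, dist_eq_norm, Real.coe_toNNReal _ hS.nonneg]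
    exact norm_gradient_localObj_sub_le hO hS i y x
  exact h.continuous

theorem hasGradientAt_globalObj (hO : IsStochObjective 𝓓 F) (hS : LSmooth 𝓓 F L) (x : Vec d) :
    HasGradientAt (globalObj 𝓓 F) ((1 / (n : ℝ)) • ∑ i, gradient (localObj 𝓓 F i) x) x := by
  rw [hasGradientAt_iff_hasFDerivAt]
  have h : ∀ i ∈ Finset.univ, HasFDerivAt (localObj 𝓓 F i)
      ((InnerProductSpace.toDual ℝ (Vec d)) (gradient (localObj 𝓓 F i) x)) x := fun i _ =>
    ((hasGradientAt_localObj hO hS i x).differentiableAt.hasGradientAt).hasFDerivAt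
  have h2 := (HasFDerivAt.fun_sum h).const_mul (1 / (n : ℝ))
  refine HasFDerivAt.congr_fderiv (f := globalObj 𝓓 F) h2 ?_
  simp

theorem gradient_globalObj (hO : IsStochObjective 𝓓 F) (hS : LSmooth 𝓓 F L) (x : Vec d) :
    gradient (globalObj 𝓓 F) x = (1 / (n : ℝ)) • ∑ i, gradient (localObj 𝓓 F i) x :=
  (hasGradientAt_globalObj hO hS x).gradient

theorem continuous_gradient_globalObj (hO : IsStochObjective 𝓓 F) (hS : LSmooth 𝓓 F L) :
    Continuous (gradient (globalObj 𝓓 F)) := by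
  rw [funext (gradient_globalObj hO hS)]
  exact Continuous.const_smul
    (continuous_finsetSum _ fun i _ => continuous_gradient_localObj hO hS i) (1 / (n : ℝ))

theorem continuous_globalObj (hO : IsStochObjective 𝓓 F) (hS : LSmooth 𝓓 F L) :
    Continuous (globalObj 𝓓 F) :=
  continuous_iff_continuousAt.2 fun x => (hasGradientAt_globalObj hO hS x).continuousAt

theorem abs_globalObj_sub_sub_inner_le (hn : 0 < n) (hO : IsStochObjective 𝓓 F)
    (hS : LSmooth 𝓓 F L) (x y : Vec d) :
    |globalObj 𝓓 F y - globalObj 𝓓 F x - ⟪gradient (globalObj 𝓓 F) x, y - x⟫_ℝ|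
      ≤ L / 2 * ‖y - x‖ ^ 2 := by
  have hn' : (0 : ℝ) < n := Nat.cast_pos.2 hn
  have e : globalObj 𝓓 F y - globalObj 𝓓 F x - ⟪gradient (globalObj 𝓓 F) x, y - x⟫_ℝ
      = (1 / (n : ℝ)) * ∑ i, (localObj 𝓓 F i y - localObj 𝓓 F i x
        - ⟪gradient (localObj 𝓓 F i) x, y - x⟫_ℝ) := by
    rw [gradient_globalObj hO hS, real_inner_smul_left, sum_inner, globalObj, globalObj,
      Finset.sum_sub_distrib, Finset.sum_sub_distrib]
    ring
  rw [e, abs_mul, abs_of_nonneg (by positivity)]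
  calc (1 / (n : ℝ)) * |∑ i, (localObj 𝓓 F i y - localObj 𝓓 F i x
        - ⟪gradient (localObj 𝓓 F i) x, y - x⟫_ℝ)|
      ≤ (1 / (n : ℝ)) * ∑ _i : Fin n, L / 2 * ‖y - x‖ ^ 2 := by
        gcongr
        exact (Finset.abs_sum_le_sum_abs _ _).trans
          (Finset.sum_le_sum fun i _ => abs_localObj_sub_sub_inner_le hO hS i x y)
    _ = L / 2 * ‖y - x‖ ^ 2 := by
        simp
        field_simp

theorem globalObj_le (hn : 0 < n) (hO : IsStochObjective 𝓓 F) (hS : LSmooth 𝓓 F L)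
    (x y : Vec d) :
    globalObj 𝓓 F y ≤ globalObj 𝓓 F x + ⟪gradient (globalObj 𝓓 F) x, y - x⟫_ℝ
      + L / 2 * ‖y - x‖ ^ 2 := by
  linarith [(abs_le.1 (abs_globalObj_sub_sub_inner_le hn hO hS x y)).2]

theorem norm_gradient_globalObj_sq_le (hn : 0 < n) (hO : IsStochObjective 𝓓 F)
    (hS : LSmooth 𝓓 F L) {m : ℝ} (hm : ∀ y, m ≤ globalObj 𝓓 F y) (x : Vec d) :
    ‖gradient (globalObj 𝓓 F) x‖ ^ 2 ≤ 2 * L * (globalObj 𝓓 F x - m) :=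
  norm_sq_le_of_lower_bound hS.nonneg (globalObj_le hn hO hS x) hm

theorem gradient_globalObj_eq_zero (hn : 0 < n) (hO : IsStochObjective 𝓓 F)
    (hS : LSmooth 𝓓 F L) {xs : Vec d} (hm : ∀ y, globalObj 𝓓 F xs ≤ globalObj 𝓓 F y) :
    gradient (globalObj 𝓓 F) xs = 0 := by
  have h := norm_gradient_globalObj_sq_le hn hO hS hm xs
  rw [sub_self, mul_zero] at h
  exact norm_eq_zero.1 (pow_eq_zero_iff two_ne_zero |>.1 (le_antisymm h (sq_nonneg _)))

end Objective

/-! ### Frobenius norms, averages and mixing -/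

section Frobenius

variable {d n : ℕ}

theorem norm_add_sq_le_young {E : Type*} [NormedAddCommGroup E] [InnerProductSpace ℝ E] {a : ℝ}
    (ha : 0 < a) (u v : E) : ‖u + v‖ ^ 2 ≤ (1 + a) * ‖u‖ ^ 2 + (1 + 1 / a) * ‖v‖ ^ 2 := by
  have h1 : ‖u + v‖ ^ 2 ≤ (‖u‖ + ‖v‖) ^ 2 := by gcongr; exact norm_add_le u v
  have h2 : (1 + a) * ‖u‖ ^ 2 + (1 + 1 / a) * ‖v‖ ^ 2 - (‖u‖ + ‖v‖) ^ 2
      = (a * ‖u‖ - ‖v‖) ^ 2 / a := by field_simp; ring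
  have h3 : 0 ≤ (a * ‖u‖ - ‖v‖) ^ 2 / a := by positivity
  linarith

theorem norm_add_add_sq_le {E : Type*} [NormedAddCommGroup E] (u v w : E) :
    ‖u + v + w‖ ^ 2 ≤ 3 * ‖u‖ ^ 2 + 3 * ‖v‖ ^ 2 + 3 * ‖w‖ ^ 2 := by
  have h1 : ‖u + v + w‖ ^ 2 ≤ (‖u‖ + ‖v‖ + ‖w‖) ^ 2 := by gcongr; exact norm_add₃_le
  nlinarith [sq_nonneg (‖u‖ - ‖v‖), sq_nonneg (‖u‖ - ‖w‖), sq_nonneg (‖v‖ - ‖w‖)]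

theorem frobSq_nonneg (X : Cols d n) : 0 ≤ frobSq X := Finset.sum_nonneg fun _ _ => sq_nonneg _

theorem frobSq_add_le {a : ℝ} (ha : 0 < a) (A B : Cols d n) :
    frobSq (A + B) ≤ (1 + a) * frobSq A + (1 + 1 / a) * frobSq B := by
  rw [frobSq, frobSq, frobSq, Finset.mul_sum, Finset.mul_sum, ← Finset.sum_add_distrib]
  exact Finset.sum_le_sum fun i _ => norm_add_sq_le_young ha _ _

theorem frobSq_smul (c : ℝ) (A : Cols d n) : frobSq (c • A) = c ^ 2 * frobSq A := by
  simp [frobSq, norm_smul, mul_pow, Finset.mul_sum]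

theorem avg_const (hn : 0 < n) (x : Vec d) : avg (fun _ : Fin n => x) = x := by
  have : (n : ℝ) ≠ 0 := by positivity
  rw [avg, Finset.sum_const, Finset.card_univ, Fintype.card_fin, ← Nat.cast_smul_eq_nsmul ℝ,
    smul_smul, one_div_mul_cancel this, one_smul]

theorem avg_add (X Y : Cols d n) : avg (X + Y) = avg X + avg Y := by
  simp [avg, Finset.sum_add_distrib]

theorem avg_sub (X Y : Cols d n) : avg (X - Y) = avg X - avg Y := by
  simp [avg, Finset.sum_sub_distrib, smul_sub]

theorem avg_smul (c : ℝ) (X : Cols d n) : avg (c • X) = c • avg X := by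
  simp [avg, ← Finset.smul_sum, smul_comm c]

theorem sum_eq_smul_avg (hn : 0 < n) (X : Cols d n) : ∑ i, X i = (n : ℝ) • avg X := by
  have : (n : ℝ) ≠ 0 := by positivity
  rw [avg, smul_smul, mul_one_div_cancel this, one_smul]

/-- Parallel-axis identity: deviations from the mean sum to zero, so the cross term vanishes. It
yields both the optimality of the mean among constants and Jensen's inequality for `avg`. -/
theorem frobSq_sub_const (hn : 0 < n) (X : Cols d n) (c : Vec d) :
    frobSq (X - fun _ => c) = frobSq (X - avgMat X) + n * ‖avg X - c‖ ^ 2 := by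
  have h : ∀ i, ‖X i - c‖ ^ 2 = ‖X i - avg X‖ ^ 2 + 2 * ⟪X i - avg X, avg X - c⟫_ℝ
      + ‖avg X - c‖ ^ 2 := fun i => by
    rw [← norm_add_sq_real, sub_add_sub_cancel]
  have h2 : ∑ i, ⟪X i - avg X, avg X - c⟫_ℝ = 0 := by
    rw [← sum_inner, Finset.sum_sub_distrib, sum_eq_smul_avg hn]
    simp [← Nat.cast_smul_eq_nsmul ℝ]
  simp only [frobSq, Pi.sub_apply, h, Finset.sum_add_distrib, ← Finset.mul_sum, h2, avgMat]
  simp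

theorem frobSq_sub_avgMat_le (hn : 0 < n) (X : Cols d n) (c : Vec d) :
    frobSq (X - avgMat X) ≤ frobSq (X - fun _ => c) := by
  rw [frobSq_sub_const hn X c]
  have : 0 ≤ (n : ℝ) * ‖avg X - c‖ ^ 2 := by positivity
  linarith

theorem frobSq_sub_avgMat_le_frobSq (hn : 0 < n) (X : Cols d n) :
    frobSq (X - avgMat X) ≤ frobSq X := by
  have h := frobSq_sub_avgMat_le hn X 0
  have e : (X - fun _ => (0 : Vec d)) = X := by ext; simp
  rwa [e] at h

theorem norm_avg_sq_le (hn : 0 < n) (X : Cols d n) : ‖avg X‖ ^ 2 ≤ (1 / (n : ℝ)) * frobSq X := by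
  have h := frobSq_sub_const hn X 0
  have e : (X - fun _ => (0 : Vec d)) = X := by ext; simp
  rw [e, sub_zero] at h
  have hn' : (0 : ℝ) < n := by positivity
  rw [one_div_mul_eq_div, le_div_iff₀ hn', h]
  linarith [frobSq_nonneg (X - avgMat X)]

/-- Unit row sums suffice here. This is why the averaged iterate does not see the mixing matrices
directly. -/
theorem avg_mix {W : Matrix (Fin n) (Fin n) ℝ} (hW : W ∈ doublyStochastic ℝ (Fin n))
    (X : Cols d n) : avg (mix W X) = avg X := by
  simp only [avg, mix]
  rw [Finset.sum_comm]
  congr 1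
  refine Finset.sum_congr rfl fun i _ => ?_
  rw [← Finset.sum_smul, sum_row_of_mem_doublyStochastic hW, one_smul]

/-- The mixing error `X W - X̄`. -/
noncomputable def mixDev (W : Matrix (Fin n) (Fin n) ℝ) (X : Cols d n) : Cols d n :=
  mix W X - avgMat X

theorem mixDev_apply (W : Matrix (Fin n) (Fin n) ℝ) (X : Cols d n) (j : Fin n) :
    mixDev W X j = ∑ i, (W i j - 1 / (n : ℝ)) • X i := by
  simp [mixDev, mix, avgMat, avg, sub_smul, Finset.smul_sum]

theorem mixDev_add (W : Matrix (Fin n) (Fin n) ℝ) (X Y : Cols d n) :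
    mixDev W (X + Y) = mixDev W X + mixDev W Y := by
  ext1 j
  simp [mixDev_apply, Finset.sum_add_distrib]

theorem mixDev_smul (W : Matrix (Fin n) (Fin n) ℝ) (c : ℝ) (X : Cols d n) :
    mixDev W (c • X) = c • mixDev W X := by
  ext1 j
  simp only [mixDev_apply, Pi.smul_apply, Finset.smul_sum]
  exact Finset.sum_congr rfl fun i _ => smul_comm _ _ _

theorem abs_entry_sub_le (hn : 0 < n) {W : Matrix (Fin n) (Fin n) ℝ}
    (hW : W ∈ doublyStochastic ℝ (Fin n)) (i j : Fin n) : |W i j - 1 / (n : ℝ)| ≤ 1 := by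
  have h0 := nonneg_of_mem_doublyStochastic hW (i := i) (j := j)
  have h1 : W i j ≤ 1 := le_one_of_mem_doublyStochastic hW
  have hn' : (1 : ℝ) ≤ n := Nat.one_le_cast.2 hn
  have h2 : 1 / (n : ℝ) ≤ 1 := by rw [div_le_one (by linarith)]; exact hn'
  have h3 : 0 ≤ 1 / (n : ℝ) := by positivity
  rw [abs_le]
  constructor <;> linarith

theorem norm_mixDev_le (hn : 0 < n) {W : Matrix (Fin n) (Fin n) ℝ}
    (hW : W ∈ doublyStochastic ℝ (Fin n)) (X : Cols d n) (j : Fin n) :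
    ‖mixDev W X j‖ ≤ ∑ i, ‖X i‖ := by
  rw [mixDev_apply]
  refine (norm_sum_le _ _).trans (Finset.sum_le_sum fun i _ => ?_)
  rw [norm_smul, Real.norm_eq_abs]
  exact mul_le_of_le_one_left (norm_nonneg _) (abs_entry_sub_le hn hW i j)

theorem measurable_entry (i j : Fin n) : Measurable fun W : Matrix (Fin n) (Fin n) ℝ => W i j :=
  (measurable_pi_apply j).comp (measurable_pi_apply (X := fun _ : Fin n => Fin n → ℝ) i)

theorem measurable_mixDev (j : Fin n) :
    Measurable fun q : Cols d n × Matrix (Fin n) (Fin n) ℝ => mixDev q.2 q.1 j := by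
  simp only [mixDev_apply]
  refine Finset.measurable_fun_sum _ fun i _ => ?_
  exact (((measurable_entry i j).comp measurable_snd).sub_const _).smul
    ((measurable_pi_apply i).comp measurable_fst)

theorem measurable_frobSq : Measurable (frobSq : Cols d n → ℝ) :=
  Finset.measurable_fun_sum _ fun i _ => (measurable_pi_apply i).norm.pow_const 2

theorem measurable_avg : Measurable (avg : Cols d n → Vec d) :=
  (Finset.measurable_fun_sum _ fun i _ => measurable_pi_apply i).const_smul (1 / (n : ℝ))

theorem measurable_frobSq_mixDev :
    Measurable fun q : Cols d n × Matrix (Fin n) (Fin n) ℝ => frobSq (mixDev q.2 q.1) :=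
  measurable_frobSq.comp (measurable_pi_lambda _ measurable_mixDev)

/-- A crude bound serving integrability only; quantitative contraction comes from the consensus
factor, in expectation. -/
theorem frobSq_mixDev_le (hn : 0 < n) {W : Matrix (Fin n) (Fin n) ℝ}
    (hW : W ∈ doublyStochastic ℝ (Fin n)) (X : Cols d n) :
    frobSq (mixDev W X) ≤ n * (n * frobSq X) := by
  have h : ∀ j, ‖mixDev W X j‖ ^ 2 ≤ n * frobSq X := fun j => by
    calc ‖mixDev W X j‖ ^ 2 ≤ (∑ i, ‖X i‖) ^ 2 := by gcongr; exact norm_mixDev_le hn hW X j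
      _ ≤ n * frobSq X := by
        have := sq_sum_le_card_mul_sum_sq (s := (Finset.univ : Finset (Fin n)))
          (f := fun i => ‖X i‖)
        simpa [frobSq] using this
  calc frobSq (mixDev W X) ≤ ∑ _j : Fin n, n * frobSq X := Finset.sum_le_sum fun j _ => h j
    _ = n * (n * frobSq X) := by simp

variable {𝒲 : ℕ → Measure (Matrix (Fin n) (Fin n) ℝ)}

theorem integrable_frobSq_mixDev (hn : 0 < n) (hW : IsMixingLaw 𝒲) (t : ℕ) (X : Cols d n) :
    Integrable (fun W => frobSq (mixDev W X)) (𝒲 t) := by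
  have := hW.prob t
  refine (integrable_const ((n : ℝ) * (n * frobSq X))).mono'
    (measurable_frobSq_mixDev.comp (measurable_const.prodMk measurable_id)).aestronglyMeasurable ?_
  filter_upwards [hW.doublyStochastic t] with W hW
  rw [Real.norm_of_nonneg (frobSq_nonneg _)]
  exact frobSq_mixDev_le hn hW X

end Frobenius

/-! ### Variance of the stochastic gradients -/

section Noise

variable {d n : ℕ} {Ξ : Fin n → Type*} [∀ i, MeasurableSpace (Ξ i)]

/-- The consensus error `(1/n) ‖X - X̄‖²`. -/
noncomputable def consensusError (X : Cols d n) : ℝ := (1 / (n : ℝ)) * frobSq (X - avgMat X)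

theorem consensusError_nonneg (X : Cols d n) : 0 ≤ consensusError X :=
  mul_nonneg (by positivity) (frobSq_nonneg _)

/-- The deviation of the stochastic gradient from its mean. -/
noncomputable def noise (𝓓 : ∀ i, Measure (Ξ i)) (F : ∀ i, Vec d → Ξ i → ℝ) (i : Fin n)
    (x : Vec d) (ξ : Ξ i) : Vec d :=
  stochGrad F i x ξ - gradient (localObj 𝓓 F i) x

/-- The variance of the stochastic gradient. -/
noncomputable def noiseVar (𝓓 : ∀ i, Measure (Ξ i)) (F : ∀ i, Vec d → Ξ i → ℝ) (i : Fin n)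
    (x : Vec d) : ℝ :=
  ∫ ξ, ‖noise 𝓓 F i x ξ‖ ^ 2 ∂(𝓓 i)

/-- The averaged variance at the columns of `X` is controlled by a constant, by the consensus error
and by the optimality gap at the average. -/
def NoiseBound (𝓓 : ∀ i, Measure (Ξ i)) (F : ∀ i, Vec d → Ξ i → ℝ) (L a b m : ℝ) : Prop :=
  ∀ X : Cols d n, (1 / (n : ℝ)) * ∑ i, noiseVar 𝓓 F i (X i)
    ≤ a + 3 * L ^ 2 * consensusError X + b * (globalObj 𝓓 F (avg X) - m)

/-- The gradient mixing error at a consensus point is controlled by a constant and by the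
optimality gap. -/
def MixingBound (𝓓 : ∀ i, Measure (Ξ i)) (F : ∀ i, Vec d → Ξ i → ℝ)
    (𝒲 : ℕ → Measure (Matrix (Fin n) (Fin n) ℝ)) (a b m : ℝ) : Prop :=
  ∀ (t : ℕ) (x : Vec d), ∫ W, (1 / (n : ℝ)) * frobSq (mixDev W (gradMat 𝓓 F (fun _ => x))) ∂(𝒲 t)
    ≤ a + b * (globalObj 𝓓 F x - m)

variable {𝓓 : ∀ i, Measure (Ξ i)} {F : ∀ i, Vec d → Ξ i → ℝ} {L : ℝ}

theorem integral_norm_sub_integral_sq_le {α : Type*} [MeasurableSpace α] {μ : Measure α}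
    [IsProbabilityMeasure μ] {Z : α → Vec d} (hZ : MemLp Z 2 μ) :
    ∫ a, ‖Z a - ∫ b, Z b ∂μ‖ ^ 2 ∂μ ≤ ∫ a, ‖Z a‖ ^ 2 ∂μ := by
  set c := ∫ b, Z b ∂μ with hc
  have hi : Integrable Z μ := hZ.integrable (by norm_num)
  have hi2 : Integrable (fun a => ‖Z a‖ ^ 2) μ := (memLp_two_iff_integrable_sq_norm hZ.1).1 hZ
  have hin : Integrable (fun a => 2 * ⟪Z a, c⟫_ℝ) μ := (hi.inner_const c).const_mul 2
  have e : ∀ a, ‖Z a - c‖ ^ 2 = ‖Z a‖ ^ 2 - 2 * ⟪Z a, c⟫_ℝ + ‖c‖ ^ 2 := fun a =>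
    norm_sub_sq_real _ _
  have e2 : ∫ a, ⟪Z a, c⟫_ℝ ∂μ = ‖c‖ ^ 2 := by
    simp_rw [real_inner_comm c]
    rw [integral_inner hi, ← hc, real_inner_self_eq_norm_sq]
  simp_rw [e]
  rw [integral_add (f := fun a => ‖Z a‖ ^ 2 - 2 * ⟪Z a, c⟫_ℝ) (hi2.sub hin)
    (integrable_const _), integral_sub hi2 hin, integral_const_mul, e2]
  simp only [integral_const, probReal_univ, one_smul]
  nlinarith [sq_nonneg ‖c‖]

theorem memLp_stochGrad_sub (hO : IsStochObjective 𝓓 F) (hS : LSmooth 𝓓 F L) (i : Fin n)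
    (x y : Vec d) : MemLp (fun ξ => stochGrad F i x ξ - stochGrad F i y ξ) 2 (𝓓 i) := by
  have := hO.prob i
  refine MemLp.of_bound ((hO.measurable_stochGrad i x).sub
    (hO.measurable_stochGrad i y)).aestronglyMeasurable (L * ‖x - y‖) ?_
  filter_upwards [hS.lipschitz i] with ξ hξ
  rw [norm_sub_rev x y]
  exact hξ y x

/-- Stochastic gradients at two points differ by an almost surely bounded vector, so finite variance
at a single point `y` propagates to every `x`. This is what makes a variance bound at `x⋆` alone
usable. -/
theorem memLp_stochGrad (hO : IsStochObjective 𝓓 F) (hS : LSmooth 𝓓 F L) {σ : ℝ} {y : Vec d}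
    (hV : VarianceAt 𝓓 F σ y) (i : Fin n) (x : Vec d) :
    MemLp (fun ξ => stochGrad F i x ξ) 2 (𝓓 i) := by
  have := hO.prob i
  have h1 : MemLp (fun ξ => stochGrad F i y ξ - gradient (localObj 𝓓 F i) y) 2 (𝓓 i) :=
    (memLp_two_iff_integrable_sq_norm
      ((hO.measurable_stochGrad i y).sub_const _).aestronglyMeasurable).2 (hV.1 i)
  have h2 := ((memLp_stochGrad_sub hO hS i x y).add h1).add
    (memLp_const (gradient (localObj 𝓓 F i) y))
  refine h2.congr_norm (hO.measurable_stochGrad i x).aestronglyMeasurable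
    (Filter.Eventually.of_forall fun ξ => ?_)
  simp

theorem memLp_noise (hO : IsStochObjective 𝓓 F) (hS : LSmooth 𝓓 F L) {σ : ℝ} {y : Vec d}
    (hV : VarianceAt 𝓓 F σ y) (i : Fin n) (x : Vec d) :
    MemLp (fun ξ => noise 𝓓 F i x ξ) 2 (𝓓 i) := by
  have := hO.prob i
  exact (memLp_stochGrad hO hS hV i x).sub (memLp_const _)

theorem integral_noise (hO : IsStochObjective 𝓓 F) (hS : LSmooth 𝓓 F L) (i : Fin n)
    (x : Vec d) : ∫ ξ, noise 𝓓 F i x ξ ∂(𝓓 i) = 0 := by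
  have := hO.prob i
  simp only [noise]
  rw [integral_sub (integrable_stochGrad hO hS i x) (integrable_const _), gradient_localObj hO hS]
  simp

/-- The difference of noises is the centred difference of stochastic gradients, and centring cannot
increase a second moment. -/
theorem integral_norm_noise_sub_sq_le (hO : IsStochObjective 𝓓 F) (hS : LSmooth 𝓓 F L)
    (i : Fin n) (x y : Vec d) :
    ∫ ξ, ‖noise 𝓓 F i x ξ - noise 𝓓 F i y ξ‖ ^ 2 ∂(𝓓 i)
      ≤ ∫ ξ, ‖stochGrad F i x ξ - stochGrad F i y ξ‖ ^ 2 ∂(𝓓 i) := by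
  have := hO.prob i
  refine le_trans (le_of_eq ?_) (integral_norm_sub_integral_sq_le (memLp_stochGrad_sub hO hS i x y))
  rw [integral_sub (integrable_stochGrad hO hS i x) (integrable_stochGrad hO hS i y),
    ← gradient_localObj hO hS, ← gradient_localObj hO hS]
  refine integral_congr_ae (Filter.Eventually.of_forall fun ξ => ?_)
  simp only [noise]
  congr 2
  abel

theorem integral_norm_noise_sub_sq_le_lipschitz (hO : IsStochObjective 𝓓 F) (hS : LSmooth 𝓓 F L)
    (i : Fin n) (x y : Vec d) :
    ∫ ξ, ‖noise 𝓓 F i x ξ - noise 𝓓 F i y ξ‖ ^ 2 ∂(𝓓 i) ≤ L ^ 2 * ‖x - y‖ ^ 2 := by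
  have := hO.prob i
  refine (integral_norm_noise_sub_sq_le hO hS i x y).trans ?_
  have h := norm_integral_le_of_norm_le_const (μ := 𝓓 i)
    (f := fun ξ => ‖stochGrad F i x ξ - stochGrad F i y ξ‖ ^ 2) (C := L ^ 2 * ‖x - y‖ ^ 2) (by
      filter_upwards [hS.lipschitz i] with ξ hξ
      rw [norm_pow, norm_norm, ← mul_pow, norm_sub_rev x y]
      gcongr
      exact hξ y x)
  simpa using (le_abs_self _).trans h

theorem sum_integral_norm_noise_sub_avg_sq_le (hO : IsStochObjective 𝓓 F) (hS : LSmooth 𝓓 F L)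
    (X : Cols d n) :
    (1 / (n : ℝ)) * ∑ i, ∫ ξ, ‖noise 𝓓 F i (X i) ξ - noise 𝓓 F i (avg X) ξ‖ ^ 2 ∂(𝓓 i)
      ≤ L ^ 2 * consensusError X := by
  have h : ∑ i, ∫ ξ, ‖noise 𝓓 F i (X i) ξ - noise 𝓓 F i (avg X) ξ‖ ^ 2 ∂(𝓓 i)
      ≤ L ^ 2 * frobSq (X - avgMat X) := by
    rw [frobSq, Finset.mul_sum]
    exact Finset.sum_le_sum fun i _ => integral_norm_noise_sub_sq_le_lipschitz hO hS i _ _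
  rw [consensusError, mul_left_comm]
  gcongr

theorem _root_.MeasureTheory.MemLp.integrable_norm_sq {α E : Type*} [MeasurableSpace α]
    [NormedAddCommGroup E] {μ : Measure α} {Z : α → E} (hZ : MemLp Z 2 μ) :
    Integrable (fun a => ‖Z a‖ ^ 2) μ :=
  (memLp_two_iff_integrable_sq_norm hZ.1).1 hZ

/-- The noise at `X i` is the noise at the average plus a difference paid for by the consensus
error. The factor 3 where 2 would do keeps the same `NoiseBound` constants as under sample
convexity. -/
theorem BoundedVariance.noiseBound (hO : IsStochObjective 𝓓 F) (hS : LSmooth 𝓓 F L) {σ : ℝ}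
    (hV : BoundedVariance 𝓓 F σ) (m : ℝ) : NoiseBound 𝓓 F L (3 * σ ^ 2) 0 m := by
  intro X
  have hm := fun i x => memLp_noise hO hS (hV 0) i x
  have h1 : ∀ i, noiseVar 𝓓 F i (X i)
      ≤ 3 * (∫ ξ, ‖noise 𝓓 F i (X i) ξ - noise 𝓓 F i (avg X) ξ‖ ^ 2 ∂(𝓓 i))
        + 3 * noiseVar 𝓓 F i (avg X) := fun i => by
    have hi1 := ((MemLp.integrable_norm_sq
      (Z := fun ξ => noise 𝓓 F i (X i) ξ - noise 𝓓 F i (avg X) ξ)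
      ((hm i (X i)).sub (hm i (avg X))))).const_mul 3
    have hi2 := ((hm i (avg X)).integrable_norm_sq).const_mul 3
    simp only [noiseVar]
    rw [← integral_const_mul, ← integral_const_mul, ← integral_add hi1 hi2]
    refine integral_mono (hm i (X i)).integrable_norm_sq (hi1.add hi2) fun ξ => ?_
    have := norm_add_add_sq_le (noise 𝓓 F i (X i) ξ - noise 𝓓 F i (avg X) ξ)
      (noise 𝓓 F i (avg X) ξ) 0
    simpa using this
  have h2 := sum_integral_norm_noise_sub_avg_sq_le hO hS X
  have h3 : (1 / (n : ℝ)) * ∑ i, noiseVar 𝓓 F i (avg X) ≤ σ ^ 2 := (hV (avg X)).2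
  calc (1 / (n : ℝ)) * ∑ i, noiseVar 𝓓 F i (X i)
      ≤ (1 / (n : ℝ)) * ∑ i, (3 * (∫ ξ, ‖noise 𝓓 F i (X i) ξ - noise 𝓓 F i (avg X) ξ‖ ^ 2 ∂(𝓓 i))
        + 3 * noiseVar 𝓓 F i (avg X)) := by
        gcongr with i
        exact h1 i
    _ ≤ _ := by
        rw [Finset.sum_add_distrib, ← Finset.mul_sum, ← Finset.mul_sum]
        linarith

/-- The linear terms average to `⟪∇f(x⋆), x - x⋆⟫ = 0`. Individual `∇f_i(x⋆)` need not vanish, so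
co-coercivity bounds turn into the gap of `f` only after averaging over the nodes. -/
theorem sum_bregman_eq (hn : 0 < n) (hO : IsStochObjective 𝓓 F) (hS : LSmooth 𝓓 F L) {xs : Vec d}
    (hm : ∀ y, globalObj 𝓓 F xs ≤ globalObj 𝓓 F y) (x : Vec d) :
    (1 / (n : ℝ)) * ∑ i, (localObj 𝓓 F i x - localObj 𝓓 F i xs
      - ⟪gradient (localObj 𝓓 F i) xs, x - xs⟫_ℝ) = globalObj 𝓓 F x - globalObj 𝓓 F xs := by
  have h0 := gradient_globalObj_eq_zero hn hO hS hm
  rw [gradient_globalObj hO hS] at h0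
  rw [Finset.sum_sub_distrib, Finset.sum_sub_distrib, ← sum_inner, mul_sub, mul_sub,
    ← real_inner_smul_left, h0, inner_zero_left, sub_zero]
  rfl

/-- Co-coercivity holds for almost every sample and is then integrated; this is where convexity of
the samples, and not only of `f_i`, enters. -/
theorem integral_norm_stochGrad_sub_sq_le (hO : IsStochObjective 𝓓 F) (hS : LSmooth 𝓓 F L)
    (hC : SampleConvex 𝓓 F) (i : Fin n) (x y : Vec d) :
    ∫ ξ, ‖stochGrad F i x ξ - stochGrad F i y ξ‖ ^ 2 ∂(𝓓 i)
      ≤ 2 * L * (localObj 𝓓 F i x - localObj 𝓓 F i y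
        - ⟪gradient (localObj 𝓓 F i) y, x - y⟫_ℝ) := by
  have hi := integrable_inner_stochGrad hO hS i y (x - y)
  have hi' := (hO.integrable i x).sub (hO.integrable i y)
  have e : localObj 𝓓 F i x - localObj 𝓓 F i y - ⟪gradient (localObj 𝓓 F i) y, x - y⟫_ℝ
      = ∫ ξ, (F i x ξ - F i y ξ - ⟪stochGrad F i y ξ, x - y⟫_ℝ) ∂(𝓓 i) := by
    rw [integral_sub (f := fun ξ => F i x ξ - F i y ξ) hi' hi,
      integral_sub (hO.integrable i x) (hO.integrable i y), gradient_localObj hO hS]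
    congr 1
    rw [real_inner_comm, ← integral_inner (integrable_stochGrad hO hS i y)]
    simp_rw [real_inner_comm]
  rw [e, ← integral_const_mul]
  refine integral_mono_ae (memLp_stochGrad_sub hO hS i x y).integrable_norm_sq
    ((hi'.sub hi).const_mul _) ?_
  filter_upwards [hS.differentiable i, hC i, hS.ae_abs_sub_sub_inner_le i] with ξ hd hc hq
  refine norm_sub_sq_le_of_convex (g := fun z => F i z ξ) hS.nonneg (fun z => ?_)
    (fun z => add_inner_gradient_le_of_convexOn hd hc y z)
  linarith [(abs_le.1 (hq x z)).2]

/-- The noise is moved from `X i` to the average (cost: consensus error), then to `x⋆` (cost: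
optimality gap, by co-coercivity), where `σ` applies. The coefficient `6L` is the splitting factor 3
times `2L`. -/
theorem SampleConvex.noiseBound (hn : 0 < n) (hO : IsStochObjective 𝓓 F) (hS : LSmooth 𝓓 F L)
    (hC : SampleConvex 𝓓 F) {σ : ℝ} {xs : Vec d} (hV : VarianceAt 𝓓 F σ xs)
    (hmin : ∀ y, globalObj 𝓓 F xs ≤ globalObj 𝓓 F y) :
    NoiseBound 𝓓 F L (3 * σ ^ 2) (6 * L) (globalObj 𝓓 F xs) := by
  intro X
  have hm := fun i x => memLp_noise hO hS hV i x
  have h1 : ∀ i, noiseVar 𝓓 F i (X i)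
      ≤ 3 * (∫ ξ, ‖noise 𝓓 F i (X i) ξ - noise 𝓓 F i (avg X) ξ‖ ^ 2 ∂(𝓓 i))
        + 3 * (∫ ξ, ‖noise 𝓓 F i (avg X) ξ - noise 𝓓 F i xs ξ‖ ^ 2 ∂(𝓓 i))
        + 3 * noiseVar 𝓓 F i xs := fun i => by
    have hi1 := ((MemLp.integrable_norm_sq
      (Z := fun ξ => noise 𝓓 F i (X i) ξ - noise 𝓓 F i (avg X) ξ)
      ((hm i (X i)).sub (hm i (avg X))))).const_mul 3
    have hi2 := ((MemLp.integrable_norm_sq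
      (Z := fun ξ => noise 𝓓 F i (avg X) ξ - noise 𝓓 F i xs ξ)
      ((hm i (avg X)).sub (hm i xs)))).const_mul 3
    have hi3 := ((hm i xs).integrable_norm_sq).const_mul 3
    simp only [noiseVar]
    rw [← integral_const_mul, ← integral_const_mul, ← integral_const_mul, ← integral_add hi1 hi2,
      ← integral_add (f := fun ξ => 3 * ‖noise 𝓓 F i (X i) ξ - noise 𝓓 F i (avg X) ξ‖ ^ 2
        + 3 * ‖noise 𝓓 F i (avg X) ξ - noise 𝓓 F i xs ξ‖ ^ 2) (hi1.add hi2) hi3]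
    refine integral_mono (hm i (X i)).integrable_norm_sq ((hi1.add hi2).add hi3) fun ξ => ?_
    have := norm_add_add_sq_le (noise 𝓓 F i (X i) ξ - noise 𝓓 F i (avg X) ξ)
      (noise 𝓓 F i (avg X) ξ - noise 𝓓 F i xs ξ) (noise 𝓓 F i xs ξ)
    simpa using this
  have h2 := sum_integral_norm_noise_sub_avg_sq_le hO hS X
  have h3 : (1 / (n : ℝ)) * ∑ i, noiseVar 𝓓 F i xs ≤ σ ^ 2 := hV.2
  have h4 : (1 / (n : ℝ)) * ∑ i, ∫ ξ, ‖noise 𝓓 F i (avg X) ξ - noise 𝓓 F i xs ξ‖ ^ 2 ∂(𝓓 i)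
      ≤ 2 * L * (globalObj 𝓓 F (avg X) - globalObj 𝓓 F xs) := by
    rw [← sum_bregman_eq hn hO hS hmin, mul_left_comm, Finset.mul_sum _ _ (2 * L)]
    gcongr with i
    exact (integral_norm_noise_sub_sq_le hO hS i _ _).trans
      (integral_norm_stochGrad_sub_sq_le hO hS hC i _ _)
  calc (1 / (n : ℝ)) * ∑ i, noiseVar 𝓓 F i (X i)
      ≤ (1 / (n : ℝ)) * ∑ i, (3 * (∫ ξ, ‖noise 𝓓 F i (X i) ξ - noise 𝓓 F i (avg X) ξ‖ ^ 2 ∂(𝓓 i))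
        + 3 * (∫ ξ, ‖noise 𝓓 F i (avg X) ξ - noise 𝓓 F i xs ξ‖ ^ 2 ∂(𝓓 i))
        + 3 * noiseVar 𝓓 F i xs) := by
        gcongr with i
        exact h1 i
    _ ≤ _ := by
        rw [Finset.sum_add_distrib, Finset.sum_add_distrib, ← Finset.mul_sum, ← Finset.mul_sum,
          ← Finset.mul_sum]
        linarith

theorem NoiseBound.mono {a b b' m : ℝ} (h : NoiseBound 𝓓 F L a b m) (hb : b ≤ b')
    (hm : ∀ y, m ≤ globalObj 𝓓 F y) : NoiseBound 𝓓 F L a b' m := fun X =>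
  (h X).trans (by
    have := mul_le_mul_of_nonneg_right hb (sub_nonneg.2 (hm (avg X)))
    linarith)

end Noise

/-! ### The gradient mixing error -/

section Mixing

variable {d n : ℕ} {Ξ : Fin n → Type*} [∀ i, MeasurableSpace (Ξ i)]
  {𝓓 : ∀ i, Measure (Ξ i)} {F : ∀ i, Vec d → Ξ i → ℝ} {L p : ℝ}
  {𝒲 : ℕ → Measure (Matrix (Fin n) (Fin n) ℝ)}

theorem avgMat_const (hn : 0 < n) (x : Vec d) : avgMat (fun _ : Fin n => x) = fun _ => x := by
  ext1 i
  exact avg_const hn x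

theorem RelativeHeterogeneity.mixingBound (hn : 0 < n) {ζ : ℝ}
    (h : RelativeHeterogeneity 𝓓 F 𝒲 ζ) (m : ℝ) : MixingBound 𝓓 F 𝒲 (ζ ^ 2) 0 m := by
  intro t x
  have h1 := h (fun _ => x) t
  rw [avgMat_const hn] at h1
  rw [zero_mul, add_zero]
  exact h1

/-- The consensus contraction, applied to the gradient matrix itself. -/
theorem DissimilarityAt.mixingErrorAt (hC : ConsensusFactor d 𝒲 p) {ζ : ℝ} {X : Cols d n}
    (h : DissimilarityAt 𝓓 F ζ X) : MixingErrorAt 𝓓 F 𝒲 (√(1 - p) * ζ) X := by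
  intro t
  have hp : 0 ≤ 1 - p := sub_nonneg.2 hC.le_one
  rw [integral_const_mul, mul_pow, Real.sq_sqrt hp]
  calc _ ≤ (1 / (n : ℝ)) * ((1 - p) * frobSq (gradMat 𝓓 F X - avgMat (gradMat 𝓓 F X))) := by
        gcongr
        exact hC.contraction t _
    _ = (1 - p) * ((1 / (n : ℝ)) * frobSq (gradMat 𝓓 F X - avgMat (gradMat 𝓓 F X))) := by ring
    _ ≤ (1 - p) * ζ ^ 2 := mul_le_mul_of_nonneg_left h hp

theorem norm_gradient_localObj_sub_sq_le (hO : IsStochObjective 𝓓 F) (hS : LSmooth 𝓓 F L)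
    (hμ : MuConvex 𝓓 F 0) (i : Fin n) (x y : Vec d) :
    ‖gradient (localObj 𝓓 F i) x - gradient (localObj 𝓓 F i) y‖ ^ 2
      ≤ 2 * L * (localObj 𝓓 F i x - localObj 𝓓 F i y
        - ⟪gradient (localObj 𝓓 F i) y, x - y⟫_ℝ) := by
  refine norm_sub_sq_le_of_convex (g := localObj 𝓓 F i) hS.nonneg (fun z => ?_) (fun z => ?_)
  · linarith [(abs_le.1 (abs_localObj_sub_sub_inner_le hO hS i x z)).2]
  · have := hμ i y z
    rw [← neg_sub z y, inner_neg_right] at this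
    simp only [zero_div, zero_mul, add_zero] at this
    linarith

/-- The gradient matrix at `x` differs from that at `x⋆` by a matrix `A`. Mixing does not expand in
mean square, and co-coercivity bounds `‖A‖²/n` by `2L` times the gap; the splitting of the square
doubles both constants. -/
theorem MixingErrorAt.mixingBound (hn : 0 < n) (hO : IsStochObjective 𝓓 F) (hS : LSmooth 𝓓 F L)
    (hW : IsMixingLaw 𝒲) (hC : ConsensusFactor d 𝒲 p) (hμ : MuConvex 𝓓 F 0) {ζ : ℝ} {xs : Vec d}
    (hmin : ∀ y, globalObj 𝓓 F xs ≤ globalObj 𝓓 F y)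
    (h : MixingErrorAt 𝓓 F 𝒲 ζ (fun _ => xs)) :
    MixingBound 𝓓 F 𝒲 (2 * ζ ^ 2) (4 * L) (globalObj 𝓓 F xs) := by
  intro t x
  set A : Cols d n := gradMat 𝓓 F (fun _ => x) - gradMat 𝓓 F (fun _ => xs) with hA
  have hi := fun X : Cols d n => integrable_frobSq_mixDev hn hW t X
  have h1 : ∀ W, frobSq (mixDev W (gradMat 𝓓 F (fun _ => x)))
      ≤ 2 * frobSq (mixDev W A) + 2 * frobSq (mixDev W (gradMat 𝓓 F (fun _ => xs))) := fun W => by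
    have e : gradMat 𝓓 F (fun _ => x) = A + gradMat 𝓓 F (fun _ => xs) := by simp [hA]
    have := frobSq_add_le one_pos (mixDev W A) (mixDev W (gradMat 𝓓 F (fun _ => xs)))
    rw [← mixDev_add, ← e] at this
    linarith
  have h2 : ∫ W, frobSq (mixDev W A) ∂(𝒲 t) ≤ frobSq A := by
    refine (hC.contraction t A).trans ?_
    refine le_trans ?_ (frobSq_sub_avgMat_le_frobSq hn A)
    exact mul_le_of_le_one_left (frobSq_nonneg _) (by linarith [hC.pos])
  have h3 : (1 / (n : ℝ)) * frobSq A ≤ 2 * L * (globalObj 𝓓 F x - globalObj 𝓓 F xs) := by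
    rw [← sum_bregman_eq hn hO hS hmin, mul_left_comm, Finset.mul_sum, frobSq]
    gcongr with i
    exact norm_gradient_localObj_sub_sq_le hO hS hμ i x xs
  have h4 := h t
  rw [integral_const_mul] at h4 ⊢
  calc _ ≤ (1 / (n : ℝ)) * ∫ W, (2 * frobSq (mixDev W A)
          + 2 * frobSq (mixDev W (gradMat 𝓓 F (fun _ => xs)))) ∂(𝒲 t) := by
        refine mul_le_mul_of_nonneg_left ?_ (by positivity)
        exact integral_mono (hi _) (((hi _).const_mul 2).add ((hi _).const_mul 2)) h1
    _ = 2 * ((1 / (n : ℝ)) * ∫ W, frobSq (mixDev W A) ∂(𝒲 t))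
          + 2 * ((1 / (n : ℝ)) * ∫ W, frobSq (mixDev W (gradMat 𝓓 F (fun _ => xs))) ∂(𝒲 t)) := by
        rw [integral_add ((hi _).const_mul 2) ((hi _).const_mul 2), integral_const_mul,
          integral_const_mul]
        ring
    _ ≤ 2 * ((1 / (n : ℝ)) * frobSq A) + 2 * ζ ^ 2 := by
        gcongr
        exact h4
    _ ≤ _ := by linarith

end Mixing

/-! ### Independence structure of the sampling -/

/-- The joint law is a product, so Fubini integrates out `V` with `U` frozen. This takes the place
of conditional expectations in the whole argument. -/
theorem integral_comp_prodMk_of_indepFun {Ω α β : Type*} [MeasurableSpace Ω] [MeasurableSpace α]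
    [MeasurableSpace β] {P : Measure Ω} [IsProbabilityMeasure P] {U : Ω → α} {V : Ω → β}
    (h : IndepFun U V P) (hU : Measurable U) (hV : Measurable V) {φ : α × β → ℝ}
    (hφ : Measurable φ) (hi : Integrable (fun ω => φ (U ω, V ω)) P) :
    Integrable (fun ω => ∫ v, φ (U ω, v) ∂(P.map V)) P ∧
      ∫ ω, φ (U ω, V ω) ∂P = ∫ ω, ∫ v, φ (U ω, v) ∂(P.map V) ∂P := by
  have := Measure.isProbabilityMeasure_map (μ := P) hU.aemeasurable
  have := Measure.isProbabilityMeasure_map (μ := P) hV.aemeasurable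
  have hmap := (indepFun_iff_map_prod_eq_prod_map_map hU.aemeasurable hV.aemeasurable).1 h
  have hUV : Measurable fun ω => (U ω, V ω) := hU.prodMk hV
  have hi' : Integrable φ ((P.map U).prod (P.map V)) := by
    rw [← hmap]
    exact (integrable_map_measure hφ.aestronglyMeasurable hUV.aemeasurable).2 hi
  have hl : Integrable (fun u => ∫ v, φ (u, v) ∂(P.map V)) (P.map U) := hi'.integral_prod_left
  refine ⟨(integrable_map_measure hl.1 hU.aemeasurable).1 hl, ?_⟩
  rw [← integral_map hU.aemeasurable hl.1, ← integral_prod φ hi', ← hmap,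
    integral_map hUV.aemeasurable hφ.aestronglyMeasurable]

/-! ### Measurability of the building blocks, relative to an arbitrary σ-algebra. -/

section Measurability

variable {d n : ℕ} {Ξ : Fin n → Type*} [∀ i, MeasurableSpace (Ξ i)]
  {𝓓 : ∀ i, Measure (Ξ i)} {F : ∀ i, Vec d → Ξ i → ℝ} {α : Type*} {m : MeasurableSpace α}

theorem measurable_stochGrad_comp (hO : IsStochObjective 𝓓 F) {i : Fin n} {X : α → Vec d}
    {Y : α → Ξ i} (hX : Measurable X) (hY : Measurable Y) :
    Measurable fun ω => stochGrad F i (X ω) (Y ω) :=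
  (hO.measurable_grad i).comp (hX.prodMk hY)

theorem measurable_noise_comp {L : ℝ} (hO : IsStochObjective 𝓓 F) (hS : LSmooth 𝓓 F L) {i : Fin n}
    {X : α → Vec d} {Y : α → Ξ i} (hX : Measurable X) (hY : Measurable Y) :
    Measurable fun ω => noise 𝓓 F i (X ω) (Y ω) :=
  (measurable_stochGrad_comp hO hX hY).sub
    ((continuous_gradient_localObj hO hS i).measurable.comp hX)

theorem measurable_mix_comp {V : α → Cols d n} {M : α → Matrix (Fin n) (Fin n) ℝ}
    (hV : Measurable V) (hM : Measurable M) : Measurable fun ω => mix (M ω) (V ω) := by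
  refine measurable_pi_lambda _ fun j => ?_
  refine Finset.measurable_fun_sum _ fun i _ => ?_
  exact ((measurable_entry i j).comp hM).smul ((measurable_pi_apply i).comp hV)

theorem measurable_mixDev_comp {V : α → Cols d n} {M : α → Matrix (Fin n) (Fin n) ℝ}
    (hV : Measurable V) (hM : Measurable M) (j : Fin n) :
    Measurable fun ω => mixDev (M ω) (V ω) j := by
  have h : Measurable ((fun q : Cols d n × Matrix (Fin n) (Fin n) ℝ => mixDev q.2 q.1 j) ∘
      fun ω => (V ω, M ω)) := (measurable_mixDev j).comp (hV.prodMk hM)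
  exact h

theorem measurable_gradient_step (hO : IsStochObjective 𝓓 F) {X : α → Cols d n}
    {Y : ∀ i, α → Ξ i} (hX : Measurable X) (hY : ∀ i, Measurable (Y i)) (c : ℝ) :
    Measurable fun ω i => X ω i - c • stochGrad F i (X ω i) (Y i ω) := by
  refine measurable_pi_lambda _ fun i => ?_
  have hi : Measurable fun ω => X ω i := (measurable_pi_apply i).comp hX
  exact hi.sub ((measurable_stochGrad_comp hO hi (hY i)).const_smul c)

theorem measurable_noise_cols {L : ℝ} (hO : IsStochObjective 𝓓 F) (hS : LSmooth 𝓓 F L)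
    {X : α → Cols d n} {Y : ∀ i, α → Ξ i} (hX : Measurable X) (hY : ∀ i, Measurable (Y i)) :
    Measurable fun ω i => noise 𝓓 F i (X ω i) (Y i ω) :=
  measurable_pi_lambda _ fun i =>
    measurable_noise_comp hO hS ((measurable_pi_apply i).comp hX) (hY i)

end Measurability

/-! ### Information σ-algebras and independence of fresh draws. -/

section Sampling

variable {d n : ℕ} {Ξ : Fin n → Type*} [∀ i, MeasurableSpace (Ξ i)]
variable {Ω : Type*} 

/-- The σ-algebra generated by the samples and mixing matrices with index in `S`. -/
@[reducible] def info (ξ : ℕ → ∀ i, Ω → Ξ i) (W : ℕ → Ω → Matrix (Fin n) (Fin n) ℝ)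
    (S : Set ((ℕ × Fin n) ⊕ ℕ)) : MeasurableSpace Ω :=
  ⨆ s ∈ S, Sum.elim (fun q : ℕ × Fin n => MeasurableSpace.comap (ξ q.1 q.2) inferInstance)
    (fun t => MeasurableSpace.comap (W t) inferInstance) s

/-- The indices of the random variables drawn before time `t`. -/
def past (n t : ℕ) : Set ((ℕ × Fin n) ⊕ ℕ) := {s | Sum.elim (fun q => q.1 < t) (fun u => u < t) s}

variable {ξ : ℕ → ∀ i, Ω → Ξ i} {W : ℕ → Ω → Matrix (Fin n) (Fin n) ℝ}

theorem info_mono {S T : Set ((ℕ × Fin n) ⊕ ℕ)} (h : S ⊆ T) : info ξ W S ≤ info ξ W T :=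
  biSup_mono h

theorem measurable_info_sample {S : Set ((ℕ × Fin n) ⊕ ℕ)} {t : ℕ} {i : Fin n}
    (h : Sum.inl (t, i) ∈ S) : Measurable[info ξ W S] (ξ t i) :=
  Measurable.mono (comap_measurable (ξ t i)) (le_iSup₂_of_le (Sum.inl (t, i)) h le_rfl) le_rfl

theorem measurable_info_mixing {S : Set ((ℕ × Fin n) ⊕ ℕ)} {t : ℕ}
    (h : Sum.inr t ∈ S) : Measurable[info ξ W S] (W t) :=
  Measurable.mono (comap_measurable (W t)) (le_iSup₂_of_le (Sum.inr t) h le_rfl) le_rfl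

theorem measurable_info_iterate {F : ∀ i, Vec d → Ξ i → ℝ} {𝓓 : ∀ i, Measure (Ξ i)}
    (hO : IsStochObjective 𝓓 F)
    (X₀ : Cols d n) (η : ℕ → ℝ) (t : ℕ) :
    Measurable[info ξ W (past n t)] (iterate F X₀ η ξ W t) := by
  induction t with
  | zero => exact measurable_const
  | succ t ih =>
    have hle : info ξ W (past n t) ≤ info ξ W (past n (t + 1)) := info_mono fun s hs => by
      rcases s with q | u
      · exact Nat.lt_succ_of_lt hs
      · exact Nat.lt_succ_of_lt hs
    have ih' : Measurable[info ξ W (past n (t + 1))] (iterate F X₀ η ξ W t) :=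
      Measurable.mono ih hle le_rfl
    refine measurable_mix_comp ?_
      (measurable_info_mixing (Nat.lt_succ_self t))
    exact measurable_gradient_step hO ih'
      (fun i => measurable_info_sample (Nat.lt_succ_self t)) (η t)

variable [mΩ : MeasurableSpace Ω]
variable {P : Measure Ω} {𝓓 : ∀ i, Measure (Ξ i)} {𝒲 : ℕ → Measure (Matrix (Fin n) (Fin n) ℝ)}

namespace IsSampling

theorem coord_le (hI : IsSampling P 𝓓 𝒲 ξ W) (s : (ℕ × Fin n) ⊕ ℕ) :
    Sum.elim (fun q : ℕ × Fin n => MeasurableSpace.comap (ξ q.1 q.2) inferInstance)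
      (fun t => MeasurableSpace.comap (W t) inferInstance) s ≤ mΩ := by
  rcases s with ⟨t, i⟩ | t
  · exact (hI.measurable_sample t i).comap_le
  · exact (hI.measurable_mixing t).comap_le

theorem info_le (hI : IsSampling P 𝓓 𝒲 ξ W) (S : Set ((ℕ × Fin n) ⊕ ℕ)) : info ξ W S ≤ mΩ :=
  iSup₂_le fun s _ => hI.coord_le s

/-- Disjoint blocks of an independent family are independent. The index set `S` is kept general
because it must sometimes contain, besides the past, other draws made at time `t`. -/
theorem indepFun_sample (hI : IsSampling P 𝓓 𝒲 ξ W) {α : Type*} [MeasurableSpace α]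
    {S : Set ((ℕ × Fin n) ⊕ ℕ)} {t : ℕ} {i : Fin n} (h : Sum.inl (t, i) ∉ S) {U : Ω → α}
    (hU : Measurable[info ξ W S] U) : IndepFun U (ξ t i) P := by
  have hind := indep_iSup_of_disjoint hI.coord_le hI.indep (S := S) (T := {Sum.inl (t, i)})
    (Set.disjoint_singleton_right.2 h)
  rw [iSup_singleton] at hind
  rw [IndepFun_iff_Indep]
  exact indep_of_indep_of_le_left hind hU.comap_le

theorem indepFun_mixing (hI : IsSampling P 𝓓 𝒲 ξ W) {α : Type*} [MeasurableSpace α]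
    {S : Set ((ℕ × Fin n) ⊕ ℕ)} {t : ℕ} (h : Sum.inr t ∉ S) {U : Ω → α}
    (hU : Measurable[info ξ W S] U) : IndepFun U (W t) P := by
  have hind := indep_iSup_of_disjoint hI.coord_le hI.indep (S := S) (T := {Sum.inr t})
    (Set.disjoint_singleton_right.2 h)
  rw [iSup_singleton] at hind
  rw [IndepFun_iff_Indep]
  exact indep_of_indep_of_le_left hind hU.comap_le

theorem ae_sample (hI : IsSampling P 𝓓 𝒲 ξ W) (t : ℕ) (i : Fin n) {q : Ξ i → Prop}
    (h : ∀ᵐ x ∂(𝓓 i), q x) : ∀ᵐ ω ∂P, q (ξ t i ω) := by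
  rw [← hI.law_sample t i] at h
  exact ae_of_ae_map (hI.measurable_sample t i).aemeasurable h

theorem ae_doublyStochastic (hI : IsSampling P 𝓓 𝒲 ξ W) (hW : IsMixingLaw 𝒲) (t : ℕ) :
    ∀ᵐ ω ∂P, W t ω ∈ doublyStochastic ℝ (Fin n) := by
  have h := hW.doublyStochastic t
  rw [← hI.law_mixing t] at h
  exact ae_of_ae_map (hI.measurable_mixing t).aemeasurable h

end IsSampling

end Sampling

/-! ### Second moments -/

section Moments

variable {d n : ℕ} {Ξ : Fin n → Type*} [∀ i, MeasurableSpace (Ξ i)]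
variable {Ω : Type*} [mΩ : MeasurableSpace Ω]
variable {P : Measure Ω} {𝓓 : ∀ i, Measure (Ξ i)} {𝒲 : ℕ → Measure (Matrix (Fin n) (Fin n) ℝ)}
  {ξ : ℕ → ∀ i, Ω → Ξ i} {W : ℕ → Ω → Matrix (Fin n) (Fin n) ℝ}
  {F : ∀ i, Vec d → Ξ i → ℝ} {L : ℝ}

theorem _root_.MeasureTheory.MemLp.integrable_real_inner {α E : Type*} [MeasurableSpace α]
    [NormedAddCommGroup E] [InnerProductSpace ℝ E] {μ : Measure α} {A B : α → E}
    (hA : MemLp A 2 μ) (hB : MemLp B 2 μ) : Integrable (fun a => ⟪A a, B a⟫_ℝ) μ := by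
  refine (hA.integrable_norm_sq.add hB.integrable_norm_sq).mono' (hA.1.inner hB.1)
    (Filter.Eventually.of_forall fun a => ?_)
  rw [Pi.add_apply, Real.norm_eq_abs]
  nlinarith [abs_real_inner_le_norm (A a) (B a), sq_nonneg (‖A a‖ - ‖B a‖), sq_nonneg ‖A a‖,
    sq_nonneg ‖B a‖]

theorem memLp_stochGrad_comp (hO : IsStochObjective 𝓓 F) (hS : LSmooth 𝓓 F L)
    (hI : IsSampling P 𝓓 𝒲 ξ W) {σ : ℝ} {y : Vec d} (hV : VarianceAt 𝓓 F σ y) (t : ℕ) (i : Fin n)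
    {X : Ω → Vec d} (hX : Measurable X) (hX2 : MemLp X 2 P) :
    MemLp (fun ω => stochGrad F i (X ω) (ξ t i ω)) 2 P := by
  have := hI.prob
  have h1 : MemLp (fun ω => stochGrad F i y (ξ t i ω)) 2 P := by
    have h := memLp_stochGrad hO hS hV i y
    rw [← hI.law_sample t i] at h
    exact h.comp_of_map (hI.measurable_sample t i).aemeasurable
  have hm := measurable_stochGrad_comp hO hX (hI.measurable_sample t i)
  have h2 : MemLp (fun ω => stochGrad F i (X ω) (ξ t i ω) - stochGrad F i y (ξ t i ω)) 2 P := by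
    refine ((hX2.sub (memLp_const y)).const_smul L).mono (hm.sub (measurable_stochGrad_comp hO
      measurable_const (hI.measurable_sample t i))).aestronglyMeasurable ?_
    filter_upwards [hI.ae_sample t i (hS.lipschitz i)] with ω hω
    have := hω y (X ω)
    simp only [Pi.smul_apply, Pi.sub_apply, norm_smul, Real.norm_eq_abs]
    rw [abs_of_nonneg hS.nonneg, norm_sub_rev (X ω) y]
    exact this
  have h3 := h2.add h1
  refine h3.congr_norm hm.aestronglyMeasurable (Filter.Eventually.of_forall fun ω => ?_)
  simp

theorem memLp_gradient_localObj_comp (hO : IsStochObjective 𝓓 F) (hS : LSmooth 𝓓 F L)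
    [IsProbabilityMeasure P] (i : Fin n) {X : Ω → Vec d} (hX : Measurable X) (hX2 : MemLp X 2 P) :
    MemLp (fun ω => gradient (localObj 𝓓 F i) (X ω)) 2 P := by
  have hm : Measurable fun ω => gradient (localObj 𝓓 F i) (X ω) :=
    (continuous_gradient_localObj hO hS i).measurable.comp hX
  have h2 : MemLp (fun ω => gradient (localObj 𝓓 F i) (X ω) - gradient (localObj 𝓓 F i) 0) 2 P := by
    refine (hX2.const_smul L).mono (hm.sub_const _).aestronglyMeasurable
      (Filter.Eventually.of_forall fun ω => ?_)
    have := norm_gradient_localObj_sub_le hO hS i 0 (X ω)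
    simpa [norm_smul, abs_of_nonneg hS.nonneg] using this
  refine (h2.add (memLp_const (gradient (localObj 𝓓 F i) 0))).congr_norm hm.aestronglyMeasurable
    (Filter.Eventually.of_forall fun ω => ?_)
  simp

theorem memLp_noise_comp (hO : IsStochObjective 𝓓 F) (hS : LSmooth 𝓓 F L)
    (hI : IsSampling P 𝓓 𝒲 ξ W) {σ : ℝ} {y : Vec d} (hV : VarianceAt 𝓓 F σ y) (t : ℕ) (i : Fin n)
    {X : Ω → Vec d} (hX : Measurable X) (hX2 : MemLp X 2 P) :
    MemLp (fun ω => noise 𝓓 F i (X ω) (ξ t i ω)) 2 P := by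
  have := hI.prob
  exact (memLp_stochGrad_comp hO hS hI hV t i hX hX2).sub
    (memLp_gradient_localObj_comp hO hS i hX hX2)

theorem memLp_mix (hI : IsSampling P 𝓓 𝒲 ξ W) (hW : IsMixingLaw 𝒲) (t : ℕ) {V : Ω → Cols d n}
    (hV : Measurable V) (hV2 : ∀ i, MemLp (fun ω => V ω i) 2 P) (j : Fin n) :
    MemLp (fun ω => mix (W t ω) (V ω) j) 2 P := by
  refine memLp_finsetSum _ fun i _ => ?_
  refine (hV2 i).mono (((measurable_entry i j).comp (hI.measurable_mixing t)).smul
    ((measurable_pi_apply i).comp hV)).aestronglyMeasurable ?_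
  filter_upwards [hI.ae_doublyStochastic hW t] with ω hω
  rw [norm_smul, Real.norm_of_nonneg (nonneg_of_mem_doublyStochastic hω)]
  exact mul_le_of_le_one_left (norm_nonneg _) (le_one_of_mem_doublyStochastic hω)

theorem memLp_avg {V : Ω → Cols d n} (hV2 : ∀ i, MemLp (fun ω => V ω i) 2 P) :
    MemLp (fun ω => avg (V ω)) 2 P := by
  have h : MemLp (fun ω => ∑ i, V ω i) 2 P := memLp_finsetSum _ fun i _ => hV2 i
  exact h.const_smul (1 / (n : ℝ))

theorem memLp_mixDev (hI : IsSampling P 𝓓 𝒲 ξ W) (hW : IsMixingLaw 𝒲) (t : ℕ) {V : Ω → Cols d n}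
    (hV : Measurable V) (hV2 : ∀ i, MemLp (fun ω => V ω i) 2 P) (j : Fin n) :
    MemLp (fun ω => mixDev (W t ω) (V ω) j) 2 P :=
  (memLp_mix hI hW t hV hV2 j).sub (memLp_avg hV2)

theorem integrable_frobSq {V : Ω → Cols d n} (hV2 : ∀ i, MemLp (fun ω => V ω i) 2 P) :
    Integrable (fun ω => frobSq (V ω)) P :=
  integrable_finsetSum _ fun i _ => (hV2 i).integrable_norm_sq

theorem memLp_iterate (hO : IsStochObjective 𝓓 F) (hS : LSmooth 𝓓 F L)
    (hI : IsSampling P 𝓓 𝒲 ξ W) (hW : IsMixingLaw 𝒲) {σ : ℝ} {y : Vec d}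
    (hV : VarianceAt 𝓓 F σ y) (X₀ : Cols d n) (η : ℕ → ℝ) (t : ℕ) (i : Fin n) :
    MemLp (fun ω => iterate F X₀ η ξ W t ω i) 2 P := by
  have := hI.prob
  induction t generalizing i with
  | zero => exact memLp_const _
  | succ t ih =>
    have hm : ∀ i, Measurable fun ω => iterate F X₀ η ξ W t ω i := fun i =>
      (measurable_pi_apply i).comp ((measurable_info_iterate hO X₀ η t).mono (hI.info_le _) le_rfl)
    refine memLp_mix hI hW t (V := fun ω i => iterate F X₀ η ξ W t ω i
      - η t • stochGrad F i (iterate F X₀ η ξ W t ω i) (ξ t i ω)) ?_ (fun i => ?_) i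
    · exact measurable_gradient_step hO (measurable_pi_lambda _ hm) (hI.measurable_sample t) (η t)
    · exact (ih i).sub ((memLp_stochGrad_comp hO hS hI hV t i (hm i) (ih i)).const_smul (η t))

/-- With `A` and `X` frozen, the remaining integral over the fresh sample is that of centred noise.
All cross terms vanish through this lemma, with three choices of `S`: the past alone, the past with
another node's sample, and the past with the current mixing matrix. -/
theorem integral_inner_noise_eq_zero (hO : IsStochObjective 𝓓 F) (hS : LSmooth 𝓓 F L)
    (hI : IsSampling P 𝓓 𝒲 ξ W) {σ : ℝ} {y : Vec d} (hV : VarianceAt 𝓓 F σ y)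
    {S : Set ((ℕ × Fin n) ⊕ ℕ)} {t : ℕ} {i : Fin n} (hS' : Sum.inl (t, i) ∉ S) {A X : Ω → Vec d}
    (hA : Measurable[info ξ W S] A) (hX : Measurable[info ξ W S] X) (hA2 : MemLp A 2 P)
    (hX2 : MemLp X 2 P) : ∫ ω, ⟪A ω, noise 𝓓 F i (X ω) (ξ t i ω)⟫_ℝ ∂P = 0 := by
  have := hI.prob
  have hle := hI.info_le S
  have h2 := memLp_noise_comp hO hS hI hV t i (hX.mono hle le_rfl) hX2
  have hind : IndepFun (fun ω => (A ω, X ω)) (ξ t i) P :=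
    hI.indepFun_sample hS' (Measurable.prodMk hA hX)
  have h := (integral_comp_prodMk_of_indepFun hind
    ((hA.mono hle le_rfl).prodMk (hX.mono hle le_rfl)) (hI.measurable_sample t i)
    (φ := fun q : (Vec d × Vec d) × Ξ i => ⟪q.1.1, noise 𝓓 F i q.1.2 q.2⟫_ℝ)
    (measurable_fst.fst.inner (measurable_noise_comp hO hS measurable_fst.snd measurable_snd))
    (hA2.integrable_real_inner h2)).2
  refine h.trans ?_
  rw [hI.law_sample t i]
  refine integral_eq_zero_of_ae (Filter.Eventually.of_forall fun ω => ?_)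
  have hn := (memLp_noise hO hS hV i (X ω))
  have := hO.prob i
  change ∫ v, ⟪A ω, noise 𝓓 F i (X ω) v⟫_ℝ ∂(𝓓 i) = 0
  rw [integral_inner (hn.integrable (by norm_num)), integral_noise hO hS, inner_zero_right]

theorem integral_norm_noise_comp_sq (hO : IsStochObjective 𝓓 F) (hS : LSmooth 𝓓 F L)
    (hI : IsSampling P 𝓓 𝒲 ξ W) {σ : ℝ} {y : Vec d} (hV : VarianceAt 𝓓 F σ y)
    {S : Set ((ℕ × Fin n) ⊕ ℕ)} {t : ℕ} {i : Fin n} (hS' : Sum.inl (t, i) ∉ S) {X : Ω → Vec d}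
    (hX : Measurable[info ξ W S] X) (hX2 : MemLp X 2 P) :
    Integrable (fun ω => noiseVar 𝓓 F i (X ω)) P ∧
      ∫ ω, ‖noise 𝓓 F i (X ω) (ξ t i ω)‖ ^ 2 ∂P = ∫ ω, noiseVar 𝓓 F i (X ω) ∂P := by
  have := hI.prob
  have hX' := hX.mono (hI.info_le S) le_rfl
  have h := integral_comp_prodMk_of_indepFun (hI.indepFun_sample hS' hX) hX'
    (hI.measurable_sample t i) (φ := fun q : Vec d × Ξ i => ‖noise 𝓓 F i q.1 q.2‖ ^ 2)
    ((measurable_noise_comp hO hS measurable_fst measurable_snd).norm.pow_const 2)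
    (memLp_noise_comp hO hS hI hV t i hX' hX2).integrable_norm_sq
  rwa [hI.law_sample t i] at h

theorem integral_frobSq_mixDev_le (hI : IsSampling P 𝓓 𝒲 ξ W) (hW : IsMixingLaw 𝒲)
    {S : Set ((ℕ × Fin n) ⊕ ℕ)} {t : ℕ} (hS : Sum.inr t ∉ S) {V : Ω → Cols d n}
    (hV : Measurable[info ξ W S] V) (hV2 : ∀ i, MemLp (fun ω => V ω i) 2 P) {g : Ω → ℝ}
    (hg : Integrable g P) (h : ∀ ω, ∫ w, frobSq (mixDev w (V ω)) ∂(𝒲 t) ≤ g ω) :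
    ∫ ω, frobSq (mixDev (W t ω) (V ω)) ∂P ≤ ∫ ω, g ω ∂P := by
  have := hI.prob
  have hV' := hV.mono (hI.info_le S) le_rfl
  have h2 := integral_comp_prodMk_of_indepFun (hI.indepFun_mixing hS hV) hV'
    (hI.measurable_mixing t) measurable_frobSq_mixDev
    (integrable_frobSq fun j => memLp_mixDev hI hW t hV' hV2 j)
  rw [hI.law_mixing t] at h2
  refine le_trans (le_of_eq h2.2) ?_
  exact integral_mono h2.1 hg h

end Moments

/-! ### Deterministic estimates for one step -/

section Deterministic

variable {d n : ℕ} {Ξ : Fin n → Type*} [∀ i, MeasurableSpace (Ξ i)]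
  {𝓓 : ∀ i, Measure (Ξ i)} {F : ∀ i, Vec d → Ξ i → ℝ} {L p : ℝ}
  {𝒲 : ℕ → Measure (Matrix (Fin n) (Fin n) ℝ)}

theorem frobSq_gradMat_sub_le (hO : IsStochObjective 𝓓 F) (hS : LSmooth 𝓓 F L) (X : Cols d n) :
    frobSq (gradMat 𝓓 F X - gradMat 𝓓 F (avgMat X)) ≤ L ^ 2 * frobSq (X - avgMat X) := by
  rw [frobSq, frobSq, Finset.mul_sum]
  refine Finset.sum_le_sum fun i _ => ?_
  rw [← mul_pow]
  gcongr
  exact norm_gradient_localObj_sub_le hO hS i _ _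

theorem norm_gradient_sub_avg_gradMat_sq_le (hn : 0 < n) (hO : IsStochObjective 𝓓 F)
    (hS : LSmooth 𝓓 F L) (X : Cols d n) :
    ‖gradient (globalObj 𝓓 F) (avg X) - avg (gradMat 𝓓 F X)‖ ^ 2 ≤ L ^ 2 * consensusError X := by
  have e : gradient (globalObj 𝓓 F) (avg X) = avg (gradMat 𝓓 F (avgMat X)) :=
    gradient_globalObj hO hS _
  rw [norm_sub_rev, e, ← avg_sub]
  refine (norm_avg_sq_le hn _).trans ?_
  rw [consensusError, mul_left_comm]
  gcongr
  exact frobSq_gradMat_sub_le hO hS X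

/-- The expected effect of mixing on a deterministic gradient step. -/
theorem integral_frobSq_mixDev_gradient_step_le (hn : 0 < n) (hO : IsStochObjective 𝓓 F)
    (hS : LSmooth 𝓓 F L) (hW : IsMixingLaw 𝒲) (hC : ConsensusFactor d 𝒲 p) {a b m : ℝ}
    (hM : MixingBound 𝓓 F 𝒲 a b m) {η : ℝ} (hη : 0 ≤ η) (hηL : η * L ≤ p / 64) (t : ℕ)
    (X : Cols d n) :
    ∫ w, frobSq (mixDev w (X - η • gradMat 𝓓 F X)) ∂(𝒲 t)
      ≤ n * ((1 - p / 2) * consensusError X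
        + 5 * η ^ 2 / p * (a + b * (globalObj 𝓓 F (avg X) - m))) := by
  have hp := hC.pos
  have hp1 := hC.le_one
  have hn' : (0 : ℝ) < n := Nat.cast_pos.2 hn
  -- `G` is the gradient matrix at the consensus point, controlled only after mixing; `H` is
  -- dominated by `L(X - X̄)` and is absorbed into the contracted part `Y`.
  set H : Cols d n := gradMat 𝓓 F X - gradMat 𝓓 F (avgMat X) with hH
  set G : Cols d n := gradMat 𝓓 F (avgMat X) with hG
  set Y : Cols d n := X - η • H with hY
  have hi := fun X : Cols d n => integrable_frobSq_mixDev hn hW t X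
  have h1 : ∀ w, frobSq (mixDev w (X - η • gradMat 𝓓 F X))
      ≤ (1 + p / 4) * frobSq (mixDev w Y) + (1 + 1 / (p / 4)) * η ^ 2 * frobSq (mixDev w G) := by
    intro w
    have e : X - η • gradMat 𝓓 F X = Y + (-η) • G := by
      rw [hY, hH, smul_sub, neg_smul]
      abel
    rw [e, mixDev_add, mixDev_smul]
    refine (frobSq_add_le (a := p / 4) (by positivity) _ _).trans ?_
    rw [frobSq_smul, neg_sq, mul_assoc (1 + 1 / (p / 4))]
  have h2 : frobSq (Y - avgMat Y) ≤ (1 + p / 6) * frobSq (X - avgMat X) := by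
    have e : Y - avgMat Y = (X - avgMat X) + (-η) • (H - avgMat H) := by
      ext1 i
      simp only [hY, avgMat, avg_sub, avg_smul, Pi.sub_apply, Pi.add_apply, Pi.smul_apply, smul_sub,
        neg_smul, Pi.neg_apply]
      abel
    rw [e]
    -- With this parameter the `H` term costs at most `p/24`, and `p/8 + p/24 = p/6`.
    refine (frobSq_add_le (a := p / 8) (by positivity) _ _).trans ?_
    rw [frobSq_smul, neg_sq]
    have h3 : frobSq (H - avgMat H) ≤ L ^ 2 * frobSq (X - avgMat X) :=
      (frobSq_sub_avgMat_le_frobSq hn H).trans (frobSq_gradMat_sub_le hO hS X)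
    have h4 : (η * L) ^ 2 ≤ (p / 64) ^ 2 := by
      have := mul_nonneg hη hS.nonneg
      gcongr
    have h5 : (1 + 1 / (p / 8)) * (η ^ 2 * frobSq (H - avgMat H))
        ≤ (1 + 1 / (p / 8)) * ((p / 64) ^ 2 * frobSq (X - avgMat X)) := by
      refine mul_le_mul_of_nonneg_left ?_ (by positivity)
      calc η ^ 2 * frobSq (H - avgMat H) ≤ η ^ 2 * (L ^ 2 * frobSq (X - avgMat X)) := by gcongr
        _ = (η * L) ^ 2 * frobSq (X - avgMat X) := by ring
        _ ≤ _ := mul_le_mul_of_nonneg_right h4 (frobSq_nonneg _)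
    have h6 : (1 + 1 / (p / 8)) * (p / 64) ^ 2 ≤ p / 24 := by
      have e : (1 + 1 / (p / 8)) * (p / 64) ^ 2 = p ^ 2 / 4096 + p / 512 := by
        field_simp; ring
      rw [e]
      nlinarith
    have h7 := mul_le_mul_of_nonneg_right h6 (frobSq_nonneg (X - avgMat X))
    linarith
  have h8 : ∫ w, frobSq (mixDev w Y) ∂(𝒲 t)
      ≤ (1 - p) * ((1 + p / 6) * frobSq (X - avgMat X)) :=
    (hC.contraction t Y).trans (mul_le_mul_of_nonneg_left h2 (by linarith))
  have h9 : ∫ w, frobSq (mixDev w G) ∂(𝒲 t) ≤ n * (a + b * (globalObj 𝓓 F (avg X) - m)) := by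
    have h := hM t (avg X)
    rw [integral_const_mul, one_div_mul_eq_div, div_le_iff₀ hn', mul_comm] at h
    exact h
  have h10 : frobSq (X - avgMat X) = n * consensusError X := by
    rw [consensusError, ← mul_assoc, mul_one_div_cancel hn'.ne', one_mul]
  have hnon : 0 ≤ ∫ w, frobSq (mixDev w G) ∂(𝒲 t) := integral_nonneg fun w => frobSq_nonneg _
  calc ∫ w, frobSq (mixDev w (X - η • gradMat 𝓓 F X)) ∂(𝒲 t)
      ≤ ∫ w, ((1 + p / 4) * frobSq (mixDev w Y)
          + (1 + 1 / (p / 4)) * η ^ 2 * frobSq (mixDev w G)) ∂(𝒲 t) :=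
        integral_mono (hi _) (((hi Y).const_mul _).add ((hi G).const_mul _)) h1
    _ = (1 + p / 4) * ∫ w, frobSq (mixDev w Y) ∂(𝒲 t)
          + (1 + 1 / (p / 4)) * η ^ 2 * ∫ w, frobSq (mixDev w G) ∂(𝒲 t) := by
        rw [integral_add ((hi Y).const_mul _) ((hi G).const_mul _), integral_const_mul,
          integral_const_mul]
    _ ≤ (1 + p / 4) * ((1 - p) * ((1 + p / 6) * frobSq (X - avgMat X)))
          + 5 * η ^ 2 / p * (n * (a + b * (globalObj 𝓓 F (avg X) - m))) := by
        have e1 : (1 + 1 / (p / 4)) * η ^ 2 ≤ 5 * η ^ 2 / p := by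
          have e : 5 * η ^ 2 / p - (1 + 1 / (p / 4)) * η ^ 2 = η ^ 2 * (1 - p) / p := by
            field_simp; ring
          have : 0 ≤ η ^ 2 * (1 - p) / p :=
            div_nonneg (mul_nonneg (sq_nonneg _) (by linarith)) hp.le
          linarith
        refine add_le_add (mul_le_mul_of_nonneg_left h8 (by positivity)) ?_
        exact (mul_le_mul_of_nonneg_right e1 hnon).trans
          (mul_le_mul_of_nonneg_left h9 (by positivity))
    _ ≤ _ := by
        rw [h10]
        -- The two Young losses leave at least half of the contraction.
        have e2 : (1 + p / 4) * ((1 - p) * (1 + p / 6)) ≤ 1 - p / 2 := by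
          nlinarith [sq_nonneg p, mul_pos hp hp]
        have := mul_le_mul_of_nonneg_right e2 (mul_nonneg hn'.le (consensusError_nonneg X))
        nlinarith

/-- Progress of a deterministic averaged gradient step towards a minimizer. -/
theorem norm_avg_gradient_step_sub_sq_le (hn : 0 < n) (hO : IsStochObjective 𝓓 F)
    (hS : LSmooth 𝓓 F L) {μ : ℝ} (hμ0 : 0 ≤ μ) (hμ : MuConvex 𝓓 F μ) {xs : Vec d}
    (hmin : ∀ y, globalObj 𝓓 F xs ≤ globalObj 𝓓 F y) {η : ℝ} (hη : 0 ≤ η) (X : Cols d n) :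
    ‖avg X - xs - η • avg (gradMat 𝓓 F X)‖ ^ 2
      ≤ (1 - η * μ) * ‖avg X - xs‖ ^ 2
        - (2 * η - 4 * η ^ 2 * L) * (globalObj 𝓓 F (avg X) - globalObj 𝓓 F xs)
        + (η * L + 2 * η ^ 2 * L ^ 2) * consensusError X := by
  have hn' : (0 : ℝ) < n := Nat.cast_pos.2 hn
  set x := avg X with hx
  set g := avg (gradMat 𝓓 F X) with hg
  have h1 : globalObj 𝓓 F x - globalObj 𝓓 F xs - L / 2 * consensusError X + μ / 2 * ‖x - xs‖ ^ 2
      ≤ ⟪x - xs, g⟫_ℝ := by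
    -- The gradient sits at `X i`: smoothness passes from `x` to `X i`, and `μ`-convexity from `X i`
    -- to `xs`.
    have h2 : ∀ i, localObj 𝓓 F i x - localObj 𝓓 F i xs - L / 2 * ‖X i - x‖ ^ 2
        + μ / 2 * ‖X i - xs‖ ^ 2 ≤ ⟪x - xs, gradient (localObj 𝓓 F i) (X i)⟫_ℝ := fun i => by
      have h3 := hμ i (X i) xs
      have h4 := (abs_le.1 (abs_localObj_sub_sub_inner_le hO hS i (X i) x)).2
      have e : ⟪x - xs, gradient (localObj 𝓓 F i) (X i)⟫_ℝ
          = ⟪gradient (localObj 𝓓 F i) (X i), x - X i⟫_ℝ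
            + ⟪gradient (localObj 𝓓 F i) (X i), X i - xs⟫_ℝ := by
        rw [← inner_add_right, sub_add_sub_cancel, real_inner_comm]
      rw [e]
      rw [norm_sub_rev x (X i)] at h4
      linarith
    have h5 := Finset.sum_le_sum fun i (_ : i ∈ Finset.univ) => h2 i
    simp only [Finset.sum_add_distrib, Finset.sum_sub_distrib, ← Finset.mul_sum, ← inner_sum] at h5
    have e1 : ∑ i, ‖X i - x‖ ^ 2 = n * consensusError X := by
      rw [consensusError, ← mul_assoc, mul_one_div_cancel hn'.ne', one_mul]
      rfl
    have e2 : (n : ℝ) * ‖x - xs‖ ^ 2 ≤ ∑ i, ‖X i - xs‖ ^ 2 := by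
      have h := frobSq_sub_const hn X xs
      have h' := frobSq_nonneg (X - avgMat X)
      have e : frobSq (X - fun _ => xs) = ∑ i, ‖X i - xs‖ ^ 2 := rfl
      rw [← e]
      linarith
    have e3 : ∑ i, gradient (localObj 𝓓 F i) (X i) = (n : ℝ) • g :=
      sum_eq_smul_avg hn (gradMat 𝓓 F X)
    have e4 : ∀ z, ∑ i, localObj 𝓓 F i z = n * globalObj 𝓓 F z := fun z => by
      rw [globalObj, ← mul_assoc, mul_one_div_cancel hn'.ne', one_mul]
    rw [e1, e3, e4, e4, real_inner_smul_right] at h5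
    have h6 := mul_le_mul_of_nonneg_left e2 (by positivity : 0 ≤ μ / 2)
    refine le_of_mul_le_mul_left ?_ hn'
    linarith
  have h7 : ‖g‖ ^ 2 ≤ 2 * L ^ 2 * consensusError X
      + 4 * L * (globalObj 𝓓 F x - globalObj 𝓓 F xs) := by
    have h8 := norm_gradient_sub_avg_gradMat_sq_le hn hO hS X
    have h9 := norm_gradient_globalObj_sq_le hn hO hS hmin x
    have h10 := norm_add_sq_le_young one_pos (gradient (globalObj 𝓓 F) x)
      (-(gradient (globalObj 𝓓 F) x - g))
    rw [norm_neg] at h10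
    have e : gradient (globalObj 𝓓 F) x + -(gradient (globalObj 𝓓 F) x - g) = g := by abel
    rw [e] at h10
    linarith
  rw [norm_sub_sq_real, real_inner_smul_right, norm_smul, mul_pow, Real.norm_eq_abs, sq_abs]
  have h11 := mul_le_mul_of_nonneg_left h1 (by positivity : 0 ≤ 2 * η)
  have h12 := mul_le_mul_of_nonneg_left h7 (sq_nonneg η)
  linarith

end Deterministic

/-! ### One step of the algorithm -/

section Step

variable {d n : ℕ} {Ξ : Fin n → Type*} [∀ i, MeasurableSpace (Ξ i)]
variable {Ω : Type*}

/-- The update of the algorithm at time `t`. -/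
noncomputable def step (F : ∀ i, Vec d → Ξ i → ℝ) (η : ℝ) (ξ : ℕ → ∀ i, Ω → Ξ i)
    (W : ℕ → Ω → Matrix (Fin n) (Fin n) ℝ) (t : ℕ) (X : Ω → Cols d n) (ω : Ω) : Cols d n :=
  mix (W t ω) (fun i => X ω i - η • stochGrad F i (X ω i) (ξ t i ω))

/-- The noise of the stochastic gradients used at time `t`. -/
noncomputable def stepNoise (𝓓 : ∀ i, Measure (Ξ i)) (F : ∀ i, Vec d → Ξ i → ℝ)
    (ξ : ℕ → ∀ i, Ω → Ξ i) (t : ℕ) (X : Ω → Cols d n) (ω : Ω) : Cols d n :=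
  fun i => noise 𝓓 F i (X ω i) (ξ t i ω)

/-- Before mixing, the step is a drift determined by the current state plus centred noise. -/
theorem step_eq {𝓓 : ∀ i, Measure (Ξ i)} {ξ : ℕ → ∀ i, Ω → Ξ i}
    {W : ℕ → Ω → Matrix (Fin n) (Fin n) ℝ} {F : ∀ i, Vec d → Ξ i → ℝ} {η : ℝ} {t : ℕ}
    {X : Ω → Cols d n} (ω : Ω) : step F η ξ W t X ω
    = mix (W t ω) ((X ω - η • gradMat 𝓓 F (X ω)) + (-η) • stepNoise 𝓓 F ξ t X ω) := by
  unfold step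
  congr 1
  ext1 i
  simp only [stepNoise, noise, gradMat, Pi.add_apply, Pi.sub_apply, Pi.smul_apply, smul_sub,
    neg_smul, Pi.neg_apply]
  abel

variable [mΩ : MeasurableSpace Ω]

/-- The assumptions shared by all convergence results: the problem, the topology, the sampling and
a finite variance at some point. -/
structure Setting (P : Measure Ω) (𝓓 : ∀ i, Measure (Ξ i)) (F : ∀ i, Vec d → Ξ i → ℝ)
    (𝒲 : ℕ → Measure (Matrix (Fin n) (Fin n) ℝ)) (ξ : ℕ → ∀ i, Ω → Ξ i)
    (W : ℕ → Ω → Matrix (Fin n) (Fin n) ℝ) (L p σ : ℝ) (y : Vec d) : Prop where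
  pos : 0 < n
  obj : IsStochObjective 𝓓 F
  smooth : LSmooth 𝓓 F L
  mixing : IsMixingLaw 𝒲
  consensus : ConsensusFactor d 𝒲 p
  sampling : IsSampling P 𝓓 𝒲 ξ W
  variance : VarianceAt 𝓓 F σ y

/-- A square-integrable state that only depends on the randomness before time `t`. -/
structure IsState (P : Measure Ω) (ξ : ℕ → ∀ i, Ω → Ξ i) (W : ℕ → Ω → Matrix (Fin n) (Fin n) ℝ)
    (t : ℕ) (X : Ω → Cols d n) : Prop where
  measurable : Measurable[info ξ W (past n t)] X
  memLp : ∀ i, MemLp (fun ω => X ω i) 2 P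

variable {P : Measure Ω} {𝓓 : ∀ i, Measure (Ξ i)} {𝒲 : ℕ → Measure (Matrix (Fin n) (Fin n) ℝ)}
  {ξ : ℕ → ∀ i, Ω → Ξ i} {W : ℕ → Ω → Matrix (Fin n) (Fin n) ℝ}
  {F : ∀ i, Vec d → Ξ i → ℝ} {L p σ η : ℝ} {y : Vec d} {t : ℕ} {X : Ω → Cols d n}

namespace Setting

theorem isState_iterate (h : Setting P 𝓓 F 𝒲 ξ W L p σ y) (X₀ : Cols d n) (η : ℕ → ℝ) (t : ℕ) :
    IsState P ξ W t (iterate F X₀ η ξ W t) :=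
  ⟨measurable_info_iterate h.obj X₀ η t,
    memLp_iterate h.obj h.smooth h.sampling h.mixing h.variance X₀ η t⟩

theorem measurable_state (h : Setting P 𝓓 F 𝒲 ξ W L p σ y) (hX : IsState P ξ W t X) :
    Measurable X :=
  hX.measurable.mono (h.sampling.info_le _) le_rfl

theorem measurable_state_apply (h : Setting P 𝓓 F 𝒲 ξ W L p σ y) (hX : IsState P ξ W t X)
    (i : Fin n) : Measurable fun ω => X ω i :=
  (measurable_pi_apply i).comp (h.measurable_state hX)

theorem memLp_stepNoise (h : Setting P 𝓓 F 𝒲 ξ W L p σ y) (hX : IsState P ξ W t X) (i : Fin n) :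
    MemLp (fun ω => stepNoise 𝓓 F ξ t X ω i) 2 P :=
  memLp_noise_comp h.obj h.smooth h.sampling h.variance t i (h.measurable_state_apply hX i)
    (hX.memLp i)

theorem memLp_gradMat (h : Setting P 𝓓 F 𝒲 ξ W L p σ y) (hX : IsState P ξ W t X) (i : Fin n) :
    MemLp (fun ω => gradMat 𝓓 F (X ω) i) 2 P :=
  have := h.sampling.prob
  memLp_gradient_localObj_comp h.obj h.smooth i (h.measurable_state_apply hX i) (hX.memLp i)

theorem integrable_consensusError (hX : ∀ i, MemLp (fun ω => X ω i) 2 P) :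
    Integrable (fun ω => consensusError (X ω)) P :=
  (integrable_frobSq (V := fun ω => X ω - avgMat (X ω))
    fun i => (hX i).sub (memLp_avg hX)).const_mul _

theorem integrable_globalObj (h : Setting P 𝓓 F 𝒲 ξ W L p σ y) {x : Ω → Vec d}
    (hx : MemLp x 2 P) : Integrable (fun ω => globalObj 𝓓 F (x ω)) P := by
  have := h.sampling.prob
  have hx1 : Integrable x P := hx.integrable (by norm_num)
  refine (((integrable_const |globalObj 𝓓 F 0|).add
    ((hx1.const_inner (gradient (globalObj 𝓓 F) 0)).abs)).add
    (hx.integrable_norm_sq.const_mul (L / 2))).mono'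
    ((continuous_globalObj h.obj h.smooth).comp_aestronglyMeasurable hx.1)
    (Filter.Eventually.of_forall fun ω => ?_)
  have h1 := abs_globalObj_sub_sub_inner_le h.pos h.obj h.smooth 0 (x ω)
  rw [sub_zero] at h1
  simp only [Pi.add_apply, Real.norm_eq_abs]
  have e : globalObj 𝓓 F (x ω) = globalObj 𝓓 F 0 + ⟪gradient (globalObj 𝓓 F) 0, x ω⟫_ℝ
    + (globalObj 𝓓 F (x ω) - globalObj 𝓓 F 0 - ⟪gradient (globalObj 𝓓 F) 0, x ω⟫_ℝ) := by ring
  rw [e]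
  exact (abs_add_three _ _ _).trans (by gcongr)

theorem memLp_gradient_globalObj (h : Setting P 𝓓 F 𝒲 ξ W L p σ y) {x : Ω → Vec d}
    (hxm : Measurable x) (hx : MemLp x 2 P) :
    MemLp (fun ω => gradient (globalObj 𝓓 F) (x ω)) 2 P := by
  have := h.sampling.prob
  simp_rw [gradient_globalObj h.obj h.smooth]
  exact memLp_avg (V := fun ω i => gradient (localObj 𝓓 F i) (x ω))
    fun i => memLp_gradient_localObj_comp h.obj h.smooth i hxm hx

theorem measurable_gradMat (h : Setting P 𝓓 F 𝒲 ξ W L p σ y) :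
    Measurable (gradMat 𝓓 F : Cols d n → Cols d n) :=
  measurable_pi_lambda _ fun i =>
    (continuous_gradient_localObj h.obj h.smooth i).measurable.comp (measurable_pi_apply i)

theorem integral_inner_avg_stepNoise (h : Setting P 𝓓 F 𝒲 ξ W L p σ y) (hX : IsState P ξ W t X)
    {A : Ω → Vec d} (hA : Measurable[info ξ W (past n t)] A) (hA2 : MemLp A 2 P) :
    ∫ ω, ⟪A ω, avg (stepNoise 𝓓 F ξ t X ω)⟫_ℝ ∂P = 0 := by
  simp only [avg, real_inner_smul_right, inner_sum]
  rw [integral_const_mul, integral_finsetSum _ fun i _ =>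
    hA2.integrable_real_inner (h.memLp_stepNoise hX i)]
  refine mul_eq_zero_of_right _ (Finset.sum_eq_zero fun i _ => ?_)
  exact integral_inner_noise_eq_zero h.obj h.smooth h.sampling h.variance (lt_irrefl t) hA
    ((measurable_pi_apply i).comp hX.measurable) hA2 (hX.memLp i)

theorem sum_integral_norm_stepNoise_sq_le (h : Setting P 𝓓 F 𝒲 ξ W L p σ y)
    (hX : IsState P ξ W t X) {a b m : ℝ} (hN : NoiseBound 𝓓 F L a b m) :
    (1 / (n : ℝ)) * ∑ i, ∫ ω, ‖stepNoise 𝓓 F ξ t X ω i‖ ^ 2 ∂P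
      ≤ a + 3 * L ^ 2 * ∫ ω, consensusError (X ω) ∂P
        + b * ((∫ ω, globalObj 𝓓 F (avg (X ω)) ∂P) - m) := by
  have := h.sampling.prob
  have h1 : ∀ i, Integrable (fun ω => noiseVar 𝓓 F i (X ω i)) P ∧
      ∫ ω, ‖noise 𝓓 F i (X ω i) (ξ t i ω)‖ ^ 2 ∂P = ∫ ω, noiseVar 𝓓 F i (X ω i) ∂P := fun i =>
    integral_norm_noise_comp_sq h.obj h.smooth h.sampling h.variance
    (S := past n t) (t := t) (i := i) (lt_irrefl t) ((measurable_pi_apply i).comp hX.measurable)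
    (hX.memLp i)
  have hc := integrable_consensusError (P := P) hX.memLp
  have hf := h.integrable_globalObj (memLp_avg hX.memLp)
  have e : ∑ i, ∫ ω, ‖stepNoise 𝓓 F ξ t X ω i‖ ^ 2 ∂P = ∫ ω, ∑ i, noiseVar 𝓓 F i (X ω i) ∂P := by
    rw [integral_finsetSum _ fun i _ => (h1 i).1]
    exact Finset.sum_congr rfl fun i _ => (h1 i).2
  have hi1 : Integrable (fun ω => a + 3 * L ^ 2 * consensusError (X ω)) P :=
    (integrable_const a).add (hc.const_mul _)
  have hi2 : Integrable (fun ω => b * (globalObj 𝓓 F (avg (X ω)) - m)) P :=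
    (hf.sub (integrable_const m)).const_mul b
  rw [e, ← integral_const_mul]
  calc ∫ ω, (1 / (n : ℝ)) * ∑ i, noiseVar 𝓓 F i (X ω i) ∂P
      ≤ ∫ ω, (a + 3 * L ^ 2 * consensusError (X ω) + b * (globalObj 𝓓 F (avg (X ω)) - m)) ∂P :=
        integral_mono ((integrable_finsetSum _ fun i _ => (h1 i).1).const_mul _)
          (hi1.add hi2) fun ω => hN (X ω)
    _ = _ := by
        rw [integral_add hi1 hi2, integral_add (integrable_const a) (hc.const_mul _),
          integral_const_mul, integral_const_mul, integral_sub hf (integrable_const m)]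
        simp

/-- Noises of distinct nodes are orthogonal in mean, so only the `n` diagonal terms of the square
survive. This produces the `1/n` in the leading term of the rates. -/
theorem integral_norm_avg_stepNoise_sq_le (h : Setting P 𝓓 F 𝒲 ξ W L p σ y)
    (hX : IsState P ξ W t X) {a b m : ℝ} (hN : NoiseBound 𝓓 F L a b m) :
    ∫ ω, ‖avg (stepNoise 𝓓 F ξ t X ω)‖ ^ 2 ∂P
      ≤ (1 / (n : ℝ)) * (a + 3 * L ^ 2 * ∫ ω, consensusError (X ω) ∂P
        + b * ((∫ ω, globalObj 𝓓 F (avg (X ω)) ∂P) - m)) := by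
  have hm := h.memLp_stepNoise hX
  have h1 : ∀ ω, ‖avg (stepNoise 𝓓 F ξ t X ω)‖ ^ 2
      = (1 / (n : ℝ)) * ((1 / (n : ℝ)) * ∑ i, ∑ j,
        ⟪stepNoise 𝓓 F ξ t X ω j, stepNoise 𝓓 F ξ t X ω i⟫_ℝ) := fun ω => by
    rw [← real_inner_self_eq_norm_sq, avg, real_inner_smul_left, real_inner_smul_right, inner_sum]
    simp only [sum_inner]
  have h2 : ∀ i j, i ≠ j →
      ∫ ω, ⟪stepNoise 𝓓 F ξ t X ω j, stepNoise 𝓓 F ξ t X ω i⟫_ℝ ∂P = 0 := fun i j hij => by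
    -- Node `j`'s sample is counted as known, while node `i`'s remains fresh.
    have hmem : Sum.inl (t, i) ∉ past n t ∪ {Sum.inl (t, j)} := by
      rintro (hm | hm)
      · exact lt_irrefl t hm
      · simp only [Set.mem_singleton_iff, Sum.inl.injEq, Prod.mk.injEq, true_and] at hm
        exact hij hm
    have hXm : ∀ k, Measurable[info ξ W (past n t ∪ {Sum.inl (t, j)})] fun ω => X ω k := fun k =>
      ((measurable_pi_apply k).comp hX.measurable).mono
        (info_mono Set.subset_union_left) le_rfl
    exact integral_inner_noise_eq_zero h.obj h.smooth h.sampling h.variance hmem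
      (measurable_noise_comp h.obj h.smooth (hXm j)
        (measurable_info_sample (Set.mem_union_right _ rfl))) (hXm i) (hm j) (hX.memLp i)
  have hint := fun i j => (hm j).integrable_real_inner (hm i)
  simp_rw [h1]
  rw [integral_const_mul, integral_const_mul]
  refine mul_le_mul_of_nonneg_left (le_trans (le_of_eq ?_)
    (h.sum_integral_norm_stepNoise_sq_le hX hN)) (by positivity)
  rw [integral_finsetSum _ fun i _ => integrable_finsetSum _ fun j _ => hint i j]
  congr 1
  refine Finset.sum_congr rfl fun i _ => ?_
  rw [integral_finsetSum _ fun j _ => hint i j, Finset.sum_eq_single i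
    (fun j _ hj => h2 i j hj.symm) (fun hi => absurd (Finset.mem_univ i) hi)]
  simp_rw [real_inner_self_eq_norm_sq]

theorem avg_step_ae (h : Setting P 𝓓 F 𝒲 ξ W L p σ y) : ∀ᵐ ω ∂P,
    avg (step F η ξ W t X ω)
      = avg (X ω) - η • avg (gradMat 𝓓 F (X ω)) - η • avg (stepNoise 𝓓 F ξ t X ω) := by
  filter_upwards [h.sampling.ae_doublyStochastic h.mixing t] with ω hω
  rw [step_eq (𝓓 := 𝓓), avg_mix hω, avg_add, avg_sub, avg_smul, avg_smul, neg_smul,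
    ← sub_eq_add_neg]

/-- The cross term is expanded entrywise, with the weight `W i j - 1/n` placed on the drift side.
Each summand then pairs a single noise column with a vector independent of that node's fresh sample.
-/
theorem consensusError_step_ae (h : Setting P 𝓓 F 𝒲 ξ W L p σ y) : ∀ᵐ ω ∂P,
    consensusError (step F η ξ W t X ω)
      = (1 / (n : ℝ)) * (frobSq (mixDev (W t ω) (X ω - η • gradMat 𝓓 F (X ω)))
        + η ^ 2 * frobSq (mixDev (W t ω) (stepNoise 𝓓 F ξ t X ω))
        - 2 * η * ∑ j, ∑ i, ⟪(W t ω i j - 1 / (n : ℝ)) •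
            mixDev (W t ω) (X ω - η • gradMat 𝓓 F (X ω)) j, stepNoise 𝓓 F ξ t X ω i⟫_ℝ) := by
  filter_upwards [h.sampling.ae_doublyStochastic h.mixing t] with ω hω
  rw [consensusError, step_eq (𝓓 := 𝓓)]
  set V := X ω - η • gradMat 𝓓 F (X ω)
  set N := stepNoise 𝓓 F ξ t X ω
  have e : mix (W t ω) (V + (-η) • N) - avgMat (mix (W t ω) (V + (-η) • N))
      = mixDev (W t ω) V + (-η) • mixDev (W t ω) N := by
    rw [← mixDev_smul, ← mixDev_add]
    ext1 j
    simp only [mixDev, avgMat, Pi.sub_apply, avg_mix hω]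
  rw [e]
  congr 1
  simp only [frobSq, Finset.mul_sum, ← Finset.sum_add_distrib, ← Finset.sum_sub_distrib,
    Pi.add_apply, Pi.smul_apply]
  refine Finset.sum_congr rfl fun j _ => ?_
  rw [norm_add_sq_real, norm_smul, mul_pow, Real.norm_eq_abs, sq_abs, neg_sq,
    real_inner_smul_right, mixDev_apply _ N, inner_sum, ← Finset.mul_sum]
  simp only [real_inner_smul_left, real_inner_smul_right]
  ring

/-- The consensus recursion. -/
theorem integral_consensusError_step_le (h : Setting P 𝓓 F 𝒲 ξ W L p σ y)
    (hX : IsState P ξ W t X) {a b m a' b' : ℝ} (hN : NoiseBound 𝓓 F L a b m)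
    (hM : MixingBound 𝓓 F 𝒲 a' b' m) (hη : 0 ≤ η) (hηL : η * L ≤ p / 64) :
    ∫ ω, consensusError (step F η ξ W t X ω) ∂P
      ≤ (1 - p / 4) * ∫ ω, consensusError (X ω) ∂P
        + 5 * η ^ 2 / p * (a' + b' * ((∫ ω, globalObj 𝓓 F (avg (X ω)) ∂P) - m))
        + η ^ 2 * (a + b * ((∫ ω, globalObj 𝓓 F (avg (X ω)) ∂P) - m)) := by
  have := h.sampling.prob
  have hp := h.consensus.pos
  have hp1 := h.consensus.le_one
  have hn' : (0 : ℝ) < n := Nat.cast_pos.2 h.pos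
  set V : Ω → Cols d n := fun ω => X ω - η • gradMat 𝓓 F (X ω) with hVdef
  set N : Ω → Cols d n := stepNoise 𝓓 F ξ t X with hNdef
  have hVm : Measurable[info ξ W (past n t)] V :=
    hX.measurable.sub ((h.measurable_gradMat.comp hX.measurable).const_smul η)
  have hV2 : ∀ i, MemLp (fun ω => V ω i) 2 P := fun i =>
    (hX.memLp i).sub ((h.memLp_gradMat hX i).const_smul η)
  have hN2 : ∀ i, MemLp (fun ω => N ω i) 2 P := h.memLp_stepNoise hX
  have hVm' : Measurable V := hVm.mono (h.sampling.info_le _) le_rfl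
  have hNm' : Measurable N := measurable_pi_lambda _ fun i =>
    measurable_noise_comp h.obj h.smooth (h.measurable_state_apply hX i)
      (h.sampling.measurable_sample t i)
  have hc := integrable_consensusError (P := P) hX.memLp
  have hf := h.integrable_globalObj (memLp_avg hX.memLp)
  have hDV := memLp_mixDev h.sampling h.mixing t hVm' hV2
  have hDN := memLp_mixDev h.sampling h.mixing t hNm' hN2
  have hB2 : ∀ i j, MemLp (fun ω => (W t ω i j - 1 / (n : ℝ)) • mixDev (W t ω) (V ω) j) 2 P := by
    intro i j
    refine (hDV j).mono ((((measurable_entry i j).comp (h.sampling.measurable_mixing t)).sub_const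
      (1 / (n : ℝ))).smul (measurable_mixDev_comp hVm'
        (h.sampling.measurable_mixing t) j)).aestronglyMeasurable ?_
    filter_upwards [h.sampling.ae_doublyStochastic h.mixing t] with ω hω
    rw [norm_smul, Real.norm_eq_abs]
    exact mul_le_of_le_one_left (norm_nonneg _) (abs_entry_sub_le h.pos hω i j)
  have hcross : ∀ i j, ∫ ω, ⟪(W t ω i j - 1 / (n : ℝ)) • mixDev (W t ω) (V ω) j, N ω i⟫_ℝ ∂P
      = 0 := by
    intro i j
    -- For the cross terms `W t` counts as known and the samples are fresh.
    have hmem : Sum.inl (t, i) ∉ past n t ∪ {Sum.inr t} := by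
      rintro (hm | hm)
      · exact lt_irrefl t hm
      · simp at hm
    have hle : info ξ W (past n t) ≤ info ξ W (past n t ∪ {Sum.inr t}) :=
      info_mono Set.subset_union_left
    have hWm : Measurable[info ξ W (past n t ∪ {Sum.inr t})] (W t) :=
      measurable_info_mixing (Set.mem_union_right _ rfl)
    exact integral_inner_noise_eq_zero h.obj h.smooth h.sampling h.variance hmem
      ((((measurable_entry i j).comp hWm).sub_const (1 / (n : ℝ))).smul
        (measurable_mixDev_comp (hVm.mono hle le_rfl) hWm j))
      (((measurable_pi_apply i).comp hX.measurable).mono hle le_rfl) (hB2 i j) (hX.memLp i)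
  have hint := fun i j => (hB2 i j).integrable_real_inner (hN2 i)
  have hI1 : Integrable (fun ω => frobSq (mixDev (W t ω) (V ω))) P := integrable_frobSq hDV
  have hI2 : Integrable (fun ω => η ^ 2 * frobSq (mixDev (W t ω) (N ω))) P :=
    (integrable_frobSq hDN).const_mul _
  have hI3 : Integrable (fun ω => 2 * η * ∑ j, ∑ i,
      ⟪(W t ω i j - 1 / (n : ℝ)) • mixDev (W t ω) (V ω) j, N ω i⟫_ℝ) P :=
    (integrable_finsetSum _ fun j _ => integrable_finsetSum _ fun i _ => hint i j).const_mul _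
  have hI12 : Integrable (fun ω => frobSq (mixDev (W t ω) (V ω))
      + η ^ 2 * frobSq (mixDev (W t ω) (N ω))) P := hI1.add hI2
  have hcross' : ∫ ω, 2 * η * ∑ j, ∑ i,
      ⟪(W t ω i j - 1 / (n : ℝ)) • mixDev (W t ω) (V ω) j, N ω i⟫_ℝ ∂P = 0 := by
    rw [integral_const_mul, integral_finsetSum _ fun j _ => integrable_finsetSum _
      fun i _ => hint i j]
    refine mul_eq_zero_of_right _ (Finset.sum_eq_zero fun j _ => ?_)
    rw [integral_finsetSum _ fun i _ => hint i j]
    exact Finset.sum_eq_zero fun i _ => hcross i j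
  have hdet : ∫ ω, frobSq (mixDev (W t ω) (V ω)) ∂P
      ≤ n * ((1 - p / 2) * ∫ ω, consensusError (X ω) ∂P
        + 5 * η ^ 2 / p * (a' + b' * ((∫ ω, globalObj 𝓓 F (avg (X ω)) ∂P) - m))) := by
    have hg1 : Integrable (fun ω => (1 - p / 2) * consensusError (X ω)) P := hc.const_mul _
    have hg2' : Integrable (fun ω => b' * (globalObj 𝓓 F (avg (X ω)) - m)) P :=
      (hf.sub (integrable_const m)).const_mul b'
    have hg2 : Integrable (fun ω =>
        5 * η ^ 2 / p * (a' + b' * (globalObj 𝓓 F (avg (X ω)) - m))) P :=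
      ((integrable_const a').add hg2').const_mul _
    refine (integral_frobSq_mixDev_le h.sampling h.mixing (S := past n t) (t := t) (lt_irrefl t)
      hVm hV2 ((hg1.add hg2).const_mul (n : ℝ)) fun ω =>
      integral_frobSq_mixDev_gradient_step_le h.pos h.obj h.smooth h.mixing h.consensus hM hη hηL t
        (X ω)).trans (le_of_eq ?_)
    rw [integral_const_mul, integral_add' hg1 hg2, integral_const_mul, integral_const_mul,
      integral_add (integrable_const a') hg2', integral_const_mul,
      integral_sub hf (integrable_const m)]
    simp
  have hnoise : ∫ ω, frobSq (mixDev (W t ω) (N ω)) ∂P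
      ≤ n * (a + 3 * L ^ 2 * ∫ ω, consensusError (X ω) ∂P
        + b * ((∫ ω, globalObj 𝓓 F (avg (X ω)) ∂P) - m)) := by
    -- Here the roles are exchanged: the samples of time `t` are known and `W t` is fresh, so the
    -- consensus bound applies to the noise matrix.
    have hmem : Sum.inr t ∉ past n t ∪ {s | ∃ i, s = Sum.inl (t, i)} := by
      rintro (hm | ⟨i, hm⟩)
      · exact lt_irrefl t hm
      · simp at hm
    have hle : info ξ W (past n t) ≤ info ξ W (past n t ∪ {s | ∃ i, s = Sum.inl (t, i)}) :=
      info_mono Set.subset_union_left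
    have hNm : Measurable[info ξ W (past n t ∪ {s | ∃ i, s = Sum.inl (t, i)})] N :=
      measurable_noise_cols h.obj h.smooth (hX.measurable.mono hle le_rfl)
        (fun i => measurable_info_sample (Set.mem_union_right _ ⟨i, rfl⟩))
    refine (integral_frobSq_mixDev_le h.sampling h.mixing hmem hNm hN2 (integrable_frobSq hN2)
      fun ω => ?_).trans ?_
    · refine (h.consensus.contraction t (N ω)).trans ?_
      refine le_trans ?_ (frobSq_sub_avgMat_le_frobSq h.pos (N ω))
      exact mul_le_of_le_one_left (frobSq_nonneg _) (by linarith)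
    · have h1 := h.sum_integral_norm_stepNoise_sq_le hX hN
      rw [one_div_mul_eq_div, div_le_iff₀ hn', mul_comm _ (n : ℝ)] at h1
      refine le_trans (le_of_eq ?_) h1
      exact integral_finsetSum _ fun i _ => (hN2 i).integrable_norm_sq
  rw [integral_congr_ae h.consensusError_step_ae, integral_const_mul,
    integral_sub hI12 hI3, integral_add hI1 hI2, hcross', integral_const_mul, sub_zero,
    one_div_mul_eq_div, div_le_iff₀ hn']
  have hc0 : 0 ≤ ∫ ω, consensusError (X ω) ∂P := integral_nonneg fun ω => consensusError_nonneg _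
  -- The consensus part of the noise variance weakens the contraction from `1 - p/2` to `1 - p/4`.
  have h4 : η ^ 2 * (3 * L ^ 2) ≤ p / 4 := by
    have h5 := mul_nonneg hη h.smooth.nonneg
    have h6 : (η * L) ^ 2 ≤ (p / 64) ^ 2 := by gcongr
    nlinarith
  have h7 := mul_le_mul_of_nonneg_right h4 (mul_nonneg hn'.le hc0)
  have h8 := mul_le_mul_of_nonneg_left hnoise (sq_nonneg η)
  nlinarith

theorem memLp_step (h : Setting P 𝓓 F 𝒲 ξ W L p σ y) (hX : IsState P ξ W t X) (i : Fin n) :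
    MemLp (fun ω => step F η ξ W t X ω i) 2 P :=
  memLp_mix h.sampling h.mixing t
    (measurable_gradient_step h.obj (h.measurable_state hX) (h.sampling.measurable_sample t) η)
    (fun i => (hX.memLp i).sub ((memLp_stochGrad_comp h.obj h.smooth h.sampling h.variance t i
      (h.measurable_state_apply hX i) (hX.memLp i)).const_smul η)) i

/-- The expected decrease of the objective in one step. -/
theorem integral_globalObj_step_le (h : Setting P 𝓓 F 𝒲 ξ W L p σ y)
    (hX : IsState P ξ W t X) {a b m : ℝ} (hN : NoiseBound 𝓓 F L a b m) (hη : 0 ≤ η)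
    (hηL : η * L ≤ 1) :
    ∫ ω, globalObj 𝓓 F (avg (step F η ξ W t X ω)) ∂P
      ≤ ∫ ω, globalObj 𝓓 F (avg (X ω)) ∂P
        - η / 2 * ∫ ω, ‖gradient (globalObj 𝓓 F) (avg (X ω))‖ ^ 2 ∂P
        + η * L ^ 2 / 2 * ∫ ω, consensusError (X ω) ∂P
        + L * η ^ 2 / 2 * ((1 / (n : ℝ)) * (a + 3 * L ^ 2 * ∫ ω, consensusError (X ω) ∂P
        + b * ((∫ ω, globalObj 𝓓 F (avg (X ω)) ∂P) - m))) := by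
  have := h.sampling.prob
  set G : Ω → Vec d := fun ω => gradient (globalObj 𝓓 F) (avg (X ω)) with hG
  set g : Ω → Vec d := fun ω => avg (gradMat 𝓓 F (X ω)) with hg
  set N : Ω → Vec d := fun ω => avg (stepNoise 𝓓 F ξ t X ω) with hNdef
  have havg : MemLp (fun ω => avg (X ω)) 2 P := memLp_avg hX.memLp
  have hG2 : MemLp G 2 P :=
    h.memLp_gradient_globalObj (measurable_avg.comp (h.measurable_state hX)) havg
  have hg2 : MemLp g 2 P := memLp_avg (h.memLp_gradMat hX)
  have hN2 : MemLp N 2 P := memLp_avg (h.memLp_stepNoise hX)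
  have hGm : Measurable[info ξ W (past n t)] G :=
    (continuous_gradient_globalObj h.obj h.smooth).measurable.comp
      (measurable_avg.comp hX.measurable)
  have hgm : Measurable[info ξ W (past n t)] g :=
    measurable_avg.comp (h.measurable_gradMat.comp hX.measurable)
  have hGN := h.integral_inner_avg_stepNoise hX hGm hG2
  have hgN := h.integral_inner_avg_stepNoise hX hgm hg2
  have hpt : ∀ᵐ ω ∂P, globalObj 𝓓 F (avg (step F η ξ W t X ω))
      ≤ globalObj 𝓓 F (avg (X ω)) + (-(η / 2)) * ‖G ω‖ ^ 2 + η * L ^ 2 / 2 * consensusError (X ω)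
        + L * η ^ 2 / 2 * ‖N ω‖ ^ 2 + (-η) * ⟪G ω, N ω⟫_ℝ + L * η ^ 2 * ⟪g ω, N ω⟫_ℝ := by
    filter_upwards [h.avg_step_ae (η := η) (t := t) (X := X)] with ω hω
    have h1 := globalObj_le h.pos h.obj h.smooth (avg (X ω)) (avg (step F η ξ W t X ω))
    have e : avg (step F η ξ W t X ω) - avg (X ω) = (-η) • (g ω + N ω) := by
      rw [hω, smul_add, neg_smul, neg_smul]
      abel
    have e2 : ‖g ω + N ω‖ ^ 2 = ‖g ω‖ ^ 2 + 2 * ⟪g ω, N ω⟫_ℝ + ‖N ω‖ ^ 2 := norm_add_sq_real _ _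
    rw [e, real_inner_smul_right, norm_smul, mul_pow, Real.norm_eq_abs, sq_abs, neg_sq,
      inner_add_right, e2] at h1
    -- Polarization of `⟪G, g⟫` yields `-η/2 ‖G‖²`, the gradient error, and `-η/2 ‖g‖²`; the last
    -- absorbs the second-order term because `η L ≤ 1`.
    have h2 : ‖G ω - g ω‖ ^ 2 ≤ L ^ 2 * consensusError (X ω) :=
      norm_gradient_sub_avg_gradMat_sq_le h.pos h.obj h.smooth (X ω)
    rw [norm_sub_sq_real] at h2
    have h3 := mul_le_mul_of_nonneg_left h2 (by positivity : 0 ≤ η / 2)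
    have h4 := mul_le_mul_of_nonneg_right (mul_le_mul_of_nonneg_right hηL hη) (sq_nonneg ‖g ω‖)
    nlinarith
  have i1 := h.integrable_globalObj havg
  have i2 : Integrable (fun ω => (-(η / 2)) * ‖G ω‖ ^ 2) P := hG2.integrable_norm_sq.const_mul _
  have i3 : Integrable (fun ω => η * L ^ 2 / 2 * consensusError (X ω)) P :=
    (integrable_consensusError hX.memLp).const_mul _
  have i4 : Integrable (fun ω => L * η ^ 2 / 2 * ‖N ω‖ ^ 2) P :=
    hN2.integrable_norm_sq.const_mul _
  have i5 : Integrable (fun ω => (-η) * ⟪G ω, N ω⟫_ℝ) P :=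
    (hG2.integrable_real_inner hN2).const_mul _
  have i6 : Integrable (fun ω => L * η ^ 2 * ⟪g ω, N ω⟫_ℝ) P :=
    (hg2.integrable_real_inner hN2).const_mul _
  have i12 := i1.add i2
  have i123 := i12.add i3
  have i1234 := i123.add i4
  have i12345 := i1234.add i5
  have hle := integral_mono_ae (h.integrable_globalObj (memLp_avg (h.memLp_step hX)))
    (i12345.add i6) hpt
  rw [integral_add' i12345 i6, integral_add' i1234 i5, integral_add' i123 i4, integral_add' i12 i3,
    integral_add' i1 i2] at hle
  simp only [integral_const_mul] at hle
  have hvar := mul_le_mul_of_nonneg_left (h.integral_norm_avg_stepNoise_sq_le hX hN)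
    (by have := h.smooth.nonneg; positivity : 0 ≤ L * η ^ 2 / 2)
  rw [hGN, hgN] at hle
  linarith

/-- The expected decrease of the squared distance to a minimizer in one step. -/
theorem integral_norm_avg_step_sub_sq_le (h : Setting P 𝓓 F 𝒲 ξ W L p σ y)
    (hX : IsState P ξ W t X) {μ : ℝ} (hμ0 : 0 ≤ μ) (hμ : MuConvex 𝓓 F μ) {xs : Vec d}
    (hmin : ∀ y, globalObj 𝓓 F xs ≤ globalObj 𝓓 F y) {a b m : ℝ}
    (hN : NoiseBound 𝓓 F L a b m) (hη : 0 ≤ η) :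
    ∫ ω, ‖avg (step F η ξ W t X ω) - xs‖ ^ 2 ∂P
      ≤ (1 - η * μ) * ∫ ω, ‖avg (X ω) - xs‖ ^ 2 ∂P
        - (2 * η - 4 * η ^ 2 * L) * ((∫ ω, globalObj 𝓓 F (avg (X ω)) ∂P) - globalObj 𝓓 F xs)
        + (η * L + 2 * η ^ 2 * L ^ 2) * ∫ ω, consensusError (X ω) ∂P
        + η ^ 2 * ((1 / (n : ℝ)) * (a + 3 * L ^ 2 * ∫ ω, consensusError (X ω) ∂P
        + b * ((∫ ω, globalObj 𝓓 F (avg (X ω)) ∂P) - m))) := by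
  have := h.sampling.prob
  set A : Ω → Vec d := fun ω => avg (X ω) - xs - η • avg (gradMat 𝓓 F (X ω)) with hA
  set N : Ω → Vec d := fun ω => avg (stepNoise 𝓓 F ξ t X ω) with hNdef
  have havg : MemLp (fun ω => avg (X ω)) 2 P := memLp_avg hX.memLp
  have hd2 : MemLp (fun ω => avg (X ω) - xs) 2 P := havg.sub (memLp_const xs)
  have hA2 : MemLp A 2 P := hd2.sub ((memLp_avg (h.memLp_gradMat hX)).const_smul η)
  have hN2 : MemLp N 2 P := memLp_avg (h.memLp_stepNoise hX)
  have hAm : Measurable[info ξ W (past n t)] A :=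
    ((measurable_avg.comp hX.measurable).sub_const xs).sub
      ((measurable_avg.comp (h.measurable_gradMat.comp hX.measurable)).const_smul η)
  have hAN := h.integral_inner_avg_stepNoise hX hAm hA2
  have hpt : ∀ᵐ ω ∂P, ‖avg (step F η ξ W t X ω) - xs‖ ^ 2
      ≤ (1 - η * μ) * ‖avg (X ω) - xs‖ ^ 2
        + (-(2 * η - 4 * η ^ 2 * L)) * (globalObj 𝓓 F (avg (X ω)) - globalObj 𝓓 F xs)
        + (η * L + 2 * η ^ 2 * L ^ 2) * consensusError (X ω)
        + η ^ 2 * ‖N ω‖ ^ 2 + (-2 * η) * ⟪A ω, N ω⟫_ℝ := by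
    filter_upwards [h.avg_step_ae (η := η) (t := t) (X := X)] with ω hω
    have e : avg (step F η ξ W t X ω) - xs = A ω - η • N ω := by
      rw [hω, sub_right_comm _ _ xs, sub_right_comm _ _ xs]
    have h1 : ‖A ω‖ ^ 2 ≤ _ :=
      norm_avg_gradient_step_sub_sq_le h.pos h.obj h.smooth hμ0 hμ hmin hη (X ω)
    rw [e, norm_sub_sq_real, norm_smul, mul_pow, Real.norm_eq_abs, sq_abs, real_inner_smul_right]
    linarith
  have i1 : Integrable (fun ω => (1 - η * μ) * ‖avg (X ω) - xs‖ ^ 2) P :=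
    hd2.integrable_norm_sq.const_mul _
  have i2 : Integrable (fun ω => (-(2 * η - 4 * η ^ 2 * L))
      * (globalObj 𝓓 F (avg (X ω)) - globalObj 𝓓 F xs)) P :=
    ((h.integrable_globalObj havg).sub (integrable_const _)).const_mul _
  have i3 : Integrable (fun ω => (η * L + 2 * η ^ 2 * L ^ 2) * consensusError (X ω)) P :=
    (integrable_consensusError hX.memLp).const_mul _
  have i4 : Integrable (fun ω => η ^ 2 * ‖N ω‖ ^ 2) P := hN2.integrable_norm_sq.const_mul _
  have i5 : Integrable (fun ω => (-2 * η) * ⟪A ω, N ω⟫_ℝ) P :=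
    (hA2.integrable_real_inner hN2).const_mul _
  have i12 := i1.add i2
  have i123 := i12.add i3
  have i1234 := i123.add i4
  have hs2 : MemLp (fun ω => avg (step F η ξ W t X ω) - xs) 2 P :=
    (memLp_avg (h.memLp_step hX)).sub (memLp_const xs)
  have hle := integral_mono_ae hs2.integrable_norm_sq (i1234.add i5) hpt
  rw [integral_add' i1234 i5, integral_add' i123 i4, integral_add' i12 i3,
    integral_add' i1 i2] at hle
  simp only [integral_const_mul] at hle
  rw [integral_sub (h.integrable_globalObj havg) (integrable_const _), hAN] at hle
  simp only [integral_const, probReal_univ, one_smul] at hle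
  have hvar := mul_le_mul_of_nonneg_left (h.integral_norm_avg_stepNoise_sq_le hX hN) (sq_nonneg η)
  linarith

end Setting

end Step

/-! ### Real recursions and the choice of the stepsize -/

section Recursions

/-- The bound is the fixed point of `c ↦ (1 - p/4) c + K`, and the start lies below it. -/
theorem le_of_contracting_recursion {c : ℕ → ℝ} {p K : ℝ} (hp : 0 < p) (hp1 : p ≤ 1) (hK : 0 ≤ K)
    (h0 : c 0 = 0) (h : ∀ t, c (t + 1) ≤ (1 - p / 4) * c t + K) (t : ℕ) : c t ≤ 4 * K / p := by
  induction t with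
  | zero => rw [h0]; positivity
  | succ t ih =>
    refine (h t).trans ?_
    have h1 : (1 - p / 4) * c t ≤ (1 - p / 4) * (4 * K / p) :=
      mul_le_mul_of_nonneg_left ih (by linarith)
    have h2 : (1 - p / 4) * (4 * K / p) + K = 4 * K / p := by field_simp; ring
    linarith

theorem sum_le_of_descent {Φ g : ℕ → ℝ} {c E : ℝ} (h : ∀ t, Φ (t + 1) ≤ Φ t - c * g t + E)
    (T : ℕ) : c * ∑ t ∈ Finset.range T, g t ≤ Φ 0 - Φ T + T * E := by
  induction T with
  | zero => simp
  | succ T ih =>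
    rw [Finset.sum_range_succ, mul_add]
    push_cast
    linarith [h T]

/-- After telescoping, `hE` and `hT` each account for `ε/2`. -/
theorem average_le_of_descent {Φ g : ℕ → ℝ} {η E m ε : ℝ} (hη : 0 < η)
    (h : ∀ t, Φ (t + 1) ≤ Φ t - η / 2 * g t + E) (hm : ∀ t, m ≤ Φ t) (hE : 4 * E ≤ η * ε) {T : ℕ}
    (hT : 4 * (Φ 0 - m) ≤ η * ε * (T + 1)) :
    (1 / ((T : ℝ) + 1)) * ∑ t ∈ Finset.range (T + 1), g t ≤ ε := by
  have h1 := sum_le_of_descent h (T + 1)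
  have hT' : (0 : ℝ) < (T : ℝ) + 1 := by positivity
  push_cast at h1
  rw [one_div_mul_eq_div, div_le_iff₀ hT']
  have h2 := mul_le_mul_of_nonneg_right hE hT'.le
  have h3 := hm (T + 1)
  refine le_of_mul_le_mul_left (a := η / 2) ?_ (by positivity)
  linarith

/-- A stepsize which is admissible for `Q` and large enough for every large horizon. -/
theorem exists_stepsize {Q R ε : ℝ} (hQ : 0 ≤ Q) (hR : 0 ≤ R) (hε : 0 < ε) :
    ∃ η : ℝ, 0 < η ∧ η * Q ≤ 1 ∧ ∀ T : ℕ, 4 * Q * R / ε ≤ T → 4 * R ≤ η * ε * (T + 1) := by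
  -- `Q` may vanish, so `1/Q` is not available. This amount added to the denominator keeps it
  -- positive, and its cost of at most `ε` is covered by the `+ 1` in `T + 1`.
  have hδ : 0 < ε / (4 * R + 1) := by positivity
  have hpos : 0 < Q + ε / (4 * R + 1) := by linarith
  refine ⟨1 / (Q + ε / (4 * R + 1)), by positivity, ?_, fun T hT => ?_⟩
  · rw [one_div_mul_eq_div, div_le_one hpos]
    linarith
  · rw [mul_assoc, one_div_mul_eq_div, le_div_iff₀ hpos]
    rw [div_le_iff₀ hε] at hT
    have h1 : 4 * R * (ε / (4 * R + 1)) ≤ ε := by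
      rw [mul_div_assoc', div_le_iff₀ (by positivity)]
      nlinarith
    nlinarith

theorem rpow_three_halves {ε : ℝ} (hε : 0 < ε) : ε ^ (3 / 2 : ℝ) = ε * √ε := by
  rw [Real.sqrt_eq_rpow, ← Real.rpow_one_add' hε.le (by norm_num)]
  norm_num

theorem sq_mul_le_of_mul_le {η q K : ℝ} (hη : 0 ≤ η) (hq : 0 ≤ q) (h : η * (64 * q) ≤ 1)
    (hK : 0 ≤ K) : K * (η * q) ^ 2 ≤ K / 4096 := by
  have h1 : η * q ≤ 1 / 64 := by linarith
  have h2 : (η * q) ^ 2 ≤ (1 / 64) ^ 2 := by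
    have := mul_nonneg hη hq
    gcongr
  have := mul_le_mul_of_nonneg_left h2 hK
  linarith

/-- The consequences of an admissible stepsize, for a noise level `v`, a heterogeneity level `z`
and a scaled variance level `s`. -/
theorem stepsize_bounds {η ν z s l p ε : ℝ} (hη : 0 ≤ η) (hν : 0 ≤ ν) (hz : 0 ≤ z) (hs : 0 ≤ s)
    (hl : 0 ≤ l) (hp : 0 < p) (hε : 0 < ε)
    (h : η * (64 * (ν / ε + (z + s * √p) / (p * √ε) + l / p)) ≤ 1) :
    η * l ≤ p / 64 ∧ η * ν ≤ ε / 64 ∧ η ^ 2 * z ^ 2 / p ^ 2 ≤ ε / 4096 ∧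
      η ^ 2 * s ^ 2 / p ≤ ε / 4096 := by
  have hse : 0 < √ε := Real.sqrt_pos.2 hε
  have hsp : 0 < √p := Real.sqrt_pos.2 hp
  have e1 : √ε ^ 2 = ε := Real.sq_sqrt hε.le
  have e2 : √p ^ 2 = p := Real.sq_sqrt hp.le
  have n1 : 0 ≤ η * (ν / ε) := by positivity
  have n2 : 0 ≤ η * (z / (p * √ε)) := by positivity
  have n3 : 0 ≤ η * (s * √p / (p * √ε)) := by positivity
  have n4 : 0 ≤ η * (l / p) := by positivity
  rw [add_div] at h
  have k1 : η * (64 * (ν / ε)) ≤ 1 := by linarith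
  have k2 : η * (64 * (z / (p * √ε))) ≤ 1 := by linarith
  have k3 : η * (64 * (s * √p / (p * √ε))) ≤ 1 := by linarith
  have k4 : η * (64 * (l / p)) ≤ 1 := by linarith
  refine ⟨?_, ?_, ?_, ?_⟩
  · have : η * l = η * (l / p) * p := by field_simp
    rw [this]
    nlinarith
  · have : η * ν = η * (ν / ε) * ε := by field_simp
    rw [this]
    nlinarith
  · have := sq_mul_le_of_mul_le hη (by positivity) k2 hε.le
    have e : ε * (η * (z / (p * √ε))) ^ 2 = η ^ 2 * z ^ 2 / p ^ 2 := by
      rw [mul_pow, div_pow, mul_pow p, e1]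
      field_simp
    rwa [e] at this
  · have := sq_mul_le_of_mul_le hη (by positivity) k3 hε.le
    have e : ε * (η * (s * √p / (p * √ε))) ^ 2 = η ^ 2 * s ^ 2 / p := by
      rw [mul_pow, div_pow, mul_pow p, e1, mul_pow s, e2]
      field_simp
    rwa [e] at this

/-- The combined Lyapunov recursion for the distance and the consensus error. -/
theorem lyapunov_step {R R' c c' D η L p μ s ζ : ℝ} {N : ℝ} (hN : 1 ≤ N) (hp : 0 < p) (hp1 : p ≤ 1)
    (hη : 0 ≤ η) (hL : 0 ≤ L) (hηL : η * L ≤ p / 64) (hημ : η * μ ≤ p / 8) (hD : 0 ≤ D)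
    (hc : 0 ≤ c)
    (h1 : c' ≤ (1 - p / 4) * c + 5 * η ^ 2 / p * (2 * ζ ^ 2 + 4 * L * D)
      + η ^ 2 * (3 * s ^ 2 + 6 * L * D))
    (h2 : R' ≤ (1 - η * μ) * R - (2 * η - 4 * η ^ 2 * L) * D + (η * L + 2 * η ^ 2 * L ^ 2) * c
      + η ^ 2 * ((1 / N) * (3 * s ^ 2 + 3 * L ^ 2 * c + 6 * L * D))) :
    R' + 16 * (η * L / p) * c' ≤ (1 - η * μ) * (R + 16 * (η * L / p) * c) - η / 2 * D
      + (3 * η ^ 2 * s ^ 2 / N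
        + 16 * (η * L / p) * (10 * η ^ 2 * ζ ^ 2 / p + 3 * η ^ 2 * s ^ 2)) := by
  -- The weight `16 r` turns the contraction `p/4` into a gain of `4 r p = 4ηL` per unit of
  -- consensus error, one quarter of which cancels the main term `ηL c` of `h2`.
  set r := η * L / p with hr
  have hx : η * L = r * p := by rw [hr]; field_simp
  have hr0 : 0 ≤ r := by positivity
  have hr1 : r ≤ 1 / 64 := by rw [hr, div_le_iff₀ hp]; linarith
  have h3 := mul_le_mul_of_nonneg_left h1 (by positivity : 0 ≤ 16 * r)
  have e1 : 16 * r * ((1 - p / 4) * c + 5 * η ^ 2 / p * (2 * ζ ^ 2 + 4 * L * D)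
      + η ^ 2 * (3 * s ^ 2 + 6 * L * D))
      = 16 * r * c - 4 * (r * p) * c
        + 16 * r * (10 * η ^ 2 * ζ ^ 2 / p + 3 * η ^ 2 * s ^ 2)
        + 16 * r * (20 * r + 6 * (r * p)) * (η * D) := by
    have e : η ^ 2 * L = η * (r * p) := by rw [← hx]; ring
    have e' : 5 * η ^ 2 / p * (4 * L * D) = 20 * r * (η * D) := by
      rw [hr]; field_simp; ring
    calc _ = 16 * r * c - 4 * (r * p) * c + 16 * r * (10 * η ^ 2 * ζ ^ 2 / p + 3 * η ^ 2 * s ^ 2)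
          + 16 * r * (5 * η ^ 2 / p * (4 * L * D)) + 16 * r * 6 * (η ^ 2 * L) * D := by ring
      _ = _ := by rw [e', e]; ring
  rw [e1] at h3
  have hN1 : 1 / N ≤ 1 := by rw [div_le_one (by linarith)]; exact hN
  have hN0 : 0 ≤ 1 / N := by positivity
  have e2 : η ^ 2 * ((1 / N) * (3 * s ^ 2 + 3 * L ^ 2 * c + 6 * L * D))
      ≤ 3 * η ^ 2 * s ^ 2 / N + 3 * (r * p) ^ 2 * c + 6 * (r * p) * (η * D) := by
    have e : η ^ 2 * ((1 / N) * (3 * s ^ 2 + 3 * L ^ 2 * c + 6 * L * D))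
        = 3 * η ^ 2 * s ^ 2 / N + (1 / N) * (3 * (r * p) ^ 2 * c + 6 * (r * p) * (η * D)) := by
      rw [← hx]; ring
    rw [e]
    have : 0 ≤ 3 * (r * p) ^ 2 * c + 6 * (r * p) * (η * D) := by positivity
    have := mul_le_of_le_one_left this hN1
    linarith
  have e3 : (2 * η - 4 * η ^ 2 * L) * D = 2 * (η * D) - 4 * (r * p) * (η * D) := by
    rw [← hx]; ring
  have e4 : (η * L + 2 * η ^ 2 * L ^ 2) * c = r * p * c + 2 * (r * p) ^ 2 * c := by
    rw [← hx]; ring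
  rw [e3, e4] at h2
  have hrp : r * p ≤ 1 / 64 := (mul_le_of_le_one_right hr0 hp1).trans hr1
  have hrp0 : 0 ≤ r * p := by positivity
  have hηD : 0 ≤ η * D := by positivity
  -- All positive multiples of the gap together use at most `3/2` of the available `2ηD`, leaving
  -- `η/2 * D`.
  have kD : (10 * (r * p) + 16 * r * (20 * r + 6 * (r * p))) * (η * D) ≤ 3 / 2 * (η * D) := by
    refine mul_le_mul_of_nonneg_right ?_ hηD
    have k1 := mul_le_mul hr1 hr1 hr0 (by norm_num : (0 : ℝ) ≤ 1 / 64)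
    have k2 := mul_le_mul hr1 hrp hrp0 (by norm_num : (0 : ℝ) ≤ 1 / 64)
    linarith
  -- The remaining gain `3 r p` pays for the second-order terms and for letting `c` contract at the
  -- rate `1 - ημ` of the distance.
  have kc : (5 * (r * p) ^ 2 + 16 * r * (η * μ)) * c ≤ 3 * (r * p) * c := by
    refine mul_le_mul_of_nonneg_right ?_ hc
    have k1 := mul_le_mul_of_nonneg_left hημ hr0
    have k2 := mul_le_mul_of_nonneg_right hrp hrp0
    linarith
  linarith

/-- Weighted averages under a linear contraction. -/
theorem weighted_sum_le_of_contraction {Φ D : ℕ → ℝ} {q c B : ℝ} (hq : 0 < q)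
    (h : ∀ t, Φ (t + 1) ≤ q * Φ t - c * D t + B) (T : ℕ) :
    (q ^ T)⁻¹ * Φ T + c * ∑ t ∈ Finset.range T, (q ^ (t + 1))⁻¹ * D t
      ≤ Φ 0 + B * ∑ t ∈ Finset.range T, (q ^ (t + 1))⁻¹ := by
  induction T with
  | zero => simp
  | succ T ih =>
    rw [Finset.sum_range_succ, Finset.sum_range_succ]
    have h1 := mul_le_mul_of_nonneg_left (h T) (by positivity : 0 ≤ (q ^ (T + 1))⁻¹)
    have h2 : (q ^ (T + 1))⁻¹ * (q * Φ T) = (q ^ T)⁻¹ * Φ T := by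
      rw [pow_succ]; field_simp
    nlinarith

theorem one_sub_mul_sum_inv_pow {q : ℝ} (hq : 0 < q) (T : ℕ) :
    (1 - q) * ∑ t ∈ Finset.range T, (q ^ (t + 1))⁻¹ = (q ^ T)⁻¹ - 1 := by
  induction T with
  | zero => simp
  | succ T ih =>
    rw [Finset.sum_range_succ, mul_add, ih, pow_succ]
    field_simp
    ring

/-- Weights `q^{-(t+1)}` make the contraction telescope, and their sum `S` satisfies `q^{-(T+1)} = 1
+ ημS`. The final distance therefore carries a factor of at least `ημS`, and the initial one is
divided by the exponentially large `S`. -/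
theorem weighted_average_le {Φ D R : ℕ → ℝ} {η μ B ε : ℝ} (hη : 0 < η) (hμ : 0 < μ)
    (hq : η * μ < 1) (hε : 0 < ε)
    (h : ∀ t, Φ (t + 1) ≤ (1 - η * μ) * Φ t - η / 2 * D t + B) (hR : ∀ t, R t ≤ Φ t)
    (hR0 : ∀ t, 0 ≤ R t) (hB : 4 * B ≤ η * ε) {T : ℕ}
    (hT : 3 * Real.log (2 + μ * Φ 0 / ε) ≤ η * μ * T) :
    ∑ t ∈ Finset.range (T + 1), ((1 - η * μ) ^ (t + 1))⁻¹ /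
        (∑ s ∈ Finset.range (T + 1), ((1 - η * μ) ^ (s + 1))⁻¹) * D t + μ * R (T + 1) ≤ ε := by
  have hq0 : 0 < 1 - η * μ := by linarith
  have hημ : 0 < η * μ := by positivity
  set q := 1 - η * μ with hqdef
  set S := ∑ s ∈ Finset.range (T + 1), (q ^ (s + 1))⁻¹ with hS
  have hSpos : 0 < S := Finset.sum_pos (fun t _ => by positivity) (by simp)
  have h1 := weighted_sum_le_of_contraction hq0 h (T + 1)
  have h2 : (q ^ (T + 1))⁻¹ = 1 + η * μ * S := by
    have := one_sub_mul_sum_inv_pow hq0 (T + 1)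
    rw [← hS] at this
    have e : 1 - q = η * μ := by rw [hqdef]; ring
    rw [e] at this
    linarith
  set x := μ * Φ 0 / ε with hx
  have hx0 : 0 ≤ x := by
    have := (hR0 0).trans (hR 0)
    positivity
  have h3 : 1 + 4 * x ≤ (q ^ (T + 1))⁻¹ := by
    have e1 : q ≤ Real.exp (-(η * μ)) := by
      have := Real.add_one_le_exp (-(η * μ))
      linarith
    have e2 : q ^ (T + 1) ≤ Real.exp (-(η * μ * (T + 1))) := by
      calc q ^ (T + 1) ≤ Real.exp (-(η * μ)) ^ (T + 1) := by gcongr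
        _ = Real.exp (-(η * μ * (T + 1))) := by
          rw [← Real.exp_nat_mul]
          push_cast
          ring_nf
    have e3 : Real.exp (η * μ * (T + 1)) ≤ (q ^ (T + 1))⁻¹ := by
      rw [le_inv_comm₀ (Real.exp_pos _) (by positivity), ← Real.exp_neg]
      exact e2
    have e4 : (2 + x) ^ 3 ≤ Real.exp (η * μ * (T + 1)) := by
      rw [← Real.exp_log (by positivity : 0 < (2 + x) ^ 3), Real.exp_le_exp, Real.log_pow]
      push_cast
      linarith
    -- The factor 3 before the logarithm is this exponent; the outcome is `4 Φ 0 ≤ ε η S`, so the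
    -- initial term costs `ε/2`.
    have e5 : 1 + 4 * x ≤ (2 + x) ^ 3 := by nlinarith [sq_nonneg x, pow_nonneg hx0 3]
    linarith
  have h4 : 4 * Φ 0 ≤ ε * η * S := by
    rw [h2] at h3
    have e : ε * (4 * x) = 4 * (μ * Φ 0) := by rw [hx]; field_simp
    have := mul_le_mul_of_nonneg_left h3 hε.le
    refine le_of_mul_le_mul_left ?_ hμ
    linarith
  rw [h2, ← hS] at h1
  have h5 : ∑ t ∈ Finset.range (T + 1), (q ^ (t + 1))⁻¹ / S * D t
      = (∑ t ∈ Finset.range (T + 1), (q ^ (t + 1))⁻¹ * D t) / S := by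
    rw [Finset.sum_div]
    exact Finset.sum_congr rfl fun t _ => by ring
  rw [h5, div_add' _ _ _ hSpos.ne', div_le_iff₀ hSpos]
  have h6 := hR (T + 1)
  have h7 := mul_le_mul_of_nonneg_left h6 (mul_nonneg hημ.le hSpos.le)
  have h8 := mul_le_mul_of_nonneg_right hB hSpos.le
  have h9 := mul_nonneg (mul_nonneg hημ.le hSpos.le) (hR0 (T + 1))
  have h10 := hR0 (T + 1)
  refine le_of_mul_le_mul_left (a := η / 2) ?_ (by positivity)
  linarith

end Recursions

/-! ### Convergence -/

section Convergence

variable {d n : ℕ} {Ξ : Fin n → Type*} [∀ i, MeasurableSpace (Ξ i)]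
variable {Ω : Type*} [mΩ : MeasurableSpace Ω]
variable {P : Measure Ω} {𝓓 : ∀ i, Measure (Ξ i)} {𝒲 : ℕ → Measure (Matrix (Fin n) (Fin n) ℝ)}
  {ξ : ℕ → ∀ i, Ω → Ξ i} {W : ℕ → Ω → Matrix (Fin n) (Fin n) ℝ}
  {F : ∀ i, Vec d → Ξ i → ℝ} {L p σ : ℝ} {y : Vec d}

theorem consensusError_const (hn : 0 < n) (x : Vec d) :
    consensusError (fun _ : Fin n => x) = 0 := by
  rw [consensusError, avgMat_const hn]
  simp [frobSq]

namespace Setting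

theorem measurable_avgIterate (h : Setting P 𝓓 F 𝒲 ξ W L p σ y) (x₀ : Vec d) (η : ℝ) (t : ℕ) :
    Measurable (avgIterate F x₀ η ξ W t) :=
  measurable_avg.comp (h.measurable_state (h.isState_iterate (fun _ => x₀) (fun _ => η) t))

theorem memLp_avgIterate (h : Setting P 𝓓 F 𝒲 ξ W L p σ y) (x₀ : Vec d) (η : ℝ) (t : ℕ) :
    MemLp (avgIterate F x₀ η ξ W t) 2 P :=
  memLp_avg (h.isState_iterate (fun _ => x₀) (fun _ => η) t).memLp

theorem average_gradient_le (h : Setting P 𝓓 F 𝒲 ξ W L p σ y) {s ζ m : ℝ} (hs : 0 ≤ s)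
    (hζ : 0 ≤ ζ) (hN : NoiseBound 𝓓 F L (3 * s ^ 2) 0 m) (hM : MixingBound 𝓓 F 𝒲 (ζ ^ 2) 0 m)
    (hm : ∀ x, m ≤ globalObj 𝓓 F x) {ε η : ℝ} (hε : 0 < ε) (hη : 0 < η)
    (hQ : η * (64 * (L * s ^ 2 / n / ε + (L * ζ + L * s * √p) / (p * √ε) + L / p)) ≤ 1)
    (x₀ : Vec d) {T : ℕ} (hT : 4 * (globalObj 𝓓 F x₀ - m) ≤ η * ε * (T + 1)) :
    (1 / ((T : ℝ) + 1)) * ∑ t ∈ Finset.range (T + 1),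
      ∫ ω, ‖gradient (globalObj 𝓓 F) (avgIterate F x₀ η ξ W t ω)‖ ^ 2 ∂P ≤ ε := by
  have := h.sampling.prob
  have hp := h.consensus.pos
  have hp1 := h.consensus.le_one
  have hL := h.smooth.nonneg
  have hn : (1 : ℝ) ≤ n := Nat.one_le_cast.2 h.pos
  obtain ⟨b1, b2, b3, b4⟩ := stepsize_bounds hη.le (by positivity) (by positivity) (by positivity)
    hL hp hε hQ
  set X := fun t => iterate F (fun _ => x₀) (fun _ => η) ξ W t with hX
  have hst : ∀ t, IsState P ξ W t (X t) := h.isState_iterate (fun _ => x₀) (fun _ => η)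
  set c : ℕ → ℝ := fun t => ∫ ω, consensusError (X t ω) ∂P with hc
  set K := 5 * η ^ 2 / p * ζ ^ 2 + η ^ 2 * (3 * s ^ 2) with hK
  have hc0 : c 0 = 0 := by
    -- The common starting point enters here: no initial consensus error has to be forgotten.
    have : ∀ ω, consensusError (X 0 ω) = 0 := fun ω => consensusError_const h.pos x₀
    simp [hc, this]
  have hcK : ∀ t, c t ≤ 4 * K / p := le_of_contracting_recursion hp hp1 (by positivity) hc0
    fun t => by
      have := h.integral_consensusError_step_le (hst t) hN hM hη.le b1
      simp only [zero_mul, add_zero] at this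
      refine le_trans this (le_of_eq ?_)
      rw [hK, add_assoc]
  have hcnn : ∀ t, 0 ≤ c t := fun t => integral_nonneg fun ω => consensusError_nonneg _
  -- The first coefficient is twice that of the descent inequality, so that it also covers the
  -- consensus part of the averaged noise.
  set E := η * L ^ 2 * (4 * K / p) + 3 * L * η ^ 2 * s ^ 2 / (2 * n) with hE
  set Φ : ℕ → ℝ := fun t => ∫ ω, globalObj 𝓓 F (avgIterate F x₀ η ξ W t ω) ∂P with hΦ
  have hηL1 : η * L ≤ 1 / 64 := b1.trans (by linarith)
  have hdesc : ∀ t, Φ (t + 1) ≤ Φ t - η / 2 *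
      (∫ ω, ‖gradient (globalObj 𝓓 F) (avgIterate F x₀ η ξ W t ω)‖ ^ 2 ∂P) + E := fun t => by
    have h1 := h.integral_globalObj_step_le (hst t) hN hη.le (hηL1.trans (by norm_num))
    simp only [zero_mul, add_zero] at h1
    refine le_trans h1 ?_
    change _ - _ + η * L ^ 2 / 2 * c t + L * η ^ 2 / 2 * ((1 / (n : ℝ))
      * (3 * s ^ 2 + 3 * L ^ 2 * c t)) ≤ _
    have hN1 : 1 / (n : ℝ) ≤ 1 := by rw [div_le_one (by linarith)]; exact hn
    have e1 : L * η ^ 2 / 2 * ((1 / (n : ℝ)) * (3 * s ^ 2 + 3 * L ^ 2 * c t))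
        = 3 * L * η ^ 2 * s ^ 2 / (2 * n)
          + (1 / (n : ℝ)) * (3 / 2 * (η * L) * (η * L ^ 2 * c t)) := by
      field_simp
    have e2 : 0 ≤ η * L ^ 2 * c t := by have := hcnn t; positivity
    have e3 : (1 / (n : ℝ)) * (3 / 2 * (η * L) * (η * L ^ 2 * c t))
        ≤ 3 / 2 * (η * L) * (η * L ^ 2 * c t) := mul_le_of_le_one_left (by positivity) hN1
    have e4 := mul_le_mul_of_nonneg_right hηL1 e2
    have e5 := mul_le_mul_of_nonneg_left (hcK t) (by positivity : 0 ≤ η * L ^ 2)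
    have e6 : ∀ ω, avg (X t ω) = avgIterate F x₀ η ξ W t ω := fun ω => rfl
    rw [e1]
    simp only [e6, hE, hΦ]
    linarith
  have hΦm : ∀ t, m ≤ Φ t := fun t => by
    have := integral_mono (μ := P) (integrable_const m)
      (h.integrable_globalObj (h.memLp_avgIterate x₀ η t)) fun ω => hm _
    simpa using this
  have hΦ0 : Φ 0 = globalObj 𝓓 F x₀ := by
    have : ∀ ω, avgIterate F x₀ η ξ W 0 ω = x₀ := fun ω => avg_const h.pos x₀
    simp [hΦ, this]
  refine average_le_of_descent hη hdesc hΦm ?_ (by rwa [hΦ0])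
  -- By the stepsize bounds the bracket is at most `(80 + 48)/4096 + 6/64 < 1` times `ε`.
  have e1 : 4 * E = η * (80 * (η ^ 2 * (L * ζ) ^ 2 / p ^ 2) + 48 * (η ^ 2 * (L * s) ^ 2 / p)
      + 6 * (η * (L * s ^ 2 / n))) := by
    rw [hE, hK]
    field_simp
    ring
  rw [e1]
  refine mul_le_mul_of_nonneg_left ?_ hη.le
  linarith

/-- The Lyapunov function of the convex analysis. -/
noncomputable def lyapunov (P : Measure Ω) (F : ∀ i, Vec d → Ξ i → ℝ) (ξ : ℕ → ∀ i, Ω → Ξ i)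
    (W : ℕ → Ω → Matrix (Fin n) (Fin n) ℝ) (L p η : ℝ) (x₀ xs : Vec d) (t : ℕ) : ℝ :=
  ∫ ω, ‖avgIterate F x₀ η ξ W t ω - xs‖ ^ 2 ∂P
    + 16 * (η * L / p) * ∫ ω, consensusError (iterate F (fun _ => x₀) (fun _ => η) ξ W t ω) ∂P

/-- The constant error term of the convex analysis. -/
noncomputable def stepError (n : ℕ) (L p η s ζ : ℝ) : ℝ :=
  3 * η ^ 2 * s ^ 2 / n + 16 * (η * L / p) * (10 * η ^ 2 * ζ ^ 2 / p + 3 * η ^ 2 * s ^ 2)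

theorem stepError_le {L p η s ζ ε : ℝ} (hL : 0 ≤ L) (hη : 0 ≤ η) (hε : 0 ≤ ε)
    (b2 : η * (s ^ 2 / n) ≤ ε / 64)
    (b3 : η ^ 2 * (√L * ζ) ^ 2 / p ^ 2 ≤ ε / 4096) (b4 : η ^ 2 * (√L * s) ^ 2 / p ≤ ε / 4096) :
    4 * stepError n L p η s ζ ≤ η * ε := by
  have e : 4 * stepError n L p η s ζ = η * (12 * (η * (s ^ 2 / n))
      + 640 * (η ^ 2 * (√L * ζ) ^ 2 / p ^ 2) + 192 * (η ^ 2 * (√L * s) ^ 2 / p)) := by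
    rw [stepError, mul_pow, mul_pow, Real.sq_sqrt hL]
    ring
  rw [e]
  refine mul_le_mul_of_nonneg_left ?_ hη
  linarith

theorem lyapunov_zero (h : Setting P 𝓓 F 𝒲 ξ W L p σ y) (η : ℝ) (x₀ xs : Vec d) :
    lyapunov P F ξ W L p η x₀ xs 0 = ‖x₀ - xs‖ ^ 2 := by
  have := h.sampling.prob
  have e1 : ∀ ω, avgIterate F x₀ η ξ W 0 ω = x₀ := fun ω => avg_const h.pos x₀
  have e2 : ∀ ω, consensusError (iterate F (fun _ => x₀) (fun _ => η) ξ W 0 ω) = 0 :=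
    fun ω => consensusError_const h.pos x₀
  simp [lyapunov, e1, e2]

theorem integral_norm_sub_sq_le_lyapunov (h : Setting P 𝓓 F 𝒲 ξ W L p σ y) {η : ℝ} (hη : 0 ≤ η)
    (x₀ xs : Vec d) (t : ℕ) :
    ∫ ω, ‖avgIterate F x₀ η ξ W t ω - xs‖ ^ 2 ∂P ≤ lyapunov P F ξ W L p η x₀ xs t := by
  have h1 : 0 ≤ ∫ ω, consensusError (iterate F (fun _ => x₀) (fun _ => η) ξ W t ω) ∂P :=
    integral_nonneg fun ω => consensusError_nonneg _
  have h2 := h.consensus.pos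
  have h3 := h.smooth.nonneg
  have : 0 ≤ 16 * (η * L / p) *
      ∫ ω, consensusError (iterate F (fun _ => x₀) (fun _ => η) ξ W t ω) ∂P := by positivity
  rw [lyapunov]
  linarith

theorem lyapunov_succ_le (h : Setting P 𝓓 F 𝒲 ξ W L p σ y) {s ζ μ : ℝ} {xs : Vec d}
    (hmin : ∀ x, globalObj 𝓓 F xs ≤ globalObj 𝓓 F x)
    (hN : NoiseBound 𝓓 F L (3 * s ^ 2) (6 * L) (globalObj 𝓓 F xs))
    (hM : MixingBound 𝓓 F 𝒲 (2 * ζ ^ 2) (4 * L) (globalObj 𝓓 F xs))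
    (hμ0 : 0 ≤ μ) (hμ : MuConvex 𝓓 F μ) {η : ℝ} (hη : 0 ≤ η) (hηL : η * L ≤ p / 64)
    (hημ : η * μ ≤ p / 8) (x₀ : Vec d) (t : ℕ) :
    lyapunov P F ξ W L p η x₀ xs (t + 1)
      ≤ (1 - η * μ) * lyapunov P F ξ W L p η x₀ xs t
        - η / 2 * ((∫ ω, globalObj 𝓓 F (avgIterate F x₀ η ξ W t ω) ∂P) - globalObj 𝓓 F xs)
        + stepError n L p η s ζ := by
  have := h.sampling.prob
  have hst := h.isState_iterate (fun _ => x₀) (fun _ => η) t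
  have hD : 0 ≤ (∫ ω, globalObj 𝓓 F (avgIterate F x₀ η ξ W t ω) ∂P) - globalObj 𝓓 F xs := by
    have := integral_mono (μ := P) (integrable_const (globalObj 𝓓 F xs))
      (h.integrable_globalObj (h.memLp_avgIterate x₀ η t)) fun ω => hmin _
    simp only [integral_const, probReal_univ, one_smul] at this
    linarith
  exact lyapunov_step (Nat.one_le_cast.2 h.pos) h.consensus.pos h.consensus.le_one hη
    h.smooth.nonneg hηL hημ hD (integral_nonneg fun ω => consensusError_nonneg _)
    (h.integral_consensusError_step_le hst hN hM hη hηL)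
    (h.integral_norm_avg_step_sub_sq_le hst hμ0 hμ hmin hN hη)

end Setting

theorem MuConvex.mono {μ μ' : ℝ} (h : MuConvex 𝓓 F μ) (hle : μ' ≤ μ) : MuConvex 𝓓 F μ' :=
  fun i x y => le_trans (by gcongr) (h i x y)

/-- Two distinct points would see curvature at least `μ` and at most `L`. The exception is the
one-point space, where `μ` is unconstrained. In the main case `μ ≤ L` transfers the smallness of
`ηL` to `ημ`. -/
theorem MuConvex.le_or_subsingleton (hn : 0 < n) (hO : IsStochObjective 𝓓 F) (hS : LSmooth 𝓓 F L)
    {μ : ℝ} (h : MuConvex 𝓓 F μ) : μ ≤ L ∨ ∀ x y : Vec d, x = y := by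
  by_contra! hcon
  obtain ⟨hlt, x, y, hxy⟩ := hcon
  have h1 := h ⟨0, hn⟩ x y
  have h2 := (abs_le.1 (abs_localObj_sub_sub_inner_le hO hS ⟨0, hn⟩ x y)).2
  rw [← neg_sub x y, inner_neg_right, norm_neg] at h2
  have h3 : 0 < ‖x - y‖ ^ 2 := by
    have := norm_pos_iff.2 (sub_ne_zero.2 hxy)
    positivity
  nlinarith

end Convergence

end DSGD

/-! ### Assembly of the four statements. -/

theorem theorem1 :
    ∃ C : ℝ, 0 < C ∧
    ∀ (d n : ℕ) (_ : 0 < n) (Ξ : Fin n → Type*) [∀ i, MeasurableSpace (Ξ i)]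
      (𝓓 : ∀ i, Measure (Ξ i)) (F : ∀ i, DSGD.Vec d → Ξ i → ℝ)
      (𝒲 : ℕ → Measure (Matrix (Fin n) (Fin n) ℝ))
      (Ω : Type*) [MeasurableSpace Ω] (P : Measure Ω)
      (ξ : ℕ → ∀ i, Ω → Ξ i) (W : ℕ → Ω → Matrix (Fin n) (Fin n) ℝ)
      (L p : ℝ) (x₀ : DSGD.Vec d),
      DSGD.IsStochObjective 𝓓 F →
      DSGD.IsMixingLaw 𝒲 →
      DSGD.IsSampling P 𝓓 𝒲 ξ W →
      DSGD.LSmooth 𝓓 F L →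
      DSGD.ConsensusFactor d 𝒲 p →
      -- non-convex case
      (∀ (σ ζ' fstar : ℝ), 0 ≤ σ → 0 ≤ ζ' →
        DSGD.BoundedVariance 𝓓 F σ →
        DSGD.RelativeHeterogeneity 𝓓 F 𝒲 ζ' →
        IsGLB (Set.range (DSGD.globalObj 𝓓 F)) fstar →
        ∀ ε : ℝ, 0 < ε → ∃ η : ℝ, 0 < η ∧ η * L ≤ p ∧
          (∀ t, Integrable (fun ω =>
            ‖gradient (DSGD.globalObj 𝓓 F) (DSGD.avgIterate F x₀ η ξ W t ω)‖ ^ 2) P) ∧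
          ∀ T : ℕ,
            C * (σ ^ 2 / (n * ε ^ 2) + (ζ' + σ * √p) / (p * ε ^ (3 / 2 : ℝ)) + 1 / (p * ε))
              * (L * (DSGD.globalObj 𝓓 F x₀ - fstar)) ≤ T →
            (1 / ((T : ℝ) + 1)) * ∑ t ∈ Finset.range (T + 1),
              ∫ ω, ‖gradient (DSGD.globalObj 𝓓 F) (DSGD.avgIterate F x₀ η ξ W t ω)‖ ^ 2 ∂P
              ≤ ε) ∧
      -- convex and strongly convex cases
      (∀ (σ ζ' : ℝ) (xstar : DSGD.Vec d), 0 ≤ σ → 0 ≤ ζ' →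
        (∀ x, DSGD.globalObj 𝓓 F xstar ≤ DSGD.globalObj 𝓓 F x) →
        (DSGD.BoundedVariance 𝓓 F σ ∨
          (DSGD.SampleConvex 𝓓 F ∧ DSGD.VarianceAt 𝓓 F σ xstar)) →
        DSGD.MixingErrorAt 𝓓 F 𝒲 ζ' (fun _ => xstar) →
        (∀ μ : ℝ, 0 ≤ μ → DSGD.MuConvex 𝓓 F μ →
          ∀ ε : ℝ, 0 < ε → ∃ η : ℝ, 0 < η ∧ η * L ≤ p ∧
            (∀ t, Integrable (fun ω =>
              DSGD.globalObj 𝓓 F (DSGD.avgIterate F x₀ η ξ W t ω)) P) ∧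
            ∀ T : ℕ,
              C * (σ ^ 2 / (n * ε ^ 2) + √L * (ζ' + σ * √p) / (p * ε ^ (3 / 2 : ℝ)) + L / (p * ε))
                * ‖x₀ - xstar‖ ^ 2 ≤ T →
              (1 / ((T : ℝ) + 1)) * ∑ t ∈ Finset.range (T + 1),
                ((∫ ω, DSGD.globalObj 𝓓 F (DSGD.avgIterate F x₀ η ξ W t ω) ∂P)
                  - DSGD.globalObj 𝓓 F xstar) ≤ ε) ∧
        (∀ μ : ℝ, 0 < μ → DSGD.MuConvex 𝓓 F μ →
          ∀ ε : ℝ, 0 < ε → ∃ (η : ℝ) (w : ℕ → ℝ), 0 < η ∧ η * L ≤ p ∧ (∀ t, 0 < w t) ∧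
            (∀ t, Integrable (fun ω =>
              DSGD.globalObj 𝓓 F (DSGD.avgIterate F x₀ η ξ W t ω)) P) ∧
            (∀ t, Integrable (fun ω =>
              ‖DSGD.avgIterate F x₀ η ξ W t ω - xstar‖ ^ 2) P) ∧
            ∀ T : ℕ,
              C * (σ ^ 2 / (μ * n * ε) + √L * (ζ' + σ * √p) / (μ * p * √ε) + L / (μ * p))
                * Real.log (2 + μ * ‖x₀ - xstar‖ ^ 2 / ε) ≤ T →
              ∑ t ∈ Finset.range (T + 1), w t / (∑ s ∈ Finset.range (T + 1), w s) *
                  ((∫ ω, DSGD.globalObj 𝓓 F (DSGD.avgIterate F x₀ η ξ W t ω) ∂P)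
                    - DSGD.globalObj 𝓓 F xstar)
                + μ * ∫ ω, ‖DSGD.avgIterate F x₀ η ξ W (T + 1) ω - xstar‖ ^ 2 ∂P ≤ ε)) ∧
      -- comparison with the matrix-independent heterogeneity
      (∀ ζ : ℝ, 0 ≤ ζ →
        (DSGD.Heterogeneity 𝓓 F ζ → DSGD.RelativeHeterogeneity 𝓓 F 𝒲 (√(1 - p) * ζ)) ∧
        (∀ xstar : DSGD.Vec d, DSGD.DissimilarityAt 𝓓 F ζ (fun _ => xstar) →
          DSGD.MixingErrorAt 𝓓 F 𝒲 (√(1 - p) * ζ) (fun _ => xstar))) := by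
  -- `256 = 4 · 64`: the 64 sits in the stepsize condition `Q`, the 4 in the horizon `4QR/ε`, or
  -- `4Q/μ` times the logarithm.
  refine ⟨256, by norm_num, ?_⟩
  intro d n hn Ξ _ 𝓓 F 𝒲 Ω _ P ξ W L p x₀ hO hW hI hS hC
  have hP := hI.prob
  have hp := hC.pos
  have hL := hS.nonneg
  have hn' : (0 : ℝ) < n := Nat.cast_pos.2 hn
  refine ⟨?_, ?_, fun ζ _ => ⟨fun h X => (h X).mixingErrorAt hC, fun xs h => h.mixingErrorAt hC⟩⟩
  · intro σ ζ m hσ hζ hV hH hm ε hε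
    have h : DSGD.Setting P 𝓓 F 𝒲 ξ W L p σ 0 := ⟨hn, hO, hS, hW, hC, hI, hV 0⟩
    have hlow : ∀ x, m ≤ DSGD.globalObj 𝓓 F x := fun x => hm.1 ⟨x, rfl⟩
    obtain ⟨η, hη, hQ, hT⟩ := DSGD.exists_stepsize
      (Q := 64 * (L * σ ^ 2 / n / ε + (L * ζ + L * σ * √p) / (p * √ε) + L / p))
      (R := DSGD.globalObj 𝓓 F x₀ - m) (ε := ε) (by positivity) (sub_nonneg.2 (hlow x₀)) hε
    have hb := DSGD.stepsize_bounds hη.le (by positivity) (by positivity) (by positivity)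
      hL hp hε hQ
    refine ⟨η, hη, by linarith [hb.1], fun t => (h.memLp_gradient_globalObj
      (h.measurable_avgIterate x₀ η t) (h.memLp_avgIterate x₀ η t)).integrable_norm_sq,
      fun T hT' => ?_⟩
    refine h.average_gradient_le hσ hζ (hV.noiseBound hO hS m) (hH.mixingBound hn m) hlow hε hη hQ
      x₀ (hT T (le_trans (le_of_eq ?_) hT'))
    rw [DSGD.rpow_three_halves hε]
    have := Real.sqrt_pos.2 hε
    field_simp
    ring
  · intro σ ζ xs hσ hζ hmin hV hH
    have hVs : DSGD.VarianceAt 𝓓 F σ xs := hV.elim (fun h => h xs) fun h => h.2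
    have h : DSGD.Setting P 𝓓 F 𝒲 ξ W L p σ xs := ⟨hn, hO, hS, hW, hC, hI, hVs⟩
    have hN : DSGD.NoiseBound 𝓓 F L (3 * σ ^ 2) (6 * L) (DSGD.globalObj 𝓓 F xs) := hV.elim
      (fun h => (h.noiseBound hO hS _).mono (by positivity) hmin)
      (fun h => h.1.noiseBound hn hO hS h.2 hmin)
    have hM : ∀ μ : ℝ, 0 ≤ μ → DSGD.MuConvex 𝓓 F μ →
        DSGD.MixingBound 𝓓 F 𝒲 (2 * ζ ^ 2) (4 * L) (DSGD.globalObj 𝓓 F xs) :=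
      fun μ hμ0 hμ => hH.mixingBound hn hO hS hW hC (hμ.mono hμ0) hmin
    constructor
    · intro μ hμ0 hμ ε hε
      obtain ⟨η, hη, hQ, hT⟩ := DSGD.exists_stepsize
        (Q := 64 * (σ ^ 2 / n / ε + (√L * ζ + √L * σ * √p) / (p * √ε) + L / p))
        (R := ‖x₀ - xs‖ ^ 2) (ε := ε) (by positivity) (by positivity) hε
      obtain ⟨b1, b2, b3, b4⟩ := DSGD.stepsize_bounds hη.le (by positivity) (by positivity)
        (by positivity) hL hp hε hQ
      refine ⟨η, hη, by linarith, fun t => h.integrable_globalObj (h.memLp_avgIterate x₀ η t),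
        fun T hT' => ?_⟩
      refine DSGD.average_le_of_descent (Φ := DSGD.Setting.lyapunov P F ξ W L p η x₀ xs)
        (E := DSGD.Setting.stepError n L p η σ ζ) (m := 0) hη (fun t => ?_) (fun t => ?_)
        (DSGD.Setting.stepError_le hL hη.le hε.le b2 b3 b4) ?_
      -- The uniform average needs no contraction, so the recursion is used with modulus 0.
      · have := h.lyapunov_succ_le hmin hN (hM μ hμ0 hμ) le_rfl (hμ.mono hμ0) hη.le b1
          (by rw [mul_zero]; positivity) x₀ t
        rwa [mul_zero, sub_zero, one_mul] at this
      · exact (integral_nonneg fun ω => sq_nonneg _).trans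
          (h.integral_norm_sub_sq_le_lyapunov hη.le x₀ xs t)
      · rw [h.lyapunov_zero, sub_zero]
        refine hT T (le_trans (le_of_eq ?_) hT')
        rw [DSGD.rpow_three_halves hε]
        have := Real.sqrt_pos.2 hε
        field_simp
        ring
    · intro μ hμ0 hμ ε hε
      rcases hμ.le_or_subsingleton hn hO hS with hμL | hsub
      -- Positivity of `L` makes `Q` positive, so that `η = 1/Q` can be taken exactly.
      · have hLpos : 0 < L := hμ0.trans_le hμL
        set Q := 64 * (σ ^ 2 / n / ε + (√L * ζ + √L * σ * √p) / (p * √ε) + L / p) with hQdef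
        have hQpos : 0 < Q := by
          have : 0 < L / p := by positivity
          have : 0 ≤ σ ^ 2 / n / ε + (√L * ζ + √L * σ * √p) / (p * √ε) := by positivity
          linarith
        set η := 1 / Q with hηdef
        have hη : 0 < η := by positivity
        have hQ : η * Q ≤ 1 := (one_div_mul_cancel hQpos.ne').le
        obtain ⟨b1, b2, b3, b4⟩ := DSGD.stepsize_bounds hη.le (by positivity) (by positivity)
          (by positivity) hL hp hε hQ
        have hημ : η * μ ≤ p / 64 := (mul_le_mul_of_nonneg_left hμL hη.le).trans b1
        have hημ1 : η * μ < 1 := by linarith [hC.le_one]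
        refine ⟨η, fun t => ((1 - η * μ) ^ (t + 1))⁻¹, hη, by linarith, fun t => ?_,
          fun t => h.integrable_globalObj (h.memLp_avgIterate x₀ η t),
          fun t => ((h.memLp_avgIterate x₀ η t).sub (memLp_const xs)).integrable_norm_sq,
          fun T hT => ?_⟩
        · have : 0 < 1 - η * μ := by linarith
          positivity
        refine DSGD.weighted_average_le (Φ := DSGD.Setting.lyapunov P F ξ W L p η x₀ xs)
          (R := fun t => ∫ ω, ‖DSGD.avgIterate F x₀ η ξ W t ω - xs‖ ^ 2 ∂P) hη hμ0 hημ1 hε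
          (h.lyapunov_succ_le hmin hN (hM μ hμ0.le hμ) hμ0.le hμ hη.le b1 (by linarith) x₀)
          (h.integral_norm_sub_sq_le_lyapunov hη.le x₀ xs)
          (fun t => integral_nonneg fun ω => sq_nonneg _)
          (DSGD.Setting.stepError_le hL hη.le hε.le b2 b3 b4) ?_
        rw [h.lyapunov_zero]
        set l := Real.log (2 + μ * ‖x₀ - xs‖ ^ 2 / ε) with hl
        have hl0 : 0 ≤ l := Real.log_nonneg (by
          have : 0 ≤ μ * ‖x₀ - xs‖ ^ 2 / ε := by positivity
          linarith)
        have e : 256 * (σ ^ 2 / (μ * n * ε) + √L * (ζ + σ * √p) / (μ * p * √ε) + L / (μ * p))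
            = 4 * (Q / μ) := by
          have := Real.sqrt_pos.2 hε
          rw [hQdef]
          field_simp
          ring
        rw [e] at hT
        have h1 := mul_le_mul_of_nonneg_left hT (by positivity : 0 ≤ η * μ)
        have e2 : η * μ * (4 * (Q / μ) * l) = 4 * l := by
          rw [hηdef]
          field_simp
        linarith
      -- In a one-point space every iterate is the minimizer; `p/(L+1)` is merely some admissible
      -- stepsize, also when `L = 0`.
      · have e : ∀ (η : ℝ) t ω, DSGD.avgIterate F x₀ η ξ W t ω = xs := fun η t ω => hsub _ _
        refine ⟨p / (L + 1), fun _ => 1, by positivity, ?_, fun _ => one_pos, fun t => ?_,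
          fun t => ?_, fun T _ => ?_⟩
        · rw [div_mul_eq_mul_div, div_le_iff₀ (by positivity)]
          nlinarith
        · simp [e]
        · simp [e]
        · simpa [e] using hε.le
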